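/- **Setting.** Logarithms are base 2, $\mathbb B=\{0,1\}$, $s$ ranges over the integers $\ge 1$. $K(x|y)$ is conditional prefix Kolmogorov complexity with respect to a fixed optimal prefix machine ($K(x)=K(x|\epsilon)$), and $Km(x|y)$ is conditional monotone complexity with respect to a fixed optimal monotone machine (the length of a shortest program whose output starts with $x$, given the string $y$). For a real constant $c$ put $d_K(x,y)=\max\{K(x|y),K(y|x)\}+c$ if $x\ne y$ and $d_K(x,x)=0$; $d_{Km}$ is defined in the same way from $Km$. Let $(\mathcal V,d)$ be a metric space. Functions $\phi_s:\mathcal V\to\mathbb B^*$ form a *string-embedding* with respect to a distance $D$ on $\mathbb B^*$ if there are constants $a,b$ with $|D(\phi_s(v),\phi_s(v'))-s\,d(v,v')|\le a\log s+b$ for all $s\ge 1$ and all $v,v'\in\mathcal V$. A map $\phi:\mathcal V\to\mathbb B^\infty$ with a function $f(s,v)\in\mathbb N$, nondecreasing in $s$, is a *sequence-embedding* if $\phi_s(v)=\phi(v)_{1:f(s,v)}$ is a string-embedding. **Random embeddings.** Let $P$ be a computable probability measure on $\mathbb B^\infty$, $\Omega\subseteq\mathbb B^\infty$ a set with $P(\Omega)=1$,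 and $\Phi_s:\mathcal V\times\Omega\to\mathbb B^*$. Write $X_v^s=\Phi_s(v,\cdot)$, let $P[X|Y]$ be the random variable $\omega\mapsto P(X=X(\omega)\mid Y=Y(\omega))$, and put $D^s_{vv'}=\max\{-\log P[X^s_v|X^s_{v'}],-\log P[X^s_{v'}|X^s_v]\}$. $\Phi_s$ is a *random scale-embedding* if 1. for each $\omega\in\Omega$: all the $P[X^s_v|X^s_{v'}](\omega)$ are positive, and there are $a,b$ with $|D^s_{vv'}(\omega)-s\,d(v,v')|\le a\log s+b$ for all $s\ge1$ and $v,v'\in\mathcal V$; 2. each $v$ has for each $s$ a representative $\dot v_s\in\mathcal V$ with $\Phi_s(\dot v_s,\omega)=\Phi_s(v,\omega)$ for all $\omega\in\Omega$, and for some constants $c',a'$ the set $\dot{\mathcal V}_s=\{\dot v_s:v\in\mathcal V\}$ has at most $(s+c')^{a'}$ elements for every $s$; 3. $\Phi_s$ is computable uniformly in $s$: the representatives have names $n_s(\dot v_s)\in\mathbb N$, the names in use at scale $s$ are enumerable uniformly in $s$, and $\Phi_s(\dot v_s,\omega)$ is computable from $s$, $n_s(\dot v_s)$ and the oracle $\omega\in\Omega$.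 It is a *random sequence-embedding* if moreover $\Phi_s(v,\omega)=\Phi(v,\omega)_{1:f(s,v)}$ for some $\Phi:\mathcal V\times\Omega\to\mathbb B^\infty$ and some $f$ nondecreasing in $s$, where a name stands for one infinite random sequence: if two representatives, possibly at different scales, have the same name, then for every $\omega\in\Omega$ one of their two strings is an initial segment of the other. **Theorem.** (A) Let $\Phi_s$ be a random scale-embedding. * (Derandomization.) There is a constant $C$, independent of $s,\delta,v,v'$, such that for each $s\ge 1$ and all weights $\delta_{ww'}>0$ with $\sum_{w,w'\in\dot{\mathcal V}_s}\delta_{ww'}<1$ there is $\omega_0^s\in\Omega$ such that, for all $v,v'\in\mathcal V$ and $x_v^s=\Phi_s(v,\omega_0^s)$, $$|d_K(x^s_v,x^s_{v'})-D^s_{vv'}(\omega^s_0)|\le\max\{-\log\delta_{\dot v_s\dot v'_s},\,-\log\delta_{\dot v'_s\dot v_s},\,K(s,n_s(\dot v_s),n_s(\dot v'_s))\}+C .$$ * There is $\omega_0\in\Omega$ such that $\phi_s=\Phi_s(\cdot,\omega_0)$ is a string-embedding with respect to $d_K$. * Every $P$-Martin-Löf-random $\omega_0\in\Omega$ has this property.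 If $P(\omega_{1:n})=2^{-n}$ is the uniform measure, so does every $K$-random $\omega_0\in\Omega$, i.e. every $\omega_0$ with $K(\omega_{0,1:n})\ge n-O(1)$ for all $n$. (B) Let $\Phi_s$ be a random sequence-embedding with $\Phi$ and $f$ as above. * (Derandomization.) There is a constant $C$, independent of $\delta,s,v,v'$, such that for all weights $\delta^s_{ww'}>0$ with $\sum_{s\ge1}\sum_{w,w'\in\dot{\mathcal V}_s}\delta^s_{ww'}<1$ there is a single $\omega_0\in\Omega$ such that, for all $s\ge 1$, $v,v'\in\mathcal V$ and $x_v^s=\Phi_s(v,\omega_0)$, $$|d_{Km}(x^s_v,x^s_{v'})-D^s_{vv'}(\omega_0)|\le\max\{-\log\delta^s_{\dot v_s\dot v'_s},\,-\log\delta^s_{\dot v'_s\dot v_s},\,K(n_s(\dot v_s),n_s(\dot v'_s))\}+C .$$ * There is $\omega_0\in\Omega$ such that $\phi=\Phi(\cdot,\omega_0)$, with the length function $f$, is a sequence-embedding both with respect to $d_K$ and with respect to $d_{Km}$. * Every $P$-Martin-Löf-random $\omega_0\in\Omega$ has this property; if $P$ is the uniform measure, so does every $K$-random $\omega_0\in\Omega$.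 -/

import Mathlib

open MeasureTheory

/-! ### Strings, sequences -/

/-- The string `ω_{1:t}` of the first `t` bits of the infinite sequence `ω`. -/
def initSeg (ω : ℕ → Bool) (t : ℕ) : List Bool := (List.range t).map ω

/-- The set of all infinite sequences that start with the string `σ`. -/
def cylinderSet (σ : List Bool) : Set (ℕ → Bool) := {ω | initSeg ω σ.length = σ}

/-- Two strings are comparable if one of them is an initial segment of the other one. -/
def StrComparable (x y : List Bool) : Prop := x <+: y ∨ y <+: x

/-! ### Conditional prefix complexity -/

/-- A prefix machine: a partial computable function `U (program) (condition)` such that for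
each condition the set of halting programs is prefix-free. -/
structure IsPrefixMachine (U : List Bool → List Bool →. List Bool) : Prop where
  partrec : Partrec₂ U
  prefixFree : ∀ y p q : List Bool, (U p y).Dom → (U q y).Dom → p <+: q → p = q

/-- An (additively) optimal reference prefix machine. -/
structure IsOptimalPrefixMachine (U : List Bool → List Bool →. List Bool) : Prop where
  isPrefixMachine : IsPrefixMachine U
  optimal : ∀ T : List Bool → List Bool →. List Bool, IsPrefixMachine T →
    ∃ c : ℕ, ∀ p y x : List Bool, x ∈ T p y → ∃ q : List Bool, x ∈ U q y ∧ q.length ≤ p.length + c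

/-- `K(x|y)`, the length of a shortest `U`-program for `x` given `y`. -/
noncomputable def condK (U : List Bool → List Bool →. List Bool) (x y : List Bool) : ℕ :=
  sInf {l : ℕ | ∃ p : List Bool, x ∈ U p y ∧ p.length = l}

/-- `K(x)`, that is, `K(x|y)` for the empty condition `y`. -/
noncomputable def plainK (U : List Bool → List Bool →. List Bool) (x : List Bool) : ℕ :=
  condK U x []

/-- `K(m,n)` for a pair of natural numbers. -/
noncomputable def pairK (U : List Bool → List Bool →. List Bool) (m n : ℕ) : ℕ :=
  plainK U (Nat.bits (Nat.pair m n))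

/-- `K(l,m,n)` for a triple of natural numbers. -/
noncomputable def tripleK (U : List Bool → List Bool →. List Bool) (l m n : ℕ) : ℕ :=
  plainK U (Nat.bits (Nat.pair l (Nat.pair m n)))

/-! ### Conditional monotone complexity -/

/-- A monotone machine (with condition), given as the computably enumerable relation
`M p y x`: "having read the program bits `p`, on the condition `y`, the machine has
produced at least the output bits `x`".  Reading more program bits can only extend the output. -/
structure IsMonotoneMachine (M : List Bool → List Bool → List Bool → Prop) : Prop where
  enumerable : REPred fun t : List Bool × List Bool × List Bool => M t.1 t.2.1 t.2.2
  coherent : ∀ y p q x x' : List Bool, M p y x → M q y x' → p <+: q → StrComparable x x'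

/-- An (additively) optimal reference monotone machine. -/
structure IsOptimalMonotoneMachine (M : List Bool → List Bool → List Bool → Prop) : Prop where
  isMonotoneMachine : IsMonotoneMachine M
  optimal : ∀ T : List Bool → List Bool → List Bool → Prop, IsMonotoneMachine T →
    ∃ c : ℕ, ∀ p y x : List Bool, T p y x →
      ∃ q x' : List Bool, M q y x' ∧ x <+: x' ∧ q.length ≤ p.length + c

/-- `Km(x|y)`, the length of a shortest program on which the output of `M` starts with `x`,
given `y`. -/
noncomputable def condKm (M : List Bool → List Bool → List Bool → Prop) (x y : List Bool) : ℕ :=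
  sInf {l : ℕ | ∃ p x' : List Bool, M p y x' ∧ x <+: x' ∧ p.length = l}

/-! ### Complexity distances -/

/-- `max {C(x|y), C(y|x)} + c` for `x ≠ y`, and `0` for `x = y`. -/
noncomputable def complexityDist (C : List Bool → List Bool → ℕ) (c : ℝ) (x y : List Bool) : ℝ :=
  if x = y then 0 else max (C x y : ℝ) (C y x : ℝ) + c

/-- The complexity distance `d_K`. -/
noncomputable def distK (U : List Bool → List Bool →. List Bool) (c : ℝ) :
    List Bool → List Bool → ℝ := complexityDist (condK U) c

/-- The complexity distance `d_Km`, with monotone complexity in place of prefix complexity. -/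
noncomputable def distKm (M : List Bool → List Bool → List Bool → Prop) (c : ℝ) :
    List Bool → List Bool → ℝ := complexityDist (condKm M) c

/-! ### Scale-embeddings -/

/-- String-embedding into `(𝔹*, D)`: `D (φ_s v) (φ_s v') = s * d(v,v') ± O(log s)`, with
constants that do not depend on `s, v, v'`. -/
def IsStringEmbedding {V : Type*} [MetricSpace V] (D : List Bool → List Bool → ℝ)
    (φ : ℕ → V → List Bool) : Prop :=
  ∃ a b : ℝ, ∀ s : ℕ, 1 ≤ s → ∀ v v' : V,
    |D (φ s v) (φ s v') - s * dist v v'| ≤ a * Real.logb 2 s + b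

/-- Sequence-embedding into `(𝔹*, D)` with length function `f`, monotone in `s`. -/
def IsSequenceEmbedding {V : Type*} [MetricSpace V] (D : List Bool → List Bool → ℝ)
    (φ : V → ℕ → Bool) (f : ℕ → V → ℕ) : Prop :=
  (∀ v : V, Monotone fun s => f s v) ∧
    IsStringEmbedding D fun s v => initSeg (φ v) (f s v)

/-! ### Computable probability measures and randomness -/

/-- A computable probability measure on the space of infinite binary sequences: the
probabilities of cylinders are uniformly computable reals. -/
structure IsComputableProb (P : Measure (ℕ → Bool)) : Prop where
  isProb : IsProbabilityMeasure P
  computable : ∃ g : List Bool → ℕ → ℕ, Computable₂ g ∧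
    ∀ (σ : List Bool) (k : ℕ), |P.real (cylinderSet σ) - (g σ k : ℝ) / 2 ^ k| ≤ 1 / 2 ^ k

/-- `P(ω_{1:n}) = 2^{-n}`. -/
def IsUniformMeasure (P : Measure (ℕ → Bool)) : Prop :=
  ∀ σ : List Bool, P (cylinderSet σ) = ((2 : ENNReal)⁻¹) ^ σ.length

/-- The open set generated by the strings in the `k`-th section of `W`. -/
def testSet (W : ℕ × List Bool → Prop) (k : ℕ) : Set (ℕ → Bool) :=
  {ω | ∃ σ : List Bool, W (k, σ) ∧ ω ∈ cylinderSet σ}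

/-- `P`-Martin-Löf randomness: `ω` passes every sequential `P`-test. -/
def IsMartinLofRandom (P : Measure (ℕ → Bool)) (ω : ℕ → Bool) : Prop :=
  ∀ W : ℕ × List Bool → Prop, REPred W → (∀ k : ℕ, P (testSet W k) ≤ ((2 : ENNReal)⁻¹) ^ k) →
    ∃ k : ℕ, ω ∉ testSet W k

/-- `K`-randomness of an infinite sequence: its initial segments are incompressible up to an
additive constant. -/
def IsKRandom (U : List Bool → List Bool →. List Bool) (ω : ℕ → Bool) : Prop :=
  ∃ b : ℕ, ∀ n : ℕ, n ≤ plainK U (initSeg ω n) + b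

/-! ### Random scale-embeddings

The sample space `Ω` is a set of infinite binary sequences of full measure.  Random variables
are functions on all sequences, but only their values on `Ω` are ever used. -/

/-- The random variable `P[X|Y]`: its value at `ω` is the conditional probability of
`X = X(ω)` given `Y = Y(ω)`. -/
noncomputable def condProb (Ω : Set (ℕ → Bool)) (P : Measure (ℕ → Bool))
    (X Y : (ℕ → Bool) → List Bool) (ω : ℕ → Bool) : ℝ :=
  P.real {ω' | ω' ∈ Ω ∧ X ω' = X ω ∧ Y ω' = Y ω} / P.real {ω' | ω' ∈ Ω ∧ Y ω' = Y ω}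

/-- `max {-log P[X|Y], -log P[Y|X]}`. -/
noncomputable def randDist (Ω : Set (ℕ → Bool)) (P : Measure (ℕ → Bool))
    (X Y : (ℕ → Bool) → List Bool) (ω : ℕ → Bool) : ℝ :=
  max (-Real.logb 2 (condProb Ω P X Y ω)) (-Real.logb 2 (condProb Ω P Y X ω))

/-- The set of representatives at scale `s`. -/
def repSet {V : Type*} (rep : ℕ → V → V) (s : ℕ) : Set V := Set.range (rep s)

/-- Computability of the family `Φ_s`, uniformly in `s`.  The metric space `V` is arbitrary
(possibly uncountable), so each representative `w` at scale `s` is given to a machine by a name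
`name s w`.  The names in use at scale `s` can be enumerated uniformly in `s`, and
`Φ_s(w, ω)` is computed from `s`, the name of `w` and the oracle `ω`, of which each computation
reads a finite part only. -/
structure IsComputableFamily {V : Type*} (Ω : Set (ℕ → Bool)) (rep : ℕ → V → V)
    (name : ℕ → V → ℕ) (Φ : ℕ → V → (ℕ → Bool) → List Bool) : Prop where
  names_enumerable : REPred fun t : ℕ × ℕ => 1 ≤ t.1 ∧ ∃ w ∈ repSet rep t.1, name t.1 w = t.2
  computable : ∃ R : ℕ × ℕ × List Bool × List Bool → Prop, REPred R ∧
    ∀ s : ℕ, 1 ≤ s → ∀ w ∈ repSet rep s, ∀ ω ∈ Ω, ∀ x : List Bool,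
      Φ s w ω = x ↔ ∃ t : ℕ, R (s, name s w, initSeg ω t, x)

/-- Random scale-embedding of `V`, with sample space `(Ω, P)`; `rep s v` is the representative
of `v` at scale `s`. -/
structure IsRandomScaleEmbedding {V : Type*} [MetricSpace V] (Ω : Set (ℕ → Bool))
    (P : Measure (ℕ → Bool)) (rep : ℕ → V → V) (name : ℕ → V → ℕ)
    (Φ : ℕ → V → (ℕ → Bool) → List Bool) : Prop where
  prob : IsComputableProb P
  full : P Ωᶜ = 0
  computable : IsComputableFamily Ω rep name Φ
  rep_eq : ∀ s : ℕ, 1 ≤ s → ∀ v : V, ∀ ω ∈ Ω, Φ s (rep s v) ω = Φ s v ω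
  poly : ∃ c a : ℕ, ∀ s : ℕ, 1 ≤ s → (repSet rep s).encard ≤ (((s + c) ^ a : ℕ) : ℕ∞)
  /- No outcome in `Ω` makes a conditional probability vanish (`-log 0` is infinite). -/
  pos : ∀ s : ℕ, 1 ≤ s → ∀ v v' : V, ∀ ω ∈ Ω, 0 < condProb Ω P (Φ s v) (Φ s v') ω
  /- The constants are uniform in `s, v, v'`. -/
  scale : ∀ ω ∈ Ω, ∃ a b : ℝ, ∀ s : ℕ, 1 ≤ s → ∀ v v' : V,
    |randDist Ω P (Φ s v) (Φ s v') ω - s * dist v v'| ≤ a * Real.logb 2 s + b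

/-- Random sequence-embedding: in addition, `Φ_s(v,ω)` consists of the first `f(s,v)` bits of an
infinite sequence `Φinf v ω`, with `f` monotone in `s`.  A name stands for one infinite random
sequence: outputs with the same name at different scales are initial segments of one sequence.
(This is no restriction, since a name may contain `s`.  For finite `V` one names each point
once and for all.) -/
structure IsRandomSequenceEmbedding {V : Type*} [MetricSpace V] (Ω : Set (ℕ → Bool))
    (P : Measure (ℕ → Bool)) (rep : ℕ → V → V) (name : ℕ → V → ℕ)
    (Φ : ℕ → V → (ℕ → Bool) → List Bool) (Φinf : V → (ℕ → Bool) → ℕ → Bool)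
    (f : ℕ → V → ℕ) : Prop where
  toRandom : IsRandomScaleEmbedding Ω P rep name Φ
  mono : ∀ v : V, Monotone fun s => f s v
  eq_initSeg : ∀ s : ℕ, 1 ≤ s → ∀ v : V, ∀ ω ∈ Ω, Φ s v ω = initSeg (Φinf v ω) (f s v)
  coherent : ∀ s s' : ℕ, 1 ≤ s → 1 ≤ s' → ∀ w ∈ repSet rep s, ∀ w' ∈ repSet rep s',
    name s w = name s' w' → ∀ ω ∈ Ω, StrComparable (Φ s w ω) (Φ s' w' ω)

/-! ### Computability -/

-- Let `X`, `Y` be the random strings of two names at scale `s`. The theorem rests on comparing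
-- `K(X|Y)` with `-log P[X|Y]` from both sides.
--
-- Upper bound, valid at every outcome of `Ω`. Up to null sets the events `X = x`, `Y = y` and `Y ≠
-- y` are enumerable open sets, so for computable `P` the inequality `2^l P(X=x, Y=y) > 2 P(Y=y)` is
-- enumerable. Whenever it holds, a codeword of length `l` is requested for `x`. For one `x` the
-- admissible `l` form a geometric series of sum at most `P(x|y)`, hence the Kraft sum for each `y`
-- is at most one. The Kraft-Chaitin construction (`exists_prefix_code`,
-- `IsOptimalPrefixMachine.coding`) yields `K(x|y) ≤ -log P(x|y) + K(s,n,n') + O(1)`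
-- (`exists_condK_le`). For `Km` the description must not contain `s`. There `exists_condKm_le` uses
-- arithmetic coding: a program is a dyadic interval inside the interval of conditional cumulative
-- probabilities of `x`, and a name stands for one infinite sequence, so all scales share one
-- monotone machine.
--
-- Lower bound, valid for most outcomes. Since `∑_x 2^{-K(x|y)} ≤ 1`, the event `P[X|Y] 2^{K(X|Y)} <
-- δ` has probability at most `δ` (`measure_condProb_lt_le`). The same holds for `Km`, because at
-- one scale the values of `X` have equal length. The union bound over pairs of representatives, and
-- over scales in the sequence case, gives the derandomized outcome.
--
-- Logarithmic error. There are polynomially many representatives, so weights `δ` of inverse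
-- polynomial size are summable over all scales, and `K(s,n,n') = O(log s)` (`exists_tripleK_le`).
-- With weights scaled by `2^{-k}` the exceptional events form a Martin-Löf test (`exists_test`), so
-- every Martin-Löf random outcome in `Ω` works; for the uniform measure `K`-randomness implies
-- Martin-Löf randomness (`IsKRandom.isMartinLofRandom`).

attribute [fun_prop] Computable
attribute [fun_prop] Computable.id Computable.const Computable.comp Computable.pair

section Computability

variable {α β γ σ : Type*} [Primcodable α] [Primcodable β] [Primcodable γ] [Primcodable σ]

/-! ### Computable functions, as rules for `fun_prop` -/

namespace Computable

@[fun_prop] theorem fst_comp {f : α → β × γ} (hf : Computable f) :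
    Computable fun a => (f a).1 := Computable.fst.comp hf

@[fun_prop] theorem snd_comp {f : α → β × γ} (hf : Computable f) :
    Computable fun a => (f a).2 := Computable.snd.comp hf

@[fun_prop] theorem unpair_comp {f : α → ℕ} (hf : Computable f) :
    Computable fun a => (f a).unpair := Computable.unpair.comp hf

@[fun_prop] theorem natPair_comp {f g : α → ℕ} (hf : Computable f) (hg : Computable g) :
    Computable fun a => Nat.pair (f a) (g a) := Primrec₂.natPair.to_comp.comp hf hg

@[fun_prop] theorem add_comp {f g : α → ℕ} (hf : Computable f) (hg : Computable g) :
    Computable fun a => f a + g a := Primrec.nat_add.to_comp.comp hf hg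

@[fun_prop] theorem sub_comp {f g : α → ℕ} (hf : Computable f) (hg : Computable g) :
    Computable fun a => f a - g a := Primrec.nat_sub.to_comp.comp hf hg

@[fun_prop] theorem mul_comp {f g : α → ℕ} (hf : Computable f) (hg : Computable g) :
    Computable fun a => f a * g a := Primrec.nat_mul.to_comp.comp hf hg

@[fun_prop] theorem pow_comp {f g : α → ℕ} (hf : Computable f) (hg : Computable g) :
    Computable fun a => f a ^ g a :=
  (Primrec₂.unpaired'.1 Nat.Primrec.pow).to_comp.comp hf hg

@[fun_prop] theorem length_comp {f : α → List β} (hf : Computable f) :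
    Computable fun a => (f a).length := Computable.list_length.comp hf

@[fun_prop] theorem append_comp {f g : α → List β} (hf : Computable f) (hg : Computable g) :
    Computable fun a => f a ++ g a := Computable.list_append.comp hf hg

@[fun_prop] theorem take_comp {f : α → ℕ} {g : α → List β} (hf : Computable f)
    (hg : Computable g) : Computable fun a => (g a).take (f a) :=
  Primrec.list_take.to_comp.comp hf hg

@[fun_prop] theorem and_comp {f g : α → Bool} (hf : Computable f) (hg : Computable g) :
    Computable fun a => f a && g a := Primrec.and.to_comp.comp hf hg

@[fun_prop] theorem or_comp {f g : α → Bool} (hf : Computable f) (hg : Computable g) :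
    Computable fun a => f a || g a := Primrec.or.to_comp.comp hf hg

@[fun_prop] theorem not_comp {f : α → Bool} (hf : Computable f) :
    Computable fun a => !f a := Primrec.not.to_comp.comp hf

@[fun_prop] theorem decide_lt {f g : α → ℕ} (hf : Computable f) (hg : Computable g) :
    Computable fun a => decide (f a < g a) := Primrec.nat_lt.decide.to_comp.comp hf hg

@[fun_prop] theorem decide_le {f g : α → ℕ} (hf : Computable f) (hg : Computable g) :
    Computable fun a => decide (f a ≤ g a) := Primrec.nat_le.decide.to_comp.comp hf hg

@[fun_prop] theorem decide_eq [DecidableEq β] {f g : α → β} (hf : Computable f)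
    (hg : Computable g) : Computable fun a => decide (f a = g a) :=
  (Primrec.eq (α := β)).decide.to_comp.comp hf hg

@[fun_prop] theorem cond_comp {c : α → Bool} {f g : α → σ} (hc : Computable c)
    (hf : Computable f) (hg : Computable g) : Computable fun a => bif c a then f a else g a :=
  Computable.cond hc hf hg

@[fun_prop] theorem encode_comp {f : α → β} (hf : Computable f) :
    Computable fun a => Encodable.encode (f a) := Computable.encode.comp hf

/-- Bounded sums of computable functions are computable. -/
theorem sum_range {f : α → ℕ} {g : α → ℕ → ℕ} (hf : Computable f)
    (hg : Computable fun p : α × ℕ => g p.1 p.2) :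
    Computable fun a => ∑ i ∈ Finset.range (f a), g a i := by
  have h : Computable fun a => (Nat.rec (motive := fun _ => ℕ) 0
      (fun i r => r + g a i) (f a) : ℕ) :=
    Computable.nat_rec hf (Computable.const 0)
      (h := fun (a : α) (p : ℕ × ℕ) => p.2 + g a p.1)
      (Computable.add_comp (by fun_prop) (hg.comp (g := fun p : α × ℕ × ℕ => (p.1, p.2.1))
        (by fun_prop)))
  refine h.of_eq fun a => ?_
  induction f a with
  | zero => simp
  | succ n ih => rw [Finset.sum_range_succ, ← ih]

/-- Bounded existential quantification of a decidable predicate. -/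
theorem bounded_exists {f : α → ℕ} {g : α → ℕ → Bool} (hf : Computable f)
    (hg : Computable fun p : α × ℕ => g p.1 p.2) :
    Computable fun a => decide (∃ i < f a, g a i = true) := by
  -- Counting the witnesses reduces the quantifier to a bounded sum.
  have h : Computable fun a => decide (0 < ∑ i ∈ Finset.range (f a),
      bif g a i then 1 else 0) :=
    Computable.decide_lt (Computable.const 0) (Computable.sum_range hf (by fun_prop))
  refine h.of_eq fun a => ?_
  rw [decide_eq_decide, Nat.pos_iff_ne_zero, ne_eq, Finset.sum_eq_zero_iff]
  push Not
  refine exists_congr fun i => ?_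
  cases g a i <;> simp

end Computable

/-! ### Closure properties of enumerable predicates -/

namespace REPred

/-- The normal form behind all closure properties: halting within `n` steps is decidable, and
conversely an unbounded search for a witness halts exactly on the predicate. -/
theorem iff_exists_computable {p : α → Prop} :
    REPred p ↔ ∃ q : α × ℕ → Bool, Computable q ∧ ∀ a, p a ↔ ∃ n, q (a, n) = true := by
  constructor
  · intro hp
    obtain ⟨c, hc⟩ := Nat.Partrec.Code.exists_code.1 hp
    refine ⟨fun t => (Nat.Partrec.Code.evaln t.2 c (Encodable.encode t.1)).isSome, ?_, ?_⟩
    · have h1 : Computable fun t : α × ℕ =>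
          Nat.Partrec.Code.evaln t.2 c (Encodable.encode t.1) :=
        Nat.Partrec.Code.primrec_evaln.to_comp.comp
          (g := fun t : α × ℕ => ((t.2, c), Encodable.encode t.1))
          (((Computable.snd).pair (Computable.const c)).pair
            (Computable.encode.comp Computable.fst))
      exact Primrec.option_isSome.to_comp.comp h1
    · intro a
      have h2 : (Nat.Partrec.Code.eval c (Encodable.encode a)).Dom ↔ p a := by
        rw [hc]
        simp [Part.bind_some, Part.assert]
      rw [← h2, Part.dom_iff_mem]
      simp only [Option.isSome_iff_exists, Nat.Partrec.Code.evaln_complete, Option.mem_def]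
      exact exists_comm
  · rintro ⟨q, hq, h⟩
    have h1 : Partrec fun a => Nat.rfind fun n => Part.some (q (a, n)) :=
      Partrec.rfind (p := fun a n => Part.some (q (a, n))) hq.partrec
    refine h1.dom_re.of_eq fun a => ?_
    refine Nat.rfind_dom'.trans ?_
    rw [h]
    constructor
    · rintro ⟨n, hn, -⟩
      exact ⟨n, by simpa using hn⟩
    · rintro ⟨n, hn⟩
      exact ⟨n, by simpa using hn, fun _ => trivial⟩

theorem of_computable {q : α → Bool} (hq : Computable q) : REPred fun a => q a = true :=
  iff_exists_computable.2 ⟨fun t => q t.1, by fun_prop, by simp⟩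

theorem of_decide {p : α → Prop} [DecidablePred p] (hq : Computable fun a => decide (p a)) :
    REPred p :=
  (of_computable hq).of_eq (by simp)

theorem le {f g : α → ℕ} (hf : Computable f) (hg : Computable g) : REPred fun a => f a ≤ g a :=
  of_decide (by fun_prop)

theorem lt {f g : α → ℕ} (hf : Computable f) (hg : Computable g) : REPred fun a => f a < g a :=
  of_decide (by fun_prop)

theorem eq [DecidableEq β] {f g : α → β} (hf : Computable f) (hg : Computable g) :
    REPred fun a => f a = g a :=
  of_decide (by fun_prop)

theorem ne [DecidableEq β] {f g : α → β} (hf : Computable f) (hg : Computable g) :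
    REPred fun a => f a ≠ g a :=
  (of_computable (q := fun a => !decide (f a = g a)) (by fun_prop)).of_eq (by simp)

theorem comp {p : β → Prop} {f : α → β} (hp : REPred p) (hf : Computable f) :
    REPred fun a => p (f a) := by
  obtain ⟨q, hq, h⟩ := iff_exists_computable.1 hp
  exact iff_exists_computable.2 ⟨fun t => q (f t.1, t.2), by fun_prop, fun a => h _⟩

/-- Dovetailing: one number encodes both the candidate `b` and the stage at which it is confirmed.
-/
theorem exists_of_primcodable {p : α → β → Prop} (hp : REPred fun t : α × β => p t.1 t.2) :
    REPred fun a => ∃ b, p a b := by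
  obtain ⟨q, hq, h⟩ := iff_exists_computable.1 hp
  refine iff_exists_computable.2 ⟨fun t =>
    ((Encodable.decode (α := β) t.2.unpair.1).map fun b => q ((t.1, b), t.2.unpair.2)).getD false,
    ?_, fun a => ?_⟩
  · refine Computable.option_getD (Computable.option_map ?_ ?_) (Computable.const false)
    · exact Computable.decode.comp (by fun_prop)
    · exact hq.comp (g := fun s : (α × ℕ) × β => ((s.1.1, s.2), s.1.2.unpair.2)) (by fun_prop)
  · constructor
    · rintro ⟨b, hb⟩
      obtain ⟨n, hn⟩ := (h (a, b)).1 hb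
      exact ⟨Nat.pair (Encodable.encode b) n, by simpa using hn⟩
    · rintro ⟨n, hn⟩
      cases hd : Encodable.decode (α := β) n.unpair.1 with
      | none => simp [hd] at hn
      | some b => exact ⟨b, (h (a, b)).2 ⟨_, by simpa [hd] using hn⟩⟩

theorem and {p q : α → Prop} (hp : REPred p) (hq : REPred q) : REPred fun a => p a ∧ q a := by
  obtain ⟨f, hf, hf'⟩ := iff_exists_computable.1 hp
  obtain ⟨g, hg, hg'⟩ := iff_exists_computable.1 hq
  refine REPred.of_eq (p := fun a => ∃ m n : ℕ, (f (a, m) && g (a, n)) = true) ?_ fun a => ?_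
  · refine exists_of_primcodable (exists_of_primcodable (of_computable ?_))
    fun_prop
  · simp [hf', hg']

theorem or {p q : α → Prop} (hp : REPred p) (hq : REPred q) : REPred fun a => p a ∨ q a := by
  obtain ⟨f, hf, hf'⟩ := iff_exists_computable.1 hp
  obtain ⟨g, hg, hg'⟩ := iff_exists_computable.1 hq
  refine REPred.of_eq (p := fun a => ∃ n : ℕ, (f (a, n) || g (a, n)) = true) ?_ fun a => ?_
  · refine exists_of_primcodable (of_computable ?_)
    fun_prop
  · simp [hf', hg', exists_or]

/-- A uniform least-witness form of a recursively enumerable predicate. -/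
theorem exists_unique_witness {p : α → Prop} (hp : REPred p) :
    ∃ q : α × ℕ → Bool, Computable q ∧ (∀ a, p a ↔ ∃ n, q (a, n) = true) ∧
      ∀ a m n, q (a, m) = true → q (a, n) = true → m = n := by
  obtain ⟨q, hq, h⟩ := iff_exists_computable.1 hp
  refine ⟨fun t => q t && !decide (∃ i < t.2, q (t.1, i) = true), ?_, fun a => ?_, ?_⟩
  · have := Computable.bounded_exists (f := fun t : α × ℕ => t.2) (g := fun t i => q (t.1, i))
      (by fun_prop) (by fun_prop)
    fun_prop
  · rw [h]
    constructor
    · intro hn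
      classical
      refine ⟨Nat.find hn, ?_⟩
      have h1 := Nat.find_spec hn
      have h2 : ¬ ∃ i < Nat.find hn, q (a, i) = true := by
        rintro ⟨i, hi, hi'⟩
        exact Nat.find_min hn hi hi'
      simp only [h1, h2, decide_false, Bool.not_false, Bool.and_self]
    · rintro ⟨n, hn⟩
      exact ⟨n, by simp at hn; exact hn.1⟩
  · intro a m n hm hn
    simp only [Bool.and_eq_true, Bool.not_eq_true', decide_eq_false_iff_not, not_exists,
      not_and] at hm hn
    rcases lt_trichotomy m n with hlt | heq | hlt
    · exact absurd hm.1 (hn.2 m hlt)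
    · exact heq
    · exact absurd hn.1 (hm.2 n hlt)

/-- A recursively enumerable single-valued relation is the graph of a partial recursive
function. -/
theorem exists_partrec {G : α × β → Prop} (hG : REPred G)
    (hfun : ∀ a b b', G (a, b) → G (a, b') → b = b') :
    ∃ f : α →. β, Partrec f ∧ ∀ a b, b ∈ f a ↔ G (a, b) := by
  obtain ⟨q, hq, h⟩ := iff_exists_computable.1 hG
  let F : α → ℕ → Option β := fun a n => (Encodable.decode (α := β) n.unpair.1).bind
    fun b => bif q ((a, b), n.unpair.2) then some b else none
  have hF : Computable₂ F := by
    refine Computable.option_bind (Computable.decode.comp (by fun_prop)) ?_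
    refine Computable.cond (c := fun s : (α × ℕ) × β => q ((s.1.1, s.2), s.1.2.unpair.2)) ?_ ?_ ?_
    · fun_prop
    · exact Computable.option_some.comp Computable.snd
    · fun_prop
  have hspec : ∀ a n b, b ∈ F a n → G (a, b) := by
    intro a n b hb
    simp only [F, Option.mem_def, Option.bind_eq_some_iff] at hb
    obtain ⟨b', -, hb'⟩ := hb
    cases hc : q ((a, b'), n.unpair.2) with
    | false => simp [hc] at hb'
    | true =>
      simp only [hc, cond_true, Option.some.injEq] at hb'
      exact hb' ▸ (h _).2 ⟨_, hc⟩
  refine ⟨fun a => Nat.rfindOpt (F a), Partrec.rfindOpt hF, fun a b => ⟨fun hb => ?_, fun hb => ?_⟩⟩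
  · obtain ⟨n, hn⟩ := Nat.rfindOpt_spec hb
    exact hspec _ _ _ hn
  · obtain ⟨n, hn⟩ := (h _).1 hb
    have hd : (Nat.rfindOpt (F a)).Dom := by
      rw [Nat.rfindOpt_dom]
      exact ⟨Nat.pair (Encodable.encode b) n, b, by simp [F, hn]⟩
    obtain ⟨b', hb'⟩ := Part.dom_iff_mem.1 hd
    obtain ⟨m, hm⟩ := Nat.rfindOpt_spec hb'
    rwa [hfun a b b' hb (hspec _ _ _ hm)]

theorem graph {f : α →. β} (hf : Partrec f) : REPred fun t : α × β => t.2 ∈ f t.1 := by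
  classical
  have h1 : Partrec fun t : α × β => (f t.1).bind fun b =>
      (bif decide (b = t.2) then Part.some () else Part.none : Part Unit) := by
    refine Partrec.bind (hf.comp Computable.fst) ?_
    refine Partrec.cond (c := fun s : (α × β) × β => decide (s.2 = s.1.2)) ?_ ?_ ?_
    · fun_prop
    · exact (Computable.const ()).partrec
    · exact Partrec.none
  refine h1.dom_re.of_eq fun t => ?_
  simp only [Part.bind_dom]
  constructor
  · rintro ⟨hd, h⟩
    by_cases hc : (f t.1).get hd = t.2
    · exact ⟨hd, hc⟩
    · simp [hc] at h
  · rintro ⟨hd, h⟩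
    exact ⟨hd, by simp [h]⟩

end REPred

end Computability

/-! ### Strings as dyadic intervals -/

section Strings

theorem REPred.prefix {α : Type*} [Primcodable α] {f g : α → List Bool} (hf : Computable f)
    (hg : Computable g) : REPred fun a => f a <+: g a := by
  refine (REPred.of_decide (p := fun a => f a = (g a).take (f a).length) ?_).of_eq fun a => ?_
  · fun_prop
  · exact List.prefix_iff_eq_take.symm

/-- The value of a string as a binary number, most significant bit first. -/
def binVal (p : List Bool) : ℕ := p.foldl (fun v b => 2 * v + b.toNat) 0

@[fun_prop] theorem Computable.binVal_comp {α : Type*} [Primcodable α] {f : α → List Bool}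
    (hf : Computable f) : Computable fun a => binVal (f a) := by
  have h : Primrec binVal := by
    refine Primrec.list_foldl Primrec.id (Primrec.const 0)
      (h := fun _ (s : ℕ × Bool) => 2 * s.1 + s.2.toNat) ?_
    refine Primrec.nat_add.comp (Primrec.nat_mul.comp (Primrec.const 2)
      (Primrec.fst.comp Primrec.snd)) ((Primrec.dom_bool Bool.toNat).comp
        (Primrec.snd.comp Primrec.snd))
  exact h.to_comp.comp hf

theorem binVal_concat (p : List Bool) (b : Bool) : binVal (p ++ [b]) = 2 * binVal p + b.toNat := by
  simp [binVal]

theorem binVal_append (p r : List Bool) :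
    binVal (p ++ r) = binVal p * 2 ^ r.length + binVal r := by
  induction r using List.reverseRecOn with
  | nil => simp [binVal]
  | append_singleton r b ih =>
    rw [← List.append_assoc, binVal_concat, binVal_concat, ih, List.length_append]
    simp only [List.length_singleton, pow_succ]
    ring

theorem binVal_lt (p : List Bool) : binVal p < 2 ^ p.length := by
  induction p using List.reverseRecOn with
  | nil => simp [binVal]
  | append_singleton p b ih =>
    rw [binVal_concat, List.length_append, List.length_singleton, pow_succ]
    cases b <;> simp <;> omega

theorem exists_binVal (m j : ℕ) (hj : j < 2 ^ m) : ∃ p : List Bool, p.length = m ∧ binVal p = j := by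
  induction m generalizing j with
  | zero => exact ⟨[], rfl, by simp at hj; simp [binVal, hj]⟩
  | succ m ih =>
    obtain ⟨p, hp, hv⟩ := ih (j / 2) (by rw [pow_succ] at hj; omega)
    refine ⟨p ++ [decide (j % 2 = 1)], by simp [hp], ?_⟩
    rw [binVal_concat, hv]
    rcases Nat.mod_two_eq_zero_or_one j with h | h <;> simp [h] <;> omega

/-- The left end of the dyadic interval of a string. -/
noncomputable def strLo (p : List Bool) : ℝ := binVal p / 2 ^ p.length

/-- The right end of the dyadic interval of a string. -/
noncomputable def strHi (p : List Bool) : ℝ := (binVal p + 1) / 2 ^ p.length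

theorem strLo_nonneg (p : List Bool) : 0 ≤ strLo p := by unfold strLo; positivity

theorem strHi_le_one (p : List Bool) : strHi p ≤ 1 := by
  unfold strHi
  rw [div_le_one (by positivity)]
  exact_mod_cast binVal_lt p

theorem strHi_eq (p : List Bool) : strHi p = strLo p + (2⁻¹) ^ p.length := by
  unfold strHi strLo
  rw [inv_pow]
  ring

theorem strLo_lt_strHi (p : List Bool) : strLo p < strHi p := by
  rw [strHi_eq]
  have : (0 : ℝ) < (2⁻¹) ^ p.length := by positivity
  linarith

theorem strLo_append (p r : List Bool) :
    strLo (p ++ r) = strLo p + (2⁻¹) ^ p.length * strLo r := by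
  unfold strLo
  rw [binVal_append, List.length_append, pow_add, inv_pow]
  push_cast
  field_simp

theorem strHi_append (p r : List Bool) :
    strHi (p ++ r) = strLo p + (2⁻¹) ^ p.length * strHi r := by
  rw [strHi_eq, strHi_eq, strLo_append, List.length_append, pow_add]
  ring

theorem strLo_le_of_prefix {p q : List Bool} (h : p <+: q) : strLo p ≤ strLo q := by
  obtain ⟨r, rfl⟩ := h
  rw [strLo_append]
  have := strLo_nonneg r
  have : 0 ≤ (2⁻¹ : ℝ) ^ p.length * strLo r := by positivity
  linarith

theorem strHi_le_of_prefix {p q : List Bool} (h : p <+: q) : strHi q ≤ strHi p := by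
  obtain ⟨r, rfl⟩ := h
  rw [strHi_append, strHi_eq p]
  have := strHi_le_one r
  have h2 : (0 : ℝ) < (2⁻¹) ^ p.length := by positivity
  nlinarith

theorem StrComparable.symm {p q : List Bool} (h : StrComparable p q) : StrComparable q p :=
  Or.symm h

/-- At the first bit where incomparable strings differ, one enters the left half and the other the
right half of a common dyadic interval. -/
theorem strHi_le_strLo_or {p q : List Bool} (h : ¬ StrComparable p q) :
    strHi p ≤ strLo q ∨ strHi q ≤ strLo p := by
  induction p generalizing q with
  | nil => exact absurd (Or.inl (List.nil_prefix)) h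
  | cons b p ih =>
    cases q with
    | nil => exact absurd (Or.inr (List.nil_prefix)) h
    | cons b' q =>
      have e1 : ∀ (b : Bool) (p : List Bool), strLo (b :: p) = strLo [b] + 2⁻¹ * strLo p :=
        fun b p => by simpa using strLo_append [b] p
      have e2 : ∀ (b : Bool) (p : List Bool), strHi (b :: p) = strLo [b] + 2⁻¹ * strHi p :=
        fun b p => by simpa using strHi_append [b] p
      have e3 : strLo [false] = 0 := by simp [strLo, binVal]
      have e4 : strLo [true] = 2⁻¹ := by simp [strLo, binVal]
      rw [e1 b p, e1 b' q, e2 b p, e2 b' q]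
      have h1 := strHi_le_one p
      have h2 := strHi_le_one q
      have h3 := strLo_nonneg p
      have h4 := strLo_nonneg q
      cases b <;> cases b' <;> simp only [e3, e4] <;> first
        | (left; linarith)
        | (right; linarith)
        | skip
      all_goals
        rcases ih (q := q) (fun hc => h (by
          rcases hc with hc | hc
          · exact Or.inl ((List.prefix_cons_inj _).2 hc)
          · exact Or.inr ((List.prefix_cons_inj _).2 hc))) with hh | hh
        · left; linarith
        · right; linarith

theorem StrComparable.of_prefix {x y z : List Bool} (hx : x <+: z) (hy : y <+: z) :
    StrComparable x y := List.prefix_or_prefix_of_prefix hx hy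

theorem StrComparable.mono {x y x' y' : List Bool} (h : StrComparable x y) (hx : x' <+: x)
    (hy : y' <+: y) : StrComparable x' y' := by
  rcases h with h | h
  · exact .of_prefix (hx.trans h) hy
  · exact .of_prefix hx (hy.trans h)

theorem StrComparable.eq_of_length {x y : List Bool} (h : StrComparable x y)
    (hl : x.length = y.length) : x = y := by
  rcases h with h | h
  · exact h.eq_of_length hl
  · exact (h.eq_of_length hl.symm).symm

/-- Kraft's inequality. -/
theorem kraft_inequality {ι : Type*} (p : ι → List Bool)
    (hp : ∀ i j, i ≠ j → ¬ StrComparable (p i) (p j)) :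
    ∑' i, (2⁻¹ : ENNReal) ^ (p i).length ≤ 1 := by
  -- The terms are the lengths of pairwise disjoint subintervals of `[0, 1)`.
  have h1 : ∀ i, (2⁻¹ : ENNReal) ^ (p i).length = volume (Set.Ico (strLo (p i)) (strHi (p i))) := by
    intro i
    rw [Real.volume_Ico, strHi_eq, add_sub_cancel_left, ENNReal.ofReal_pow (by norm_num),
      ENNReal.ofReal_inv_of_pos (by norm_num)]
    simp
  simp_rw [h1]
  calc _ ≤ volume (⋃ i, Set.Ico (strLo (p i)) (strHi (p i))) := by
        refine tsum_meas_le_meas_iUnion_of_disjoint _ (fun i => measurableSet_Ico) ?_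
        intro i j hij
        rw [Function.onFun, Set.disjoint_left]
        rintro t ⟨h1, h2⟩ ⟨h3, h4⟩
        rcases strHi_le_strLo_or (hp i j hij) with h | h <;> linarith
    _ ≤ volume (Set.Ico (0 : ℝ) 1) := by
        refine measure_mono (Set.iUnion_subset fun i => ?_)
        exact Set.Ico_subset_Ico (strLo_nonneg _) (strHi_le_one _)
    _ = 1 := by simp

/-! ### Binary expansions of natural numbers -/

/-- The number with a given binary expansion, least significant bit first. -/
def ofBits (x : List Bool) : ℕ := binVal x.reverse

@[fun_prop] theorem Computable.ofBits_comp {α : Type*} [Primcodable α] {f : α → List Bool}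
    (hf : Computable f) : Computable fun a => ofBits (f a) :=
  Computable.binVal_comp (Computable.list_reverse.comp hf)

theorem ofBits_cons (b : Bool) (x : List Bool) : ofBits (b :: x) = Nat.bit b (ofBits x) := by
  rw [ofBits, List.reverse_cons, binVal_concat, Nat.bit_val, ofBits]

theorem ofBits_bits (n : ℕ) : ofBits (Nat.bits n) = n := by
  induction n using Nat.binaryRec' with
  | zero => simp [ofBits, binVal]
  | bit b n h ih => rw [Nat.bits_append_bit _ _ h, ofBits_cons, ih]

/-- An expansion is determined by its value once a leading zero is excluded; the leading digit comes
last here. Both conditions are manifestly computable, which gives `REPred.eq_bits`. -/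
theorem bits_eq_iff (n : ℕ) (x : List Bool) :
    x = Nat.bits n ↔ ofBits x = n ∧ x.reverse.head? ≠ some false := by
  constructor
  · rintro rfl
    refine ⟨ofBits_bits n, ?_⟩
    induction n using Nat.binaryRec' with
    | zero => simp
    | bit b n h ih =>
      rw [Nat.bits_append_bit _ _ h]
      rcases Nat.eq_zero_or_pos n with rfl | hn
      · simp [h rfl]
      · have : n.bits ≠ [] := by
          intro h0
          have := ofBits_bits n
          rw [h0] at this
          simp [ofBits, binVal] at this
          omega
        rw [List.reverse_cons, List.head?_append_of_ne_nil]
        · exact ih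
        · simpa using this
  · rintro ⟨rfl, h⟩
    induction x with
    | nil => simp [ofBits, binVal]
    | cons b x ih =>
      rw [ofBits_cons]
      by_cases hx : x = []
      · subst hx
        cases b
        · simp at h
        · simp [ofBits, binVal]
      · rw [List.reverse_cons, List.head?_append_of_ne_nil _ (by simpa using hx)] at h
        have hx' := ih h
        rw [Nat.bits_append_bit, ← hx']
        intro h0
        rw [h0] at hx'
        exact absurd (hx'.trans Nat.zero_bits) hx

theorem REPred.eq_bits {α : Type*} [Primcodable α] {f : α → List Bool} {g : α → ℕ}
    (hf : Computable f) (hg : Computable g) : REPred fun a => f a = Nat.bits (g a) := by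
  refine (REPred.and (p := fun a => ofBits (f a) = g a)
    (q := fun a => (f a).reverse.head? ≠ some false) ?_ ?_).of_eq fun a => (bits_eq_iff _ _).symm
  · exact REPred.of_decide (by fun_prop)
  · have h1 : Computable fun a => (f a).reverse.head? :=
      Primrec.list_head?.to_comp.comp (Computable.list_reverse.comp hf)
    refine (REPred.of_computable (q := fun a => !decide ((f a).reverse.head? = some false))
      (by fun_prop)).of_eq fun a => by simp

end Strings

/-! ### Prefix machines and the coding theorem -/

section PrefixMachines

/-- Dyadic intervals of comparable strings are nested, hence overlap. With `strHi_le_strLo_or` this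
turns questions of comparability into inequalities between end points. -/
theorem StrComparable.strLo_lt_strHi {p q : List Bool} (h : StrComparable p q) :
    strLo q < strHi p := by
  rcases h with h | h
  · exact (_root_.strLo_lt_strHi q).trans_le (strHi_le_of_prefix h)
  · exact (strLo_le_of_prefix h).trans_lt (_root_.strLo_lt_strHi p)

variable {U : List Bool → List Bool →. List Bool}

/-- Allows machines to be specified by their graphs: taking `p = q` in `hfun` gives
single-valuedness, the rest is prefix-freeness of the domain. -/
theorem exists_prefixMachine {G : (List Bool × List Bool) × List Bool → Prop} (hG : REPred G)
    (hfun : ∀ y p q x x', G ((p, y), x) → G ((q, y), x') → p <+: q → p = q ∧ x = x') :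
    ∃ T : List Bool → List Bool →. List Bool, IsPrefixMachine T ∧
      ∀ p y x, x ∈ T p y ↔ G ((p, y), x) := by
  obtain ⟨f, hf, h⟩ := hG.exists_partrec fun a b b' h1 h2 =>
    (hfun a.2 a.1 a.1 b b' h1 h2 List.prefix_rfl).2
  refine ⟨fun p y => f (p, y), ⟨hf, fun y p q hp hq hpq => ?_⟩, fun p y x => h _ _⟩
  obtain ⟨x, hx⟩ := Part.dom_iff_mem.1 hp
  obtain ⟨x', hx'⟩ := Part.dom_iff_mem.1 hq
  exact (hfun y p q x x' ((h _ _).1 hx) ((h _ _).1 hx') hpq).1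

/-- Optimality is applied to the machine whose only program, the empty one, prints `x`. It follows
that the infimum in `condK` is taken over a nonempty set and is attained. -/
theorem IsOptimalPrefixMachine.exists_program (hU : IsOptimalPrefixMachine U) (x y : List Bool) :
    ∃ p, x ∈ U p y := by
  obtain ⟨T, hT, h⟩ := exists_prefixMachine
    (G := fun t => t.1.1 = [] ∧ t.2 = x)
    ((REPred.eq (by fun_prop) (by fun_prop)).and (REPred.eq (by fun_prop) (by fun_prop)))
    (fun y p q x x' h1 h2 _ => ⟨h1.1.trans h2.1.symm, h1.2.trans h2.2.symm⟩)
  obtain ⟨c, hc⟩ := hU.optimal T hT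
  obtain ⟨q, hq, -⟩ := hc [] y x ((h _ _ _).2 ⟨rfl, rfl⟩)
  exact ⟨q, hq⟩

theorem IsOptimalPrefixMachine.exists_condK_eq (hU : IsOptimalPrefixMachine U)
    (x y : List Bool) : ∃ p, x ∈ U p y ∧ p.length = condK U x y := by
  obtain ⟨p, hp⟩ := hU.exists_program x y
  exact Nat.sInf_mem (s := {l : ℕ | ∃ p : List Bool, x ∈ U p y ∧ p.length = l}) ⟨_, p, hp, rfl⟩

theorem condK_le {x y p : List Bool} (hp : x ∈ U p y) : condK U x y ≤ p.length :=
  Nat.sInf_le ⟨p, hp, rfl⟩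

theorem IsPrefixMachine.graph_re (hU : IsPrefixMachine U) :
    REPred fun t : (List Bool × List Bool) × List Bool => t.2 ∈ U t.1.1 t.1.2 :=
  REPred.graph hU.partrec

/-- Complexity is approximable from above by searching for programs; this makes the exceptional
events of the tests enumerable. -/
theorem IsOptimalPrefixMachine.condK_le_re (hU : IsOptimalPrefixMachine U) :
    REPred fun t : List Bool × List Bool × ℕ => condK U t.1 t.2.1 ≤ t.2.2 := by
  refine REPred.of_eq (p := fun t : List Bool × List Bool × ℕ =>
    ∃ p : List Bool, t.1 ∈ U p t.2.1 ∧ p.length ≤ t.2.2) ?_ fun t => ?_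
  · refine REPred.exists_of_primcodable (REPred.and ?_ (REPred.le (by fun_prop) (by fun_prop)))
    have := hU.isPrefixMachine.graph_re.comp
      (f := fun s : (List Bool × List Bool × ℕ) × List Bool => ((s.2, s.1.2.1), s.1.1))
      (by fun_prop)
    exact this
  · constructor
    · rintro ⟨p, hp, hl⟩
      exact (condK_le hp).trans hl
    · intro h
      obtain ⟨p, hp, hl⟩ := hU.exists_condK_eq t.1 t.2.1
      exact ⟨p, hp, hl.trans_le h⟩

theorem IsOptimalPrefixMachine.kraft (hU : IsOptimalPrefixMachine U) {ι : Type*}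
    (x : ι → List Bool) (hx : Function.Injective x) (y : List Bool) :
    ∑' i, (2⁻¹ : ENNReal) ^ condK U (x i) y ≤ 1 := by
  choose p hp hl using fun i => hU.exists_condK_eq (x i) y
  simp_rw [← hl]
  have key : ∀ i j, p i <+: p j → i = j := by
    intro i j h
    have h1 := hU.isPrefixMachine.prefixFree y _ _ (Part.dom_iff_mem.2 ⟨_, hp i⟩)
      (Part.dom_iff_mem.2 ⟨_, hp j⟩) h
    have h2 := hp i
    rw [h1] at h2
    exact hx (Part.mem_unique h2 (hp j))
  refine kraft_inequality p fun i j hij h => ?_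
  rcases h with h | h
  · exact hij (key _ _ h)
  · exact hij (key _ _ h).symm

/-- Self-delimiting programs can be split off in a unique way. -/
theorem IsPrefixMachine.append_prefix_append (hU : IsPrefixMachine U) {y p₁ p₂ q₁ q₂ a b : List Bool}
    (ha : a ∈ U p₁ y) (hb : b ∈ U q₁ y) (h : p₁ ++ p₂ <+: q₁ ++ q₂) :
    p₁ = q₁ ∧ a = b ∧ p₂ <+: q₂ := by
  have hp : p₁ <+: q₁ ++ q₂ := (List.prefix_append _ _).trans h
  have hq : q₁ <+: q₁ ++ q₂ := List.prefix_append _ _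
  have da := Part.dom_iff_mem.2 ⟨_, ha⟩
  have db := Part.dom_iff_mem.2 ⟨_, hb⟩
  have e : p₁ = q₁ := by
    rcases List.prefix_or_prefix_of_prefix hp hq with hc | hc
    · exact hU.prefixFree y _ _ da db hc
    · exact (hU.prefixFree y _ _ db da hc).symm
  subst e
  exact ⟨rfl, Part.mem_unique ha hb, (List.prefix_append_right_inj _).1 h⟩

/-- Enumerated requests of codewords of given lengths, with the Kraft sum at most one, can be
satisfied by a prefix code up to one additional bit. -/
theorem exists_prefix_code {κ : Type*} [Primcodable κ] {A : κ × ℕ × List Bool → Prop}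
    (hA : REPred A)
    (hsum : ∀ k, ∑' t : {t : ℕ × List Bool // A (k, t)}, (2⁻¹ : ENNReal) ^ t.1.1 ≤ 1) :
    ∃ D : κ × List Bool × List Bool → Prop, REPred D ∧
      (∀ k p q x x', D (k, p, x) → D (k, q, x') → p <+: q → p = q ∧ x = x') ∧
      ∀ k l x, A (k, l, x) → ∃ p, D (k, p, x) ∧ p.length = l + 1 := by
  obtain ⟨q, hq, hqA, hqu⟩ := hA.exists_unique_witness
  let len : ℕ → ℕ := fun i => i.unpair.1
  let str : ℕ → List Bool := fun i => (Encodable.decode i.unpair.2.unpair.1).getD []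
  -- An index codes a request with its unique witness. The encoding check discards indices whose
  -- string is only the default `[]`, so each request has exactly one valid index.
  let valid : κ → ℕ → Bool := fun k i =>
    q ((k, len i, str i), i.unpair.2.unpair.2) && decide (Encodable.encode (str i) = i.unpair.2.unpair.1)
  -- The numerator, over the denominator `2 ^ i`, of the total length allotted before index `i`. It
  -- is an integer, and the subtraction is exact, since `len j ≤ j < i`.
  let S : κ → ℕ → ℕ := fun k i =>
    ∑ j ∈ Finset.range i, bif valid k j then 2 ^ (i - len j) else 0
  have hlen : Computable len := by fun_prop
  have hstr : Computable str := Computable.option_getD (Computable.decode.comp (by fun_prop)) (.const [])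
  have hvalid : Computable fun t : κ × ℕ => valid t.1 t.2 := by fun_prop
  have hS : Computable fun t : κ × ℕ => S t.1 t.2 := by
    refine Computable.sum_range (α := κ × ℕ) (f := fun t => t.2)
      (g := fun t j => bif valid t.1 j then 2 ^ (t.2 - len j) else 0) (by fun_prop) ?_
    have := hvalid.comp (g := fun s : (κ × ℕ) × ℕ => (s.1.1, s.2)) (by fun_prop)
    fun_prop
  -- the left end point of the interval allotted to request number `i`
  let F : κ → ℕ → ℝ := fun k i =>
    ∑ j ∈ Finset.range i, if valid k j = true then (2⁻¹ : ℝ) ^ len j else 0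
  have hSF : ∀ k i, (S k i : ℝ) = F k i * 2 ^ i := by
    intro k i
    simp only [S, F, Nat.cast_sum, Finset.sum_mul]
    refine Finset.sum_congr rfl fun j hj => ?_
    have hj : len j ≤ i := (Nat.unpair_left_le j).trans (Finset.mem_range.1 hj).le
    cases valid k j
    · simp
    · simp only [cond_true, if_true, Nat.cast_pow, Nat.cast_ofNat]
      rw [pow_sub₀ _ (by norm_num) hj, inv_pow, mul_comm]
  have hF_mono : ∀ k, Monotone (F k) := by
    intro k i j hij
    refine Finset.sum_le_sum_of_subset_of_nonneg (Finset.range_mono hij) fun _ _ _ => ?_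
    split_ifs <;> positivity
  have hF_succ : ∀ k i, valid k i = true → F k (i + 1) = F k i + (2⁻¹ : ℝ) ^ len i := by
    intro k i hi
    simp [F, Finset.sum_range_succ, hi]
  have hF_one : ∀ k i, F k i ≤ 1 := by
    intro k i
    have h1 : ∑ j ∈ Finset.range i,
        (if valid k j = true then (2⁻¹ : ENNReal) ^ len j else 0) ≤ 1 := by
      refine (ENNReal.sum_le_tsum _).trans (le_trans (le_of_eq ?_) ((ENNReal.tsum_comp_le_tsum_of_injective
        (f := fun j : {j // valid k j = true} =>
          (⟨(len j, str j), (hqA _).2 ⟨_, (Bool.and_eq_true_iff.1 j.2).1⟩⟩ : {t : ℕ × List Bool // A (k, t)})) ?_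
        (fun t => (2⁻¹ : ENNReal) ^ t.1.1)).trans (hsum k)))
      · refine Eq.trans ?_ (tsum_subtype {j | valid k j = true}
          fun j => (2⁻¹ : ENNReal) ^ len j).symm
        refine tsum_congr fun j => ?_
        simp [Set.indicator_apply]
      · rintro ⟨i, hi⟩ ⟨j, hj⟩ hij
        simp only [Subtype.mk.injEq, Prod.mk.injEq] at hij ⊢
        obtain ⟨h1, h2⟩ := hij
        simp only [valid, h1, h2, Bool.and_eq_true, decide_eq_true_eq] at hi hj
        have h3 := hqu _ _ _ hi.1 hj.1
        have h4 : i.unpair.2.unpair.1 = j.unpair.2.unpair.1 := hi.2.symm.trans hj.2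
        rw [← Nat.pair_unpair i, ← Nat.pair_unpair j, ← Nat.pair_unpair i.unpair.2,
          ← Nat.pair_unpair j.unpair.2, h3, h4]
        simp only [len] at h1
        rw [h1]
    have h2 := ENNReal.toReal_mono ENNReal.one_ne_top h1
    rw [ENNReal.toReal_sum (fun j _ => by split_ifs <;> simp)] at h2
    refine (le_of_eq (Finset.sum_congr rfl fun j _ => ?_)).trans (h2.trans (by simp))
    split_ifs <;> simp
  -- Integer forms of the inclusion of the interval of `p` in the allotted interval; the summand `2
  -- * 2 ^ i` arises from `2 ^ (-len i) = 2 / 2 ^ p.length`.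
  have hint : ∀ k i p, p.length = len i + 1 →
      (S k i * 2 ^ p.length ≤ binVal p * 2 ^ i ↔ F k i ≤ strLo p) ∧
      ((binVal p + 1) * 2 ^ i ≤ S k i * 2 ^ p.length + 2 * 2 ^ i ↔
        strHi p ≤ F k i + (2⁻¹ : ℝ) ^ len i) := by
    intro k i p hp
    have hi : (0 : ℝ) < 2 ^ i := by positivity
    have hl : (0 : ℝ) < 2 ^ p.length := by positivity
    have e : (2⁻¹ : ℝ) ^ len i = 2 / 2 ^ p.length := by
      rw [hp, pow_succ, inv_pow]; field_simp
    have e1 : S k i * 2 ^ p.length ≤ binVal p * 2 ^ i ↔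
        F k i * 2 ^ i * 2 ^ p.length ≤ (binVal p : ℝ) * 2 ^ i := by
      rw [← hSF]; norm_cast
    have e2 : (binVal p + 1) * 2 ^ i ≤ S k i * 2 ^ p.length + 2 * 2 ^ i ↔
        ((binVal p : ℝ) + 1) * 2 ^ i ≤ F k i * 2 ^ i * 2 ^ p.length + 2 * 2 ^ i := by
      rw [← hSF]; norm_cast
    constructor
    · rw [e1, strLo, le_div_iff₀ hl, mul_right_comm, mul_le_mul_iff_left₀ hi]
    · rw [e2, strHi, e, div_le_iff₀ hl, add_mul (F k i), div_mul_cancel₀ _ hl.ne', mul_right_comm,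
        ← add_mul, mul_le_mul_iff_left₀ hi]
  have hsep : ∀ k i j p q, i < j → valid k i = true →
      strHi p ≤ F k i + (2⁻¹ : ℝ) ^ len i → F k j ≤ strLo q → ¬ StrComparable p q := by
    intro k i j p q hij hi hp hq hc
    have h1 := hF_succ k i hi
    have h2 := hF_mono k (Nat.succ_le_of_lt hij)
    have h3 := hc.strLo_lt_strHi
    simp only [Nat.succ_eq_add_one] at h2
    linarith
  -- Allotted intervals need not be aligned, but one of length `2 ^ (-l)` contains a dyadic interval
  -- of half that length: hence the additional bit. Every such dyadic subinterval is accepted as a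
  -- codeword; those for the same request have equal length and do not conflict.
  refine ⟨fun t => ∃ i, valid t.1 i = true ∧ str i = t.2.2 ∧ t.2.1.length = len i + 1 ∧
    S t.1 i * 2 ^ t.2.1.length ≤ binVal t.2.1 * 2 ^ i ∧
    (binVal t.2.1 + 1) * 2 ^ i ≤ S t.1 i * 2 ^ t.2.1.length + 2 * 2 ^ i, ?_, ?_, ?_⟩
  · have h1 : Computable fun s : (κ × List Bool × List Bool) × ℕ => valid s.1.1 s.2 :=
      hvalid.comp (g := fun s : (κ × List Bool × List Bool) × ℕ => (s.1.1, s.2)) (by fun_prop)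
    have h2 : Computable fun s : (κ × List Bool × List Bool) × ℕ => S s.1.1 s.2 :=
      hS.comp (g := fun s : (κ × List Bool × List Bool) × ℕ => (s.1.1, s.2)) (by fun_prop)
    refine REPred.exists_of_primcodable ((REPred.of_computable h1).and
      (.and (.eq ?_ ?_) (.and (.eq ?_ ?_) (.and (.le ?_ ?_) (.le ?_ ?_)))))
    all_goals fun_prop
  · rintro k p q x x' ⟨i, hi, hx, hp, hp1, hp2⟩ ⟨j, hj, hx', hq, hq1, hq2⟩ hpq
    simp only at hx hp hp1 hp2 hx' hq hq1 hq2
    rw [(hint k i p hp).1] at hp1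
    rw [(hint k i p hp).2] at hp2
    rw [(hint k j q hq).1] at hq1
    rw [(hint k j q hq).2] at hq2
    rcases lt_trichotomy i j with hij | rfl | hij
    · exact absurd (Or.inl hpq) (hsep k i j p q hij hi hp2 hq1)
    · exact ⟨hpq.eq_of_length (hp.trans hq.symm), hx.symm.trans hx'⟩
    · exact absurd (Or.inr hpq) (hsep k j i q p hij hj hq2 hp1)
  · intro k l x hklx
    obtain ⟨w, hw⟩ := (hqA _).1 hklx
    let i := Nat.pair l (Nat.pair (Encodable.encode x) w)
    have hl : len i = l := by simp [len, i]
    have hx : str i = x := by simp [str, i]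
    have hi : valid k i = true := by simp only [valid, hl, hx]; simpa [i] using hw
    have h1 := hF_one k (i + 1)
    rw [hF_succ k i hi, hl] at h1
    have hpos : (0 : ℝ) < 2 ^ (l + 1) := by positivity
    have hFnn : 0 ≤ F k i := Finset.sum_nonneg fun j _ => by split_ifs <;> positivity
    have e : (2⁻¹ : ℝ) ^ l = 2 / 2 ^ (l + 1) := by rw [pow_succ, inv_pow]; field_simp
    have hm := Nat.ceil_lt_add_one (mul_nonneg hFnn hpos.le)
    have hm' := Nat.le_ceil (F k i * 2 ^ (l + 1))
    have h2 : F k i * 2 ^ (l + 1) + 2 ≤ 2 ^ (l + 1) := by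
      have := mul_le_mul_of_nonneg_right h1 hpos.le
      rw [e, add_mul, div_mul_cancel₀ _ hpos.ne'] at this
      linarith
    -- The first dyadic point of level `l + 1` at or after the left end of the allotted interval.
    obtain ⟨p, hp, hv⟩ := exists_binVal (l + 1) ⌈F k i * 2 ^ (l + 1)⌉₊ (by
      rw [← Nat.cast_lt (α := ℝ)]
      push_cast
      linarith)
    have hpl : p.length = len i + 1 := by rw [hp, hl]
    refine ⟨p, ⟨i, hi, hx, hpl, (hint k i p hpl).1.2 ?_, (hint k i p hpl).2.2 ?_⟩, hp⟩
    · rw [strLo, hv, hp, le_div_iff₀ hpos]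
      exact hm'
    · rw [strHi, hv, hp, hl, div_le_iff₀ hpos, e, add_mul, div_mul_cancel₀ _ hpos.ne']
      linarith

/-- The coding theorem: enumerated requests `(l, x)`, given a key `k` and a condition `y`, yield
programs of length about `l`, together with a program for the key. -/
theorem IsOptimalPrefixMachine.coding (hU : IsOptimalPrefixMachine U)
    {A : (ℕ × List Bool) × ℕ × List Bool → Prop} (hA : REPred A)
    (hsum : ∀ k, ∑' t : {t : ℕ × List Bool // A (k, t)}, (2⁻¹ : ENNReal) ^ t.1.1 ≤ 1) :
    ∃ C : ℕ, ∀ k y l x, A ((k, y), l, x) → condK U x y ≤ l + plainK U (Nat.bits k) + C := by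
  obtain ⟨D, hD, hDfun, hDex⟩ := exists_prefix_code hA hsum
  -- The machine reads a self-delimiting program for the key and then a codeword from the code
  -- belonging to that key and the condition.
  obtain ⟨T, hT, h⟩ := exists_prefixMachine
    (G := fun t => ∃ p₁ p₂ z : List Bool, ∃ k : ℕ, t.1.1 = p₁ ++ p₂ ∧ z ∈ U p₁ [] ∧
      z = Nat.bits k ∧ D ((k, t.1.2), p₂, t.2)) (by
    refine .exists_of_primcodable (.exists_of_primcodable (.exists_of_primcodable
      (.exists_of_primcodable (.and (.eq ?_ ?_) (.and ?_ (.and ?_ ?_))))))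
    · fun_prop
    · fun_prop
    · have := hU.isPrefixMachine.graph_re.comp (f := fun s : (((((List Bool × List Bool) ×
        List Bool) × List Bool) × List Bool) × List Bool) × ℕ => ((s.1.1.1.2, []), s.1.2))
        (by fun_prop)
      exact this
    · exact REPred.eq_bits (by fun_prop) (by fun_prop)
    · have := hD.comp (f := fun s : (((((List Bool × List Bool) ×
        List Bool) × List Bool) × List Bool) × List Bool) × ℕ =>
          ((s.2, s.1.1.1.1.1.2), s.1.1.2, s.1.1.1.1.2)) (by fun_prop)
      exact this) (by
    rintro y p q x x' ⟨p₁, p₂, z, k, hp, hz, hk, hd⟩ ⟨q₁, q₂, z', k', hq, hz', hk', hd'⟩ hpq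
    simp only at hp hd hq hd'
    subst hp hq hk hk'
    obtain ⟨rfl, hkk, hpq'⟩ := hU.isPrefixMachine.append_prefix_append hz hz' hpq
    obtain rfl : k = k' := by rw [← ofBits_bits k, hkk, ofBits_bits]
    obtain ⟨rfl, rfl⟩ := hDfun _ _ _ _ _ hd hd' hpq'
    exact ⟨rfl, rfl⟩)
  obtain ⟨c, hc⟩ := hU.optimal T hT
  refine ⟨c + 1, fun k y l x hA => ?_⟩
  obtain ⟨p₂, hp₂, hl⟩ := hDex _ _ _ hA
  obtain ⟨p₁, hp₁, hl₁⟩ := hU.exists_condK_eq (Nat.bits k) []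
  obtain ⟨q, hq, hlq⟩ := hc (p₁ ++ p₂) y x ((h _ _ _).2 ⟨p₁, p₂, _, k, rfl, hp₁, rfl, hp₂⟩)
  have := condK_le hq
  rw [List.length_append] at hlq
  unfold plainK
  omega

theorem IsOptimalPrefixMachine.exists_plainK_comp_le (hU : IsOptimalPrefixMachine U) {f : ℕ → ℕ}
    (hf : Computable f) :
    ∃ C : ℕ, ∀ k, plainK U (Nat.bits (f k)) ≤ plainK U (Nat.bits k) + C := by
  obtain ⟨C, hC⟩ := hU.coding (A := fun t => t.2.1 = 0 ∧ t.2.2 = Nat.bits (f t.1.1))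
    (.and (.eq (by fun_prop) (by fun_prop)) (.eq_bits (by fun_prop) (by fun_prop))) (by
    intro k
    have : Subsingleton {t : ℕ × List Bool // t.1 = 0 ∧ t.2 = Nat.bits (f k.1)} :=
      ⟨fun a b => Subtype.ext (Prod.ext (a.2.1.trans b.2.1.symm) (a.2.2.trans b.2.2.symm))⟩
    refine (tsum_le_of_sum_le' (a₂ := 1) zero_le_one fun s => ?_)
    exact (Finset.sum_le_card_nsmul s _ 1 fun t _ => pow_le_one' (by simp) _).trans (by
      have := Finset.card_le_one_of_subsingleton s
      simpa using this))
  refine ⟨C, fun k => ?_⟩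
  have := hC k [] 0 (Nat.bits (f k)) ⟨rfl, rfl⟩
  unfold plainK at *
  omega

theorem IsOptimalPrefixMachine.exists_condK_self_le (hU : IsOptimalPrefixMachine U) :
    ∃ C : ℕ, ∀ x, condK U x x ≤ C := by
  obtain ⟨T, hT, h⟩ := exists_prefixMachine (G := fun t => t.1.1 = [] ∧ t.2 = t.1.2)
    ((REPred.eq (by fun_prop) (by fun_prop)).and (REPred.eq (by fun_prop) (by fun_prop)))
    (fun y p q x x' h1 h2 _ => ⟨h1.1.trans h2.1.symm, h1.2.trans h2.2.symm⟩)
  obtain ⟨c, hc⟩ := hU.optimal T hT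
  refine ⟨c, fun x => ?_⟩
  obtain ⟨q, hq, hl⟩ := hc [] x x ((h _ _ _).2 ⟨rfl, rfl⟩)
  exact (condK_le hq).trans (by simpa using hl)

end PrefixMachines

/-! ### Monotone machines -/

section MonotoneMachines

variable {U : List Bool → List Bool →. List Bool} {M : List Bool → List Bool → List Bool → Prop}

theorem condKm_le {x x' y p : List Bool} (hp : M p y x') (hx : x <+: x') :
    condKm M x y ≤ p.length :=
  Nat.sInf_le ⟨p, x', hp, hx, rfl⟩

theorem IsOptimalMonotoneMachine.exists_program (hM : IsOptimalMonotoneMachine M)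
    (x y : List Bool) : ∃ p x', M p y x' ∧ x <+: x' := by
  obtain ⟨c, hc⟩ := hM.optimal (fun _ _ x' => x' = x)
    ⟨REPred.eq (by fun_prop) (by fun_prop), fun y p q x₁ x₂ h1 h2 _ => by
      rw [h1, h2]; exact Or.inl List.prefix_rfl⟩
  obtain ⟨q, x', hq, hx, -⟩ := hc [] y x rfl
  exact ⟨q, x', hq, hx⟩

theorem IsOptimalMonotoneMachine.exists_condKm_eq (hM : IsOptimalMonotoneMachine M)
    (x y : List Bool) : ∃ p x', M p y x' ∧ x <+: x' ∧ p.length = condKm M x y := by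
  obtain ⟨p, x', hp, hx⟩ := hM.exists_program x y
  exact Nat.sInf_mem (s := {l : ℕ | ∃ p x' : List Bool, M p y x' ∧ x <+: x' ∧ p.length = l})
    ⟨_, p, x', hp, hx, rfl⟩

theorem IsOptimalMonotoneMachine.condKm_le_re (hM : IsOptimalMonotoneMachine M) :
    REPred fun t : List Bool × List Bool × ℕ => condKm M t.1 t.2.1 ≤ t.2.2 := by
  refine REPred.of_eq (p := fun t : List Bool × List Bool × ℕ =>
    ∃ p x' : List Bool, M p t.2.1 x' ∧ t.1 <+: x' ∧ p.length ≤ t.2.2) ?_ fun t => ?_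
  · refine .exists_of_primcodable (.exists_of_primcodable (.and ?_ (.and
      (.prefix (by fun_prop) (by fun_prop)) (.le (by fun_prop) (by fun_prop)))))
    have := hM.isMonotoneMachine.enumerable.comp
      (f := fun s : ((List Bool × List Bool × ℕ) × List Bool) × List Bool =>
        (s.1.2, s.1.1.2.1, s.2)) (by fun_prop)
    exact this
  · constructor
    · rintro ⟨p, x', hp, hx, hl⟩
      exact (condKm_le hp hx).trans hl
    · intro h
      obtain ⟨p, x', hp, hx, hl⟩ := hM.exists_condKm_eq t.1 t.2.1
      exact ⟨p, x', hp, hx, hl.trans_le h⟩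

/-- Comparable shortest programs have comparable outputs, and then the required initial segments,
being of equal length, coincide. Without equal lengths this fails, since one program serves all
initial segments of its output. -/
theorem IsOptimalMonotoneMachine.kraft (hM : IsOptimalMonotoneMachine M) {ι : Type*}
    (x : ι → List Bool) (hx : Function.Injective x) (hl : ∀ i j, (x i).length = (x j).length)
    (y : List Bool) :
    ∑' i, (2⁻¹ : ENNReal) ^ condKm M (x i) y ≤ 1 := by
  choose p x' hp hx' hlen using fun i => hM.exists_condKm_eq (x i) y
  simp_rw [← hlen]
  refine kraft_inequality p fun i j hij h => hij (hx ?_)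
  have : StrComparable (x' i) (x' j) := by
    rcases h with h | h
    · exact hM.isMonotoneMachine.coherent y _ _ _ _ (hp i) (hp j) h
    · exact (hM.isMonotoneMachine.coherent y _ _ _ _ (hp j) (hp i) h).symm
  exact (this.mono (hx' i) (hx' j)).eq_of_length (hl i j)

/-- The coding theorem for monotone machines: an enumerable coherent family of codes, one for
each key `k` and condition `y`, is simulated at the cost of a program for the key. -/
theorem IsOptimalMonotoneMachine.coding (hM : IsOptimalMonotoneMachine M)
    (hU : IsOptimalPrefixMachine U)
    {D : (ℕ × List Bool) × List Bool × List Bool → Prop} (hD : REPred D)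
    (hcoh : ∀ k p q x x', D (k, p, x) → D (k, q, x') → p <+: q → StrComparable x x') :
    ∃ C : ℕ, ∀ k y p x, D ((k, y), p, x) →
      condKm M x y ≤ p.length + plainK U (Nat.bits k) + C := by
  obtain ⟨c, hc⟩ := hM.optimal (fun p y x => ∃ p₁ p₂ z : List Bool, ∃ k : ℕ, p = p₁ ++ p₂ ∧
      z ∈ U p₁ [] ∧ z = Nat.bits k ∧ D ((k, y), p₂, x)) ⟨by
    refine .exists_of_primcodable (.exists_of_primcodable (.exists_of_primcodable
      (.exists_of_primcodable (.and (.eq ?_ ?_) (.and ?_ (.and ?_ ?_))))))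
    · fun_prop
    · fun_prop
    · have := hU.isPrefixMachine.graph_re.comp (f := fun s : ((((List Bool × List Bool ×
        List Bool) × List Bool) × List Bool) × List Bool) × ℕ => ((s.1.1.1.2, []), s.1.2))
        (by fun_prop)
      exact this
    · exact REPred.eq_bits (by fun_prop) (by fun_prop)
    · have := hD.comp (f := fun s : ((((List Bool × List Bool ×
        List Bool) × List Bool) × List Bool) × List Bool) × ℕ =>
          ((s.2, s.1.1.1.1.2.1), s.1.1.2, s.1.1.1.1.2.2)) (by fun_prop)
      exact this, by
    rintro y p q x x' ⟨p₁, p₂, z, k, rfl, hz, rfl, hd⟩ ⟨q₁, q₂, z', k', rfl, hz', rfl, hd'⟩ hpq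
    obtain ⟨rfl, hkk, hpq'⟩ := hU.isPrefixMachine.append_prefix_append hz hz' hpq
    obtain rfl : k = k' := by rw [← ofBits_bits k, hkk, ofBits_bits]
    exact hcoh _ _ _ _ _ hd hd' hpq'⟩
  refine ⟨c, fun k y p x hd => ?_⟩
  obtain ⟨p₁, hp₁, hl₁⟩ := hU.exists_condK_eq (Nat.bits k) []
  obtain ⟨q, x', hq, hx, hlq⟩ := hc (p₁ ++ p) y x ⟨p₁, p, _, k, rfl, hp₁, rfl, hd⟩
  have := condKm_le hq hx
  rw [List.length_append] at hlq
  unfold plainK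
  omega

/-- A prefix machine becomes monotone by ignoring all bits after its self-delimiting program. -/
theorem IsOptimalMonotoneMachine.exists_condKm_le_condK (hM : IsOptimalMonotoneMachine M)
    (hU : IsOptimalPrefixMachine U) : ∃ C : ℕ, ∀ x y, condKm M x y ≤ condK U x y + C := by
  obtain ⟨c, hc⟩ := hM.optimal (fun p y x => ∃ p' : List Bool, x ∈ U p' y ∧ p' <+: p) ⟨by
    refine .exists_of_primcodable (.and ?_ (.prefix (by fun_prop) (by fun_prop)))
    have := hU.isPrefixMachine.graph_re.comp
      (f := fun s : (List Bool × List Bool × List Bool) × List Bool => ((s.2, s.1.2.1), s.1.2.2))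
      (by fun_prop)
    exact this, by
    rintro y p q x x' ⟨p', hp', hp⟩ ⟨q', hq', hq⟩ hpq
    obtain ⟨p₂, rfl⟩ := hp.trans hpq
    obtain ⟨q₂, hq₂⟩ := hq
    obtain ⟨-, rfl, -⟩ := hU.isPrefixMachine.append_prefix_append hq' hp' (p₂ := q₂) (q₂ := p₂)
      (by rw [hq₂])
    exact Or.inl List.prefix_rfl⟩
  refine ⟨c, fun x y => ?_⟩
  obtain ⟨p, hp, hl⟩ := hU.exists_condK_eq x y
  obtain ⟨q, x', hq, hx, hlq⟩ := hc p y x ⟨p, hp, List.prefix_rfl⟩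
  exact (condKm_le hq hx).trans (by omega)

end MonotoneMachines

/-! ### Enumerable open sets and computable measures -/

section OpenSets

@[simp] theorem length_initSeg (ω : ℕ → Bool) (t : ℕ) : (initSeg ω t).length = t := by
  simp [initSeg]

theorem take_initSeg (ω : ℕ → Bool) (i t : ℕ) : (initSeg ω t).take i = initSeg ω (min i t) := by
  rw [initSeg, ← List.map_take, List.take_range, initSeg]

theorem initSeg_prefix (ω : ℕ → Bool) {i t : ℕ} (h : i ≤ t) : initSeg ω i <+: initSeg ω t := by
  rw [List.prefix_iff_eq_take, length_initSeg, take_initSeg, min_eq_left h]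

theorem eq_initSeg_of_prefix {ω : ℕ → Bool} {t : ℕ} {σ : List Bool} (h : σ <+: initSeg ω t) :
    σ = initSeg ω σ.length := by
  have h1 := h.length_le
  rw [length_initSeg] at h1
  rw [List.prefix_iff_eq_take, take_initSeg, min_eq_left h1] at h
  exact h

theorem measurableSet_initSeg (G : List Bool → Prop) (t : ℕ) :
    MeasurableSet {ω | G (initSeg ω t)} := by
  have h1 : Measurable fun ω : ℕ → Bool => fun i : Fin t => ω i :=
    measurable_pi_lambda _ fun i => measurable_pi_apply _
  have h2 : {ω | G (initSeg ω t)} = (fun ω : ℕ → Bool => fun i : Fin t => ω i) ⁻¹'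
      {x | G (List.ofFn x)} := by
    ext ω
    have : initSeg ω t = List.ofFn fun i : Fin t => ω i := by
      rw [initSeg, List.ofFn_eq_map, ← List.map_coe_finRange_eq_range, List.map_map]
      rfl
    simp [this]
  rw [h2]
  exact h1 (Set.toFinite _).measurableSet

/-- The open set generated by a set of strings. -/
def openSet (G : List Bool → Prop) : Set (ℕ → Bool) := {ω | ∃ t, G (initSeg ω t)}

theorem measurableSet_openSet (G : List Bool → Prop) : MeasurableSet (openSet G) := by
  have : openSet G = ⋃ t, {ω | G (initSeg ω t)} := by ext; simp [openSet]
  rw [this]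
  exact .iUnion fun t => measurableSet_initSeg G t

theorem testSet_eq_openSet (W : ℕ × List Bool → Prop) (k : ℕ) :
    testSet W k = openSet fun σ => W (k, σ) := by
  ext ω
  constructor
  · rintro ⟨σ, hσ, h⟩
    exact ⟨σ.length, by rw [show initSeg ω σ.length = σ from h]; exact hσ⟩
  · rintro ⟨t, ht⟩
    exact ⟨_, ht, by simp [cylinderSet]⟩

theorem measurableSet_cylinderSet (σ : List Bool) : MeasurableSet (cylinderSet σ) :=
  measurableSet_initSeg (fun τ => τ = σ) σ.length

theorem disjoint_cylinderSet {σ τ : List Bool} (h : ¬ StrComparable σ τ) :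
    Disjoint (cylinderSet σ) (cylinderSet τ) := by
  rw [Set.disjoint_left]
  intro ω h1 h2
  simp only [cylinderSet, Set.mem_ofPred_eq] at h1 h2
  refine h ?_
  rw [← h1, ← h2]
  rcases le_total σ.length τ.length with hl | hl
  · exact Or.inl (initSeg_prefix ω hl)
  · exact Or.inr (initSeg_prefix ω hl)

variable {α : Type*} [Primcodable α]

/-- An enumerable family of open sets is generated by a decidable family of strings closed
under extension. -/
theorem REPred.exists_monotone_stage {G : α × List Bool → Prop} (hG : REPred G) :
    ∃ H : α × List Bool → Bool, Computable H ∧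
      (∀ a σ τ, σ <+: τ → H (a, σ) = true → H (a, τ) = true) ∧
      ∀ a, openSet (fun σ => G (a, σ)) = openSet fun σ => H (a, σ) = true := by
  obtain ⟨q, hq, hqG⟩ := iff_exists_computable.1 hG
  have hspec : ∀ a τ, decide (∃ i < τ.length + 1,
      decide (∃ n < τ.length, q ((a, τ.take i), n) = true) = true) = true ↔
      ∃ σ, σ <+: τ ∧ ∃ n < τ.length, q ((a, σ), n) = true := by
    intro a τ
    simp only [decide_eq_true_eq]
    constructor
    · rintro ⟨i, -, h⟩
      exact ⟨_, List.take_prefix _ _, h⟩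
    · rintro ⟨σ, hσ, h⟩
      refine ⟨σ.length, Nat.lt_succ_of_le hσ.length_le, ?_⟩
      rwa [← List.prefix_iff_eq_take.1 hσ]
  -- The length of the string also bounds the search: `τ` is accepted once some initial segment of
  -- it has been enumerated at a stage below `τ.length`.
  refine ⟨fun t => decide (∃ i < t.2.length + 1,
    decide (∃ n < t.2.length, q ((t.1, t.2.take i), n) = true) = true), ?_, ?_, ?_⟩
  · refine Computable.bounded_exists (α := α × List Bool) (f := fun t => t.2.length + 1)
      (g := fun t i => decide (∃ n < t.2.length, q ((t.1, t.2.take i), n) = true))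
      (by fun_prop) ?_
    refine Computable.bounded_exists (α := (α × List Bool) × ℕ) (f := fun t => t.1.2.length)
      (g := fun t n => q ((t.1.1, t.1.2.take t.2), n)) (by fun_prop) (by fun_prop)
  · intro a σ τ hστ
    simp only [hspec]
    rintro ⟨ρ, hρ, n, hn, h⟩
    exact ⟨ρ, hρ.trans hστ, n, hn.trans_le hστ.length_le, h⟩
  · intro a
    ext ω
    simp only [openSet, Set.mem_ofPred_eq, hspec]
    constructor
    · rintro ⟨t, ht⟩
      obtain ⟨n, hn⟩ := (hqG _).1 ht
      exact ⟨t + n + 1, initSeg ω t, initSeg_prefix ω (by omega), n, by simp, hn⟩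
    · rintro ⟨t, σ, hσ, n, -, h⟩
      refine ⟨σ.length, ?_⟩
      rw [← eq_initSeg_of_prefix hσ]
      exact (hqG _).2 ⟨n, h⟩

/-- The `i`-th string of length `t`. -/
def nthString (t i : ℕ) : List Bool := (List.range t).map fun j => decide (i / 2 ^ j % 2 = 1)

theorem computable_nthString : Computable fun s : ℕ × ℕ => nthString s.1 s.2 := by
  refine Primrec.to_comp (Primrec.list_map (Primrec.list_range.comp Primrec.fst)
    (g := fun (s : ℕ × ℕ) j => decide (s.2 / 2 ^ j % 2 = 1)) ?_)
  refine PrimrecRel.decide ?_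
  have hpow : Primrec₂ ((· ^ ·) : ℕ → ℕ → ℕ) := Primrec₂.unpaired'.1 Nat.Primrec.pow
  exact Primrec.eq.comp (Primrec.nat_mod.comp (Primrec.nat_div.comp
    (Primrec.snd.comp Primrec.fst) (hpow.comp (Primrec.const 2) Primrec.snd)) (Primrec.const 2))
    (Primrec.const 1)

@[simp] theorem length_nthString (t i : ℕ) : (nthString t i).length = t := by simp [nthString]

theorem nthString_succ (t i : ℕ) :
    nthString (t + 1) i = decide (i % 2 = 1) :: nthString t (i / 2) := by
  simp only [nthString, List.range_succ_eq_map, List.map_cons, List.map_map, pow_zero, Nat.div_one]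
  congr 1
  refine List.map_congr_left fun j _ => ?_
  simp only [Function.comp, pow_succ', Nat.succ_eq_add_one, Nat.div_div_eq_div_mul]

theorem ofBits_nthString (t i : ℕ) (hi : i < 2 ^ t) : ofBits (nthString t i) = i := by
  induction t generalizing i with
  | zero => simp at hi; simp [nthString, ofBits, binVal, hi]
  | succ t ih =>
    rw [nthString_succ, ofBits_cons, ih _ (by rw [pow_succ] at hi; omega), Nat.bit_val]
    rcases Nat.mod_two_eq_zero_or_one i with h | h <;> simp [h] <;> omega

theorem nthString_ofBits (x : List Bool) : nthString x.length (ofBits x) = x := by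
  induction x with
  | nil => rfl
  | cons b x ih =>
    rw [List.length_cons, nthString_succ, ofBits_cons]
    have h1 : Nat.bit b (ofBits x) / 2 = ofBits x := by rw [Nat.bit_val]; cases b <;> simp; omega
    have h2 : decide (Nat.bit b (ofBits x) % 2 = 1) = b := by
      rw [Nat.bit_val]; cases b <;> simp
    rw [h1, h2, ih]

theorem ofBits_lt (x : List Bool) : ofBits x < 2 ^ x.length := by
  simpa [ofBits] using binVal_lt x.reverse

variable {P : Measure (ℕ → Bool)}

/-- The measure of an enumerable open set is a limit from below of computable dyadic
rationals. -/
theorem IsComputableProb.exists_approx (hP : IsComputableProb P) {G : α × List Bool → Prop}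
    (hG : REPred G) :
    ∃ h : α → ℕ → ℕ, (Computable fun s : α × ℕ => h s.1 s.2) ∧
      (∀ a t, (h a t : ℝ) / 4 ^ t ≤ P.real (openSet fun σ => G (a, σ))) ∧
      ∀ a, Filter.Tendsto (fun t => (h a t : ℝ) / 4 ^ t) Filter.atTop
        (nhds (P.real (openSet fun σ => G (a, σ)))) := by
  have := hP.isProb
  obtain ⟨H, hH, hmono, hopen⟩ := hG.exists_monotone_stage
  obtain ⟨g, hg, hgP⟩ := hP.computable
  -- Each of at most `2 ^ t` cylinders is approximated to within `4 ^ (-t)`, so the total error is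
  -- at most `2 ^ (-t)`.
  let S : α → ℕ → ℕ := fun a t => ∑ i ∈ Finset.range (2 ^ t),
    bif H (a, nthString t i) then g (nthString t i) (2 * t) else 0
  have hS : Computable fun s : α × ℕ => S s.1 s.2 := by
    refine Computable.sum_range (α := α × ℕ) (f := fun s => 2 ^ s.2)
      (g := fun s i => bif H (s.1, nthString s.2 i) then g (nthString s.2 i) (2 * s.2) else 0)
      (by fun_prop) ?_
    have h1 : Computable fun s : (α × ℕ) × ℕ => nthString s.1.2 s.2 :=
      computable_nthString.comp (g := fun s : (α × ℕ) × ℕ => (s.1.2, s.2)) (by fun_prop)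
    have h2 : Computable fun s : (α × ℕ) × ℕ => g (nthString s.1.2 s.2) (2 * s.1.2) :=
      hg.comp h1 (by fun_prop)
    have h3 : Computable fun s : (α × ℕ) × ℕ => H (s.1.1, nthString s.1.2 s.2) :=
      hH.comp (Computable.pair (by fun_prop) h1)
    exact Computable.cond h3 h2 (.const 0)
  let E : α → ℕ → Set (ℕ → Bool) := fun a t => {ω | H (a, initSeg ω t) = true}
  have hE : ∀ a, openSet (fun σ => G (a, σ)) = ⋃ t, E a t := by
    intro a
    rw [hopen]
    ext
    simp [openSet, E]
  have hEmono : ∀ a, Monotone (E a) := fun a s t hst ω h => hmono _ _ _ (initSeg_prefix ω hst) h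
  have hElim : ∀ a, Filter.Tendsto (fun t => P.real (E a t)) Filter.atTop
      (nhds (P.real (openSet fun σ => G (a, σ)))) := by
    intro a
    rw [hE]
    exact (ENNReal.tendsto_toReal (measure_ne_top _ _)).comp
      (tendsto_measure_iUnion_atTop (hEmono a))
  have hEsum : ∀ a t, P.real (E a t) = ∑ i ∈ Finset.range (2 ^ t),
      if H (a, nthString t i) = true then P.real (cylinderSet (nthString t i)) else 0 := by
    intro a t
    rw [← Finset.sum_filter, ← measureReal_biUnion_finset]
    · congr 1
      ext ω
      simp only [E, Set.mem_ofPred_eq, Finset.mem_filter, Finset.mem_range, Set.mem_iUnion,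
        cylinderSet, length_nthString, exists_prop]
      constructor
      · intro h
        have e : nthString t (ofBits (initSeg ω t)) = initSeg ω t := by
          simpa using nthString_ofBits (initSeg ω t)
        exact ⟨ofBits (initSeg ω t), ⟨by simpa using ofBits_lt (initSeg ω t), by rwa [e]⟩, e.symm⟩
      · rintro ⟨i, ⟨-, h⟩, hi⟩
        rwa [hi]
    · intro i hi j hj hij
      simp only [Finset.coe_filter, Finset.mem_range, Set.mem_ofPred_eq] at hi hj
      refine disjoint_cylinderSet fun hc => hij ?_
      rw [← ofBits_nthString t i hi.1, ← ofBits_nthString t j hj.1, hc.eq_of_length (by simp)]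
    · exact fun i _ => measurableSet_cylinderSet _
  have hbound : ∀ a t, |4 ^ t * P.real (E a t) - S a t| ≤ 2 ^ t := by
    intro a t
    rw [hEsum]
    simp only [S, Nat.cast_sum, Finset.mul_sum, ← Finset.sum_sub_distrib]
    refine (Finset.abs_sum_le_sum_abs _ _).trans ((Finset.sum_le_sum (g := fun _ => (1 : ℝ))
      fun i _ => ?_).trans (by simp))
    have h1 := hgP (nthString t i) (2 * t)
    have h4 : (2 : ℝ) ^ (2 * t) = 4 ^ t := by rw [pow_mul]; norm_num
    rw [h4] at h1
    have h5 : (0 : ℝ) < 4 ^ t := by positivity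
    cases H (a, nthString t i)
    · simp
    · simp only [if_true, cond_true]
      have h6 := mul_le_mul_of_nonneg_left h1 h5.le
      rw [← abs_of_pos h5, ← abs_mul, abs_of_pos h5, mul_sub, mul_div_cancel₀ _ h5.ne',
        mul_div_cancel₀ _ h5.ne'] at h6
      exact h6
  -- Subtracting the error bound makes the approximation one from below; truncation at zero is
  -- harmless.
  have hup : ∀ a t, ((S a t - 2 ^ t : ℕ) : ℝ) / 4 ^ t ≤ P.real (E a t) := by
    intro a t
    rw [div_le_iff₀ (by positivity)]
    rcases le_total (S a t) (2 ^ t) with h | h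
    · rw [Nat.sub_eq_zero_of_le h]
      simp only [Nat.cast_zero]
      positivity
    · have := (abs_le.1 (hbound a t)).1
      push_cast [Nat.cast_sub h]
      linarith
  have hlow : ∀ a t, P.real (E a t) - 2 * (2⁻¹ : ℝ) ^ t ≤ ((S a t - 2 ^ t : ℕ) : ℝ) / 4 ^ t := by
    intro a t
    have h5 : (0 : ℝ) < 4 ^ t := by positivity
    have e : (2⁻¹ : ℝ) ^ t * 4 ^ t = 2 ^ t := by rw [← mul_pow]; norm_num
    rw [le_div_iff₀ h5, sub_mul, mul_assoc, e]
    have h1 := (abs_le.1 (hbound a t)).2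
    have h2 : (S a t : ℝ) - 2 ^ t ≤ ((S a t - 2 ^ t : ℕ) : ℝ) := by
      have h3 : S a t ≤ (S a t - 2 ^ t) + 2 ^ t := by omega
      have h4 : (S a t : ℝ) ≤ ((S a t - 2 ^ t : ℕ) : ℝ) + 2 ^ t := by exact_mod_cast h3
      linarith
    linarith
  refine ⟨fun a t => S a t - 2 ^ t, by fun_prop, fun a t => (hup a t).trans ?_, fun a => ?_⟩
  · rw [hE]
    exact measureReal_mono (Set.subset_iUnion _ _)
  · refine tendsto_of_tendsto_of_tendsto_of_le_of_le ?_ (hElim a) (fun t => hlow a t)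
      fun t => hup a t
    have h1 : Filter.Tendsto (fun t : ℕ => (2⁻¹ : ℝ) ^ t) Filter.atTop (nhds 0) :=
      tendsto_pow_atTop_nhds_zero_of_lt_one (by norm_num) (by norm_num)
    simpa using (hElim a).sub (h1.const_mul 2)

/-- Strict lower bounds on combinations of the measures of enumerable open sets are
enumerable. -/
theorem IsComputableProb.re_lt (hP : IsComputableProb P) {G G' : α × List Bool → Prop}
    (hG : REPred G) (hG' : REPred G') {c d e : α → ℕ} (hc : Computable c) (hd : Computable d)
    (he : Computable e) :
    REPred fun a => (c a : ℝ) < d a * P.real (openSet fun σ => G (a, σ)) +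
      e a * P.real (openSet fun σ => G' (a, σ)) := by
  obtain ⟨h, hh, hle, hlim⟩ := hP.exists_approx hG
  obtain ⟨h', hh', hle', hlim'⟩ := hP.exists_approx hG'
  refine REPred.of_eq (p := fun a => ∃ t : ℕ, c a * 4 ^ t < d a * h a t + e a * h' a t)
    (.exists_of_primcodable (.lt (by fun_prop) (by fun_prop))) fun a => ?_
  have key : ∀ t, c a * 4 ^ t < d a * h a t + e a * h' a t ↔
      (c a : ℝ) < d a * ((h a t : ℝ) / 4 ^ t) + e a * ((h' a t : ℝ) / 4 ^ t) := by
    intro t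
    have h5 : (0 : ℝ) < 4 ^ t := by positivity
    rw [← mul_div_assoc, ← mul_div_assoc, ← add_div, lt_div_iff₀ h5]
    norm_cast
  simp only [key]
  constructor
  · rintro ⟨t, ht⟩
    refine ht.trans_le ?_
    have h1 := hle a t
    have h2 := hle' a t
    gcongr
  · intro hlt
    exact ((((hlim a).const_mul _).add ((hlim' a).const_mul _)).eventually_const_lt hlt).exists

/-- An infinite sequence that is `K`-random is Martin-Löf random for the uniform measure. -/
theorem IsKRandom.isMartinLofRandom {U : List Bool → List Bool →. List Bool}
    (hU : IsOptimalPrefixMachine U) (hP : IsUniformMeasure P) {ω : ℕ → Bool}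
    (hω : IsKRandom U ω) : IsMartinLofRandom P ω := by
  intro W hW hWP
  by_contra! hall
  obtain ⟨b, hb⟩ := hω
  obtain ⟨H, hH, hmono, hopen⟩ := REPred.exists_monotone_stage hW
  -- The minimal strings of the test at level `2 * (j + 1)` are pairwise incomparable, so their
  -- cylinders are disjoint.
  let mini : ℕ → List Bool → Bool := fun j τ => H (2 * (j + 1), τ) &&
    !decide (∃ i < τ.length, H (2 * (j + 1), τ.take i) = true)
  have hmini : Computable fun s : ℕ × List Bool => mini s.1 s.2 := by
    have := Computable.bounded_exists (α := ℕ × List Bool) (f := fun s => s.2.length)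
      (g := fun s i => H (2 * (s.1 + 1), s.2.take i)) (by fun_prop) (by fun_prop)
    fun_prop
  have hmini_iff : ∀ j τ, mini j τ = true ↔ H (2 * (j + 1), τ) = true ∧
      ∀ i < τ.length, ¬ H (2 * (j + 1), τ.take i) = true := by
    intro j τ
    simp [mini]
  have hanti' : ∀ j σ τ, mini j σ = true → mini j τ = true → σ <+: τ → σ = τ := by
    intro j σ τ hσ hτ h
    by_contra hne
    have hlt : σ.length < τ.length := lt_of_le_of_ne h.length_le fun hl => hne (h.eq_of_length hl)
    refine ((hmini_iff _ _).1 hτ).2 _ hlt ?_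
    rw [← List.prefix_iff_eq_take.1 h]
    exact ((hmini_iff _ _).1 hσ).1
  have hsum_j : ∀ j, ∑' τ : {τ // mini j τ = true}, (2⁻¹ : ENNReal) ^ τ.1.length ≤
      (2⁻¹ : ENNReal) ^ (2 * (j + 1)) := by
    intro j
    refine le_trans ?_ (hWP (2 * (j + 1)))
    simp_rw [← show ∀ σ, P (cylinderSet σ) = _ from hP]
    refine (tsum_meas_le_meas_iUnion_of_disjoint P
      (fun τ : {τ // mini j τ = true} => measurableSet_cylinderSet τ.1) ?_).trans
      (measure_mono (Set.iUnion_subset fun τ => ?_))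
    · rintro ⟨σ, hσ⟩ ⟨τ, hτ⟩ hne
      refine disjoint_cylinderSet fun hc => hne (Subtype.ext ?_)
      rcases hc with hc | hc
      · exact hanti' j _ _ hσ hτ hc
      · exact (hanti' j _ _ hτ hσ hc).symm
    · rw [testSet_eq_openSet, hopen]
      intro ω hω
      refine ⟨τ.1.length, ?_⟩
      rw [show initSeg ω τ.1.length = τ.1 from hω]
      exact ((hmini_iff _ _).1 τ.2).1
  -- A minimal string at level `2 * (j + 1)` is to be compressed by `j + 1` bits. This multiplies
  -- its weight by `2 ^ (j + 1)`, and the level sums become `2 ^ (-(j + 1))`, of total one.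
  let A : (ℕ × List Bool) × ℕ × List Bool → Prop := fun t =>
    ∃ j, mini j t.2.2 = true ∧ t.2.1 + (j + 1) = t.2.2.length
  obtain ⟨C, hC⟩ := hU.coding (A := A)
    (.exists_of_primcodable (.and (.of_computable (hmini.comp
      (g := fun s : ((ℕ × List Bool) × ℕ × List Bool) × ℕ => (s.2, s.1.2.2)) (by fun_prop)))
      (.eq (by fun_prop) (by fun_prop)))) (by
    intro k
    choose j hj hl using fun t : {t : ℕ × List Bool // A (k, t)} => t.2
    have hinj : Function.Injective fun t : {t : ℕ × List Bool // A (k, t)} =>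
        (⟨j t, ⟨t.1.2, hj t⟩⟩ : Σ j, {τ // mini j τ = true}) := by
      intro t t' h
      have h1 : j t = j t' := congrArg Sigma.fst h
      have h2 : t.1.2 = t'.1.2 :=
        congrArg (fun s : Σ j, {τ // mini j τ = true} => s.2.1) h
      have h3 := hl t
      have h4 := hl t'
      simp only at h3 h4
      exact Subtype.ext (Prod.ext (by rw [h2, h1] at h3; omega) h2)
    calc ∑' t : {t : ℕ × List Bool // A (k, t)}, (2⁻¹ : ENNReal) ^ t.1.1
        = ∑' t : {t : ℕ × List Bool // A (k, t)},
            (2 : ENNReal) ^ (j t + 1) * (2⁻¹) ^ t.1.2.length := by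
          refine tsum_congr fun t => ?_
          have h3 := hl t
          simp only at h3
          rw [← h3, pow_add _ t.1.1, mul_left_comm, ← mul_pow, ENNReal.mul_inv_cancel (by simp) (by simp),
            one_pow, mul_one]
      _ ≤ ∑' s : Σ j, {τ // mini j τ = true}, (2 : ENNReal) ^ (s.1 + 1) * (2⁻¹) ^ s.2.1.length :=
          ENNReal.tsum_comp_le_tsum_of_injective hinj
            fun s : Σ j, {τ // mini j τ = true} => (2 : ENNReal) ^ (s.1 + 1) * (2⁻¹) ^ s.2.1.length
      _ = ∑' j, (2 : ENNReal) ^ (j + 1) * ∑' τ : {τ // mini j τ = true}, (2⁻¹) ^ τ.1.length := by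
          rw [ENNReal.tsum_sigma' (fun s : Σ j, {τ // mini j τ = true} =>
            (2 : ENNReal) ^ (s.1 + 1) * (2⁻¹) ^ s.2.1.length)]
          simp_rw [ENNReal.tsum_mul_left]
      _ ≤ ∑' j : ℕ, (2⁻¹ : ENNReal) ^ (j + 1) := by
          refine ENNReal.tsum_le_tsum fun j => (mul_le_mul_right (hsum_j j) _).trans_eq ?_
          rw [two_mul, pow_add _ (j + 1), ← mul_assoc, ← mul_pow,
            ENNReal.mul_inv_cancel (by simp) (by simp), one_pow, one_mul]
      _ = 1 := by
          rw [ENNReal.tsum_geometric_add_one, ENNReal.one_sub_inv_two, inv_inv,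
            ENNReal.inv_mul_cancel (by simp) (by simp)])
  -- Chosen so that the saving of `j + 1` bits exceeds all additive constants together with the
  -- randomness deficiency `b`.
  let j := plainK U (Nat.bits 0) + C + b
  have hmem : ω ∈ openSet fun σ => H (2 * (j + 1), σ) = true := by
    rw [← hopen, ← testSet_eq_openSet]
    exact hall _
  classical
  obtain ⟨n, hn, hmin⟩ : ∃ n, H (2 * (j + 1), initSeg ω n) = true ∧
      ∀ i < n, ¬ H (2 * (j + 1), initSeg ω i) = true :=
    ⟨Nat.find hmem, Nat.find_spec hmem, fun i hi => Nat.find_min hmem hi⟩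
  have hm : mini j (initSeg ω n) = true := by
    rw [hmini_iff]
    refine ⟨hn, fun i hi => ?_⟩
    rw [length_initSeg] at hi
    rw [take_initSeg, min_eq_left hi.le]
    exact hmin i hi
  -- A string of the test cannot be too short, as its cylinder has measure at most `2 ^ (-2 * (j +
  -- 1))`. Hence `n - (j + 1)` is not truncated.
  have hlen : j + 1 ≤ n := by
    have h1 := (ENNReal.le_tsum (f := fun τ : {τ // mini j τ = true} =>
      (2⁻¹ : ENNReal) ^ τ.1.length) ⟨_, hm⟩).trans (hsum_j j)
    simp only [length_initSeg] at h1
    have h2 := ENNReal.toReal_mono (by simp) h1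
    simp only [ENNReal.toReal_pow, ENNReal.toReal_inv, ENNReal.toReal_ofNat] at h2
    rw [pow_le_pow_iff_right_of_lt_one₀ (by norm_num) (by norm_num)] at h2
    omega
  have h1 : plainK U (initSeg ω n) ≤ n - (j + 1) + plainK U (Nat.bits 0) + C :=
    hC 0 [] (n - (j + 1)) (initSeg ω n) ⟨j, hm, by simp; omega⟩
  have h2 := hb n
  have h3 : j = plainK U (Nat.bits 0) + C + b := rfl
  omega

end OpenSets

/-! ### Conditional probabilities and complexity -/

section Weights

/-- A geometric tail is twice its first term. Thus requesting every sufficiently large length, as an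
enumeration from below does, costs only a factor of two. -/
theorem tsum_pow_le_two_mul (r : ℝ) :
    ∑' l : {l : ℕ // (2⁻¹ : ℝ) ^ l ≤ r}, (2⁻¹ : ENNReal) ^ l.1 ≤ 2 * ENNReal.ofReal r := by
  classical
  by_cases hne : ∃ l : ℕ, (2⁻¹ : ℝ) ^ l ≤ r
  · set m := Nat.find hne
    have hm : (2⁻¹ : ℝ) ^ m ≤ r := Nat.find_spec hne
    have hle : ∀ l : {l : ℕ // (2⁻¹ : ℝ) ^ l ≤ r}, m ≤ l.1 := fun l => Nat.find_min' hne l.2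
    calc ∑' l : {l : ℕ // (2⁻¹ : ℝ) ^ l ≤ r}, (2⁻¹ : ENNReal) ^ l.1
        = ∑' l : {l : ℕ // (2⁻¹ : ℝ) ^ l ≤ r}, (2⁻¹ : ENNReal) ^ m * (2⁻¹) ^ (l.1 - m) :=
          tsum_congr fun l => by rw [← pow_add, Nat.add_sub_cancel' (hle l)]
      _ ≤ ∑' j : ℕ, (2⁻¹ : ENNReal) ^ m * (2⁻¹) ^ j :=
          ENNReal.tsum_comp_le_tsum_of_injective
            (f := fun l : {l : ℕ // (2⁻¹ : ℝ) ^ l ≤ r} => l.1 - m)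
            (fun l l' h => Subtype.ext (by
              have h1 := hle l
              have h2 := hle l'
              simp only at h
              omega)) fun j => (2⁻¹ : ENNReal) ^ m * (2⁻¹) ^ j
      _ = 2 * (2⁻¹ : ENNReal) ^ m := by
          rw [ENNReal.tsum_mul_left, ENNReal.tsum_geometric, ENNReal.one_sub_inv_two, inv_inv,
            mul_comm]
      _ ≤ 2 * ENNReal.ofReal r := by
          gcongr
          have := ENNReal.ofReal_le_ofReal hm
          rwa [ENNReal.ofReal_pow (by norm_num), ENNReal.ofReal_inv_of_pos (by norm_num),
            ENNReal.ofReal_ofNat] at this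
  · have : IsEmpty {l : ℕ // (2⁻¹ : ℝ) ^ l ≤ r} := ⟨fun l => hne ⟨l.1, l.2⟩⟩
    simp

/-- Supplies a codeword length for probability `p`; the strict factor two pays for the geometric
tail in `tsum_pow_le_two_mul`, or for fitting a dyadic interval in arithmetic coding. -/
theorem exists_nat_two_lt {p : ℝ} (h0 : 0 < p) (h1 : p ≤ 1) :
    ∃ l : ℕ, 2 < 2 ^ l * p ∧ (l : ℝ) ≤ -Real.logb 2 p + 2 := by
  have hlog : Real.logb 2 p ≤ 0 := Real.logb_nonpos (by norm_num) h0.le h1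
  refine ⟨⌊-Real.logb 2 p + 1⌋₊ + 1, ?_, ?_⟩
  · have h2 := Nat.lt_floor_add_one (-Real.logb 2 p + 1)
    have h3 : (2 : ℝ) ^ (-Real.logb 2 p + 1) < 2 ^ ((⌊-Real.logb 2 p + 1⌋₊ + 1 : ℕ) : ℝ) :=
      Real.rpow_lt_rpow_of_exponent_lt (by norm_num) (by push_cast; exact h2)
    rw [Real.rpow_natCast, Real.rpow_add (by norm_num), Real.rpow_neg (by norm_num),
      Real.rpow_logb (by norm_num) (by norm_num) h0, Real.rpow_one] at h3
    have h4 := mul_lt_mul_of_pos_right h3 h0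
    rwa [mul_right_comm, inv_mul_cancel₀ h0.ne', one_mul] at h4
  · have := Nat.floor_le (a := -Real.logb 2 p + 1) (by linarith)
    push_cast
    linarith

/-- A polynomially growing weight that makes the sum over all scales of the reciprocal weights
of all pairs of names at most one. -/
def scaleWeight (c a s : ℕ) : ℕ := s * (s + 1) * ((s + c) ^ a) ^ 2

theorem scaleWeight_pos (c a : ℕ) {s : ℕ} (hs : 1 ≤ s) : 0 < scaleWeight c a s := by
  unfold scaleWeight; positivity

theorem exists_logb_scaleWeight_le (c a : ℕ) :
    ∃ α β : ℝ, ∀ s : ℕ, 1 ≤ s → Real.logb 2 (scaleWeight c a s) ≤ α * Real.logb 2 s + β := by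
  -- From `s + 1 ≤ 2 * s` and `s + c ≤ s * (1 + c)` for `s ≥ 1`.
  refine ⟨(2 + a * 2 : ℕ), Real.logb 2 (2 * (1 + c) ^ (a * 2) : ℝ), fun s hs => ?_⟩
  have hs' : (1 : ℝ) ≤ s := by exact_mod_cast hs
  have hpos : (0 : ℝ) < s := by linarith
  rw [← Real.logb_pow, ← Real.logb_mul (by positivity) (by positivity)]
  refine Real.logb_le_logb_of_le (by norm_num) (by exact_mod_cast scaleWeight_pos c a hs) ?_
  have h1 : scaleWeight c a s ≤ s * (s + s) * ((s * (1 + c)) ^ a) ^ 2 := by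
    unfold scaleWeight
    gcongr
    nlinarith
  calc (scaleWeight c a s : ℝ) ≤ (s * (s + s) * ((s * (1 + c)) ^ a) ^ 2 : ℕ) := by
        exact_mod_cast h1
    _ = _ := by push_cast; simp only [mul_pow]; ring

theorem tsum_scaleWeight_le {V : Type*} {rep : ℕ → V → V} {c a : ℕ}
    (h : ∀ s : ℕ, 1 ≤ s → (repSet rep s).encard ≤ (((s + c) ^ a : ℕ) : ℕ∞)) :
    ∑' s : {s : ℕ // 1 ≤ s}, ∑' _ : repSet rep s × repSet rep s,
      ENNReal.ofReal (1 / scaleWeight c a s) ≤ 1 := by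
  have h1 : ∀ s : {s : ℕ // 1 ≤ s}, ∑' _ : repSet rep s × repSet rep s,
      ENNReal.ofReal (1 / scaleWeight c a s) ≤
        ENNReal.ofReal (1 / (s.1 * (s.1 + 1) : ℕ)) := by
    rintro ⟨s, hs⟩
    have hcard : ((ENat.card (repSet rep s × repSet rep s) : ENat) : ENNReal) ≤
        ENNReal.ofReal ((((s + c) ^ a) ^ 2 : ℕ) : ℝ) := by
      rw [ENNReal.ofReal_natCast, ENat.card_prod, pow_two, ← ENat.toENNReal_coe,
        ENat.toENNReal_le, Nat.cast_mul]
      exact mul_le_mul' (h s hs) (h s hs)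
    rw [ENNReal.tsum_const]
    calc _ ≤ ENNReal.ofReal ((((s + c) ^ a) ^ 2 : ℕ) : ℝ) *
          ENNReal.ofReal (1 / scaleWeight c a s) := by gcongr
      _ = _ := by
        rw [← ENNReal.ofReal_mul (by positivity)]
        congr 1
        have : (0 : ℝ) < s := by exact_mod_cast hs
        have : (0 : ℝ) < ((s : ℝ) + c) ^ a := by positivity
        unfold scaleWeight
        push_cast
        field_simp
  refine (ENNReal.tsum_le_tsum h1).trans ?_
  have hinj : Function.Injective fun s : {s : ℕ // 1 ≤ s} => s.1 - 1 := by
    rintro ⟨s, hs⟩ ⟨t, ht⟩ h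
    simp only [Subtype.mk.injEq] at h ⊢
    omega
  have h2 := ENNReal.tsum_comp_le_tsum_of_injective hinj
    fun j : ℕ => ENNReal.ofReal (1 / ((j + 1) * (j + 1 + 1) : ℕ))
  refine le_trans (le_of_eq (tsum_congr fun s => ?_)) (h2.trans ?_)
  · rw [Nat.sub_add_cancel s.2]
  · refine ENNReal.tsum_le_of_sum_range_le fun n => ?_
    rw [← ENNReal.ofReal_sum_of_nonneg fun i _ => by positivity, ← ENNReal.ofReal_one]
    refine ENNReal.ofReal_le_ofReal ?_
    -- The factor `s * (s + 1)` of the weight makes the sum over scales telescope.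
    have : ∀ n : ℕ, ∑ j ∈ Finset.range n, (1 : ℝ) / ((j + 1) * (j + 1 + 1) : ℕ) =
        1 - 1 / (n + 1) := by
      intro n
      induction n with
      | zero => simp
      | succ n ih =>
        rw [Finset.sum_range_succ, ih]
        push_cast
        field_simp
        ring
    rw [this]
    have : (0 : ℝ) ≤ 1 / (n + 1) := by positivity
    linarith

end Weights

/-! ### Markov-type bounds for conditional probabilities -/

section CondProb

variable {Ω : Set (ℕ → Bool)} {P : Measure (ℕ → Bool)} {X Y : (ℕ → Bool) → List Bool}

theorem measure_congr_of_full (hΩ : P Ωᶜ = 0) {A B : Set (ℕ → Bool)}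
    (h : ∀ ω ∈ Ω, ω ∈ A ↔ ω ∈ B) : P A = P B := by
  refine measure_congr (Filter.eventuallyEq_set.2 ?_)
  filter_upwards [compl_mem_ae_iff.2 hΩ] with ω hω
  exact h ω (by simpa using hω)

theorem measureReal_congr_of_full (hΩ : P Ωᶜ = 0) {A B : Set (ℕ → Bool)}
    (h : ∀ ω ∈ Ω, ω ∈ A ↔ ω ∈ B) : P.real A = P.real B :=
  congrArg ENNReal.toReal (measure_congr_of_full hΩ h)

theorem nullMeasurableSet_of_full (hΩ : P Ωᶜ = 0) {A B : Set (ℕ → Bool)}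
    (h : ∀ ω ∈ Ω, ω ∈ A ↔ ω ∈ B) (hB : MeasurableSet B) : NullMeasurableSet A P := by
  refine hB.nullMeasurableSet.congr (Filter.eventuallyEq_set.2 ?_)
  filter_upwards [compl_mem_ae_iff.2 hΩ] with ω hω
  exact (h ω (by simpa using hω)).symm

theorem condProb_le_one [IsProbabilityMeasure P] (ω : ℕ → Bool) : condProb Ω P X Y ω ≤ 1 :=
  div_le_one_of_le₀ (measureReal_mono fun _ h => ⟨h.1, h.2.2⟩) measureReal_nonneg

theorem tsum_measure_fiber_le
    (hX : ∀ x, NullMeasurableSet {ω | ω ∈ Ω ∧ X ω = x} P)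
    (hY : ∀ y, NullMeasurableSet {ω | ω ∈ Ω ∧ Y ω = y} P) (y : List Bool) :
    ∑' x, P {ω | ω ∈ Ω ∧ X ω = x ∧ Y ω = y} ≤ P {ω | ω ∈ Ω ∧ Y ω = y} := by
  have h : ∀ x, {ω | ω ∈ Ω ∧ X ω = x ∧ Y ω = y} =
      {ω | ω ∈ Ω ∧ X ω = x} ∩ {ω | ω ∈ Ω ∧ Y ω = y} := by
    intro x
    ext ω
    exact ⟨fun h => ⟨⟨h.1, h.2.1⟩, h.1, h.2.2⟩, fun h => ⟨h.1.1, h.1.2, h.2.2⟩⟩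
  refine (tsum_meas_le_meas_iUnion_of_disjoint₀ P (fun x => ?_) ?_).trans
    (measure_mono (Set.iUnion_subset fun x ω hω => ⟨hω.1, hω.2.2⟩))
  · rw [h]
    exact (hX x).inter (hY y)
  · intro x x' hxx
    refine Disjoint.aedisjoint (Set.disjoint_left.2 fun ω h1 h2 => hxx ?_)
    exact h1.2.1.symm.trans h2.2.1

/-- If the complexities of the possible values of `X` satisfy Kraft's inequality for each
condition, then the conditional probability of `X` given `Y` is rarely much smaller than its
algorithmic counterpart. -/
theorem measure_condProb_lt_le [IsProbabilityMeasure P]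
    (hY : ∀ y, NullMeasurableSet {ω | ω ∈ Ω ∧ Y ω = y} P) {C : List Bool → List Bool → ℕ}
    (hC : ∀ y, ∑' x : {x // ∃ ω ∈ Ω, X ω = x}, (2⁻¹ : ENNReal) ^ C x.1 y ≤ 1) {δ : ℝ} (hδ : 0 < δ) :
    P {ω | ω ∈ Ω ∧ condProb Ω P X Y ω * 2 ^ C (X ω) (Y ω) < δ} ≤ ENNReal.ofReal δ := by
  classical
  let B : List Bool → {x // ∃ ω ∈ Ω, X ω = x} → Set (ℕ → Bool) := fun y x =>
    {ω | ω ∈ Ω ∧ (X ω = x.1 ∧ Y ω = y) ∧ condProb Ω P X Y ω * 2 ^ C (X ω) (Y ω) < δ}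
  have hB : ∀ y x, P (B y x) ≤
      ENNReal.ofReal δ * ((2⁻¹ : ENNReal) ^ C x.1 y * P {ω | ω ∈ Ω ∧ Y ω = y}) := by
    intro y x
    rcases (B y x).eq_empty_or_nonempty with he | ⟨ω, hω, ⟨hx, hy⟩, hlt⟩
    · rw [he]; simp
    have hsub : B y x ⊆ {ω' | ω' ∈ Ω ∧ X ω' = X ω ∧ Y ω' = Y ω} :=
      fun ω' h => ⟨h.1, h.2.1.1.trans hx.symm, h.2.1.2.trans hy.symm⟩
    refine (measure_mono hsub).trans ?_
    unfold condProb at hlt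
    rw [hx, hy] at hlt ⊢
    -- If `Y = y` is null, the quotient has the default value `0` and `hlt` carries no information,
    -- but then the joint event is null as well.
    rcases (measureReal_nonneg (μ := P) (s := {ω' | ω' ∈ Ω ∧ Y ω' = y})).eq_or_lt with h0 | h0
    · have : P {ω' | ω' ∈ Ω ∧ X ω' = x.1 ∧ Y ω' = y} ≤ P {ω' | ω' ∈ Ω ∧ Y ω' = y} :=
        measure_mono fun _ h => ⟨h.1, h.2.2⟩
      rw [(measureReal_eq_zero_iff).1 h0.symm] at this ⊢
      simpa using this
    · rw [div_mul_eq_mul_div, div_lt_iff₀ h0] at hlt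
      have h1 : P.real {ω' | ω' ∈ Ω ∧ X ω' = x.1 ∧ Y ω' = y} ≤
          δ * ((2⁻¹) ^ C x.1 y * P.real {ω' | ω' ∈ Ω ∧ Y ω' = y}) := by
        have h2 : (0 : ℝ) < 2 ^ C x.1 y := by positivity
        rw [inv_pow, mul_left_comm, ← div_eq_inv_mul, le_div_iff₀ h2]
        exact hlt.le
      rw [← ofReal_measureReal, ← ofReal_measureReal (s := {ω' | ω' ∈ Ω ∧ Y ω' = y})]
      refine (ENNReal.ofReal_le_ofReal h1).trans_eq ?_
      rw [ENNReal.ofReal_mul hδ.le, ENNReal.ofReal_mul (by positivity),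
        ENNReal.ofReal_pow (by norm_num), ENNReal.ofReal_inv_of_pos (by norm_num),
        ENNReal.ofReal_ofNat]
  calc P {ω | ω ∈ Ω ∧ condProb Ω P X Y ω * 2 ^ C (X ω) (Y ω) < δ}
      ≤ P (⋃ y, ⋃ x, B y x) := by
        refine measure_mono fun ω hω => ?_
        simp only [Set.mem_iUnion]
        exact ⟨Y ω, ⟨X ω, ω, hω.1, rfl⟩, hω.1, ⟨rfl, rfl⟩, hω.2⟩
    _ ≤ ∑' y, ∑' x, P (B y x) :=
        (measure_iUnion_le _).trans (ENNReal.tsum_le_tsum fun y => measure_iUnion_le _)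
    _ ≤ ∑' y, ∑' x : {x // ∃ ω ∈ Ω, X ω = x}, ENNReal.ofReal δ *
          ((2⁻¹ : ENNReal) ^ C x.1 y * P {ω | ω ∈ Ω ∧ Y ω = y}) :=
        ENNReal.tsum_le_tsum fun y => ENNReal.tsum_le_tsum fun x => hB y x
    _ ≤ ∑' y, ENNReal.ofReal δ * P {ω | ω ∈ Ω ∧ Y ω = y} := by
        refine ENNReal.tsum_le_tsum fun y => ?_
        rw [ENNReal.tsum_mul_left, ENNReal.tsum_mul_right]
        gcongr
        exact (mul_le_mul_left (hC y) _).trans_eq (one_mul _)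
    _ ≤ ENNReal.ofReal δ := by
        rw [ENNReal.tsum_mul_left]
        refine (mul_le_mul_right (?_ : _ ≤ (1 : ENNReal)) _).trans_eq (mul_one _)
        refine (tsum_meas_le_meas_iUnion_of_disjoint₀ P hY ?_).trans prob_le_one
        intro y y' hyy
        refine Disjoint.aedisjoint (Set.disjoint_left.2 fun ω h1 h2 => hyy ?_)
        exact h1.2.symm.trans h2.2

end CondProb

/-- The strings that extend a member of `G` as well as a member of `G'`. -/
def commonExt (G G' : List Bool → Prop) (τ : List Bool) : Prop :=
  ∃ τ₁ τ₂, τ₁ <+: τ ∧ τ₂ <+: τ ∧ G τ₁ ∧ G' τ₂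

theorem openSet_commonExt (G G' : List Bool → Prop) :
    openSet (commonExt G G') = openSet G ∩ openSet G' := by
  ext ω
  constructor
  · rintro ⟨t, τ₁, τ₂, h1, h2, hG, hG'⟩
    rw [eq_initSeg_of_prefix h1] at hG
    rw [eq_initSeg_of_prefix h2] at hG'
    exact ⟨⟨_, hG⟩, ⟨_, hG'⟩⟩
  · rintro ⟨⟨t, hG⟩, ⟨t', hG'⟩⟩
    exact ⟨max t t', _, _, initSeg_prefix ω (le_max_left _ _), initSeg_prefix ω (le_max_right _ _),
      hG, hG'⟩

theorem REPred.commonExt {α : Type*} [Primcodable α] {G G' : α × List Bool → Prop}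
    (hG : REPred G) (hG' : REPred G') :
    REPred fun s : α × List Bool =>
      _root_.commonExt (fun σ => G (s.1, σ)) (fun σ => G' (s.1, σ)) s.2 := by
  refine .exists_of_primcodable (.exists_of_primcodable (.and (.prefix (by fun_prop)
    (by fun_prop)) (.and (.prefix (by fun_prop) (by fun_prop)) (.and ?_ ?_))))
  · have := hG.comp (f := fun s : ((α × List Bool) × List Bool) × List Bool => (s.1.1.1, s.1.2))
      (by fun_prop)
    exact this
  · have := hG'.comp (f := fun s : ((α × List Bool) × List Bool) × List Bool => (s.1.1.1, s.2))
      (by fun_prop)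
    exact this

/-! ### Random scale-embeddings -/

namespace IsRandomScaleEmbedding

variable {V : Type*} [MetricSpace V] {Ω : Set (ℕ → Bool)} {P : Measure (ℕ → Bool)}
  {rep : ℕ → V → V} {name : ℕ → V → ℕ} {Φ : ℕ → V → (ℕ → Bool) → List Bool}
  {U : List Bool → List Bool →. List Bool}

/-- A value is fixed by finitely many bits of the oracle, so the fiber agrees with an open set on
`Ω`. Nothing is known off `Ω`, hence only null measurability. -/
theorem nullMeasurableSet_fiber (hE : IsRandomScaleEmbedding Ω P rep name Φ) {s : ℕ} (hs : 1 ≤ s)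
    {w : V} (hw : w ∈ repSet rep s) (x : List Bool) :
    NullMeasurableSet {ω | ω ∈ Ω ∧ Φ s w ω = x} P := by
  obtain ⟨R, -, hR⟩ := hE.computable.computable
  refine nullMeasurableSet_of_full hE.full (B := openSet fun σ => R (s, name s w, σ, x))
    (fun ω hω => ?_) (measurableSet_openSet _)
  exact (and_iff_right hω).trans (hR s hs w hw ω hω x)

theorem finite_repSet (hE : IsRandomScaleEmbedding Ω P rep name Φ) {s : ℕ} (hs : 1 ≤ s) :
    (repSet rep s).Finite := by
  obtain ⟨c, a, h⟩ := hE.poly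
  exact Set.finite_of_encard_le_coe (h s hs)

/-- Conditional Kolmogorov complexity is bounded by the conditional probability, up to a
description of the names of the variables. -/
theorem exists_condK_le (hE : IsRandomScaleEmbedding Ω P rep name Φ)
    (hU : IsOptimalPrefixMachine U) :
    ∃ C : ℕ, ∀ s : ℕ, 1 ≤ s → ∀ w ∈ repSet rep s, ∀ w' ∈ repSet rep s, ∀ ω ∈ Ω,
      (condK U (Φ s w ω) (Φ s w' ω) : ℝ) ≤ -Real.logb 2 (condProb Ω P (Φ s w) (Φ s w') ω) +
        tripleK U s (name s w) (name s w') + C := by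
  have := hE.prob.isProb
  obtain ⟨R, hR, hRΦ⟩ := hE.computable.computable
  let F : ((ℕ × List Bool) × ℕ × List Bool) × List Bool → Prop := fun a =>
    commonExt (fun σ => R (a.1.1.1.unpair.1, a.1.1.1.unpair.2.unpair.1, σ, a.1.2.2))
      (fun σ => R (a.1.1.1.unpair.1, a.1.1.1.unpair.2.unpair.2, σ, a.1.1.2)) a.2
  have hF : REPred F := REPred.commonExt
    (G := fun a : ((ℕ × List Bool) × ℕ × List Bool) × List Bool =>
      R (a.1.1.1.unpair.1, a.1.1.1.unpair.2.unpair.1, a.2, a.1.2.2))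
    (G' := fun a : ((ℕ × List Bool) × ℕ × List Bool) × List Bool =>
      R (a.1.1.1.unpair.1, a.1.1.1.unpair.2.unpair.2, a.2, a.1.1.2))
    (hR.comp (by fun_prop)) (hR.comp (by fun_prop))
  -- On `Ω` this generates the event `Y ≠ y`. Its lower approximations are upper approximations of
  -- `P(Y = y)`, the denominator of the conditional probability.
  let H : ((ℕ × List Bool) × ℕ × List Bool) × List Bool → Prop := fun a =>
    ∃ y, y ≠ a.1.1.2 ∧ R (a.1.1.1.unpair.1, a.1.1.1.unpair.2.unpair.2, a.2, y)
  have hH : REPred H := by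
    refine .exists_of_primcodable (.and (.ne (by fun_prop) (by fun_prop)) ?_)
    have := hR.comp (f := fun a : (((ℕ × List Bool) × ℕ × List Bool) × List Bool) × List Bool =>
      (a.1.1.1.1.unpair.1, a.1.1.1.1.unpair.2.unpair.2, a.1.2, a.2)) (by fun_prop)
    exact this
  -- Nothing is assumed of `R` at other names, where requests could violate Kraft's inequality.
  let use : ℕ × ℕ → Prop := fun t => 1 ≤ t.1 ∧ ∃ w ∈ repSet rep t.1, name t.1 w = t.2
  have huse : REPred use := hE.computable.names_enumerable
  let A : (ℕ × List Bool) × ℕ × List Bool → Prop := fun t =>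
    use (t.1.1.unpair.1, t.1.1.unpair.2.unpair.1) ∧
    use (t.1.1.unpair.1, t.1.1.unpair.2.unpair.2) ∧
    ((2 : ℕ) : ℝ) < (2 ^ t.2.1 : ℕ) * P.real (openSet fun σ => F (t, σ)) +
      (2 : ℕ) * P.real (openSet fun σ => H (t, σ))
  have hA : REPred A := .and (huse.comp (by fun_prop)) (.and (huse.comp (by fun_prop))
    (hE.prob.re_lt hF hH (by fun_prop) (by fun_prop) (by fun_prop)))
  have hFval : ∀ s, 1 ≤ s → ∀ w ∈ repSet rep s, ∀ w' ∈ repSet rep s, ∀ y l x,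
      P.real (openSet fun σ => F (((Nat.pair s (Nat.pair (name s w) (name s w')), y), l, x), σ)) =
        P.real {ω | ω ∈ Ω ∧ Φ s w ω = x ∧ Φ s w' ω = y} := by
    intro s hs w hw w' hw' y l x
    refine measureReal_congr_of_full hE.full fun ω hω => ?_
    simp only [F, Nat.unpair_pair]
    rw [openSet_commonExt]
    refine Iff.trans ?_ (and_iff_right hω).symm
    rw [hRΦ s hs w hw ω hω, hRΦ s hs w' hw' ω hω]
    rfl
  have hHval : ∀ s, 1 ≤ s → ∀ w ∈ repSet rep s, ∀ w' ∈ repSet rep s, ∀ y l x,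
      P.real (openSet fun σ => H (((Nat.pair s (Nat.pair (name s w) (name s w')), y), l, x), σ)) =
        1 - P.real {ω | ω ∈ Ω ∧ Φ s w' ω = y} := by
    intro s hs w hw w' hw' y l x
    rw [← probReal_compl_eq_one_sub₀ (hE.nullMeasurableSet_fiber hs hw' y)]
    refine measureReal_congr_of_full hE.full fun ω hω => ?_
    simp only [H, Nat.unpair_pair, Set.mem_compl_iff, Set.mem_ofPred_eq, hω, true_and]
    constructor
    · rintro ⟨t, y', hne, hy'⟩ h
      exact hne (((hRΦ s hs w' hw' ω hω y').2 ⟨t, hy'⟩).symm.trans h)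
    · intro h
      obtain ⟨t, ht⟩ := (hRΦ s hs w' hw' ω hω _).1 rfl
      exact ⟨t, _, h, ht⟩
  obtain ⟨C, hC⟩ := hU.coding hA (by
    rintro ⟨k, y⟩
    obtain ⟨s, n, n', rfl⟩ : ∃ s n n', k = Nat.pair s (Nat.pair n n') :=
      ⟨k.unpair.1, k.unpair.2.unpair.1, k.unpair.2.unpair.2, by simp [Nat.pair_unpair]⟩
    by_cases hk : use (s, n) ∧ use (s, n')
    swap
    · have : IsEmpty {t : ℕ × List Bool // A ((Nat.pair s (Nat.pair n n'), y), t)} :=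
        ⟨fun t => hk (by
          have h1 := t.2.1
          have h2 := t.2.2.1
          simp only [Nat.unpair_pair] at h1 h2
          exact ⟨h1, h2⟩)⟩
      simp
    obtain ⟨⟨hs, w, hw, hn⟩, -, w', hw', hn'⟩ := hk
    simp only at hs hw hn hw' hn'
    subst hn hn'
    set d := P.real {ω | ω ∈ Ω ∧ Φ s w' ω = y} with hd
    have hAval : ∀ t : {t : ℕ × List Bool //
        A ((Nat.pair s (Nat.pair (name s w) (name s w')), y), t)}, 0 < d ∧ (2⁻¹ : ℝ) ^ t.1.1 ≤
          P.real {ω | ω ∈ Ω ∧ Φ s w ω = t.1.2 ∧ Φ s w' ω = y} / (2 * d) := by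
      rintro ⟨⟨l, x⟩, ht⟩
      have h3 := ht.2.2
      rw [hFval s hs w hw w' hw', hHval s hs w hw w' hw', ← hd] at h3
      push_cast at h3
      have h4 : (0 : ℝ) < 2 ^ l := by positivity
      have h5 : P.real {ω | ω ∈ Ω ∧ Φ s w ω = x ∧ Φ s w' ω = y} ≤ d :=
        measureReal_mono fun _ h => ⟨h.1, h.2.2⟩
      -- For `d = 0` the joint probability vanishes too, and the request condition would read `2 <
      -- 2`.
      have h6 : 0 < d := by
        rcases (measureReal_nonneg (μ := P) (s := {ω | ω ∈ Ω ∧ Φ s w' ω = y})).eq_or_lt with h | h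
        · exfalso
          rw [← hd] at h
          rw [← h] at h3 h5
          have := mul_le_mul_of_nonneg_left h5 h4.le
          linarith
        · exact h
      refine ⟨h6, ?_⟩
      rw [inv_pow, inv_le_iff_one_le_mul₀ h4, div_mul_eq_mul_div, le_div_iff₀ (by positivity)]
      linarith
    by_cases hd0 : 0 < d
    swap
    · have : IsEmpty {t : ℕ × List Bool //
        A ((Nat.pair s (Nat.pair (name s w) (name s w')), y), t)} := ⟨fun t => hd0 (hAval t).1⟩
      simp
    let f : List Bool → ℝ := fun x => P.real {ω | ω ∈ Ω ∧ Φ s w ω = x ∧ Φ s w' ω = y}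
    calc _ ≤ ∑' t : (Σ x : List Bool, {l : ℕ // (2⁻¹ : ℝ) ^ l ≤ f x / (2 * d)}),
          (2⁻¹ : ENNReal) ^ t.2.1 :=
          ENNReal.tsum_comp_le_tsum_of_injective
            (f := fun t : {t : ℕ × List Bool //
              A ((Nat.pair s (Nat.pair (name s w) (name s w')), y), t)} =>
              (⟨t.1.2, t.1.1, (hAval t).2⟩ :
                Σ x : List Bool, {l : ℕ // (2⁻¹ : ℝ) ^ l ≤ f x / (2 * d)}))
            (fun t t' h => Subtype.ext (Prod.ext
              (congrArg (fun z : (Σ x : List Bool, {l : ℕ // (2⁻¹ : ℝ) ^ l ≤ f x / (2 * d)}) =>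
                z.2.1) h) (congrArg Sigma.fst h))) fun t => (2⁻¹ : ENNReal) ^ t.2.1
      _ ≤ ∑' x, 2 * ENNReal.ofReal (f x / (2 * d)) := by
          rw [ENNReal.tsum_sigma' (fun t : (Σ x : List Bool,
            {l : ℕ // (2⁻¹ : ℝ) ^ l ≤ f x / (2 * d)}) => (2⁻¹ : ENNReal) ^ t.2.1)]
          exact ENNReal.tsum_le_tsum fun x => tsum_pow_le_two_mul _
      _ = ∑' x, P {ω | ω ∈ Ω ∧ Φ s w ω = x ∧ Φ s w' ω = y} * (ENNReal.ofReal d)⁻¹ := by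
          refine tsum_congr fun x => ?_
          rw [← ENNReal.ofReal_ofNat, ← ENNReal.ofReal_mul (by norm_num),
            ← ofReal_measureReal, ← ENNReal.ofReal_inv_of_pos hd0,
            ← ENNReal.ofReal_mul measureReal_nonneg]
          congr 1
          simp only [f]
          field_simp
      _ ≤ P {ω | ω ∈ Ω ∧ Φ s w' ω = y} * (ENNReal.ofReal d)⁻¹ := by
          rw [ENNReal.tsum_mul_right]
          gcongr
          exact tsum_measure_fiber_le (hE.nullMeasurableSet_fiber hs hw)
            (hE.nullMeasurableSet_fiber hs hw') y
      _ = 1 := by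
          rw [hd, ofReal_measureReal]
          refine ENNReal.mul_inv_cancel ?_ (measure_ne_top _ _)
          intro h
          rw [hd, measureReal_def, h] at hd0
          simp at hd0)
  refine ⟨C + 2, fun s hs w hw w' hw' ω hω => ?_⟩
  have hp := hE.pos s hs w w' ω hω
  obtain ⟨l, hl, hl'⟩ := exists_nat_two_lt hp (condProb_le_one ω)
  have hd : 0 < P.real {ω' | ω' ∈ Ω ∧ Φ s w' ω' = Φ s w' ω} := by
    rcases (measureReal_nonneg (μ := P)
      (s := {ω' | ω' ∈ Ω ∧ Φ s w' ω' = Φ s w' ω})).eq_or_lt with h | h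
    · rw [condProb, ← h, div_zero] at hp
      exact absurd hp (lt_irrefl _)
    · exact h
  have h1 := hC (Nat.pair s (Nat.pair (name s w) (name s w'))) (Φ s w' ω) l (Φ s w ω) (by
    refine ⟨?_, ?_, ?_⟩
    · simpa only [Nat.unpair_pair] using ⟨hs, w, hw, rfl⟩
    · simpa only [Nat.unpair_pair] using ⟨hs, w', hw', rfl⟩
    · rw [hFval s hs w hw w' hw', hHval s hs w hw w' hw']
      unfold condProb at hl
      rw [mul_div_assoc', lt_div_iff₀ hd] at hl
      push_cast
      linarith)
  have h2 : (condK U (Φ s w ω) (Φ s w' ω) : ℝ) ≤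
      l + tripleK U s (name s w) (name s w') + C := by
    unfold tripleK
    exact_mod_cast h1
  push_cast
  linarith

/-- The names at scale `s` have complexity `O(log s)`. -/
theorem exists_tripleK_le (hE : IsRandomScaleEmbedding Ω P rep name Φ)
    (hU : IsOptimalPrefixMachine U) :
    ∃ α β : ℝ, ∀ s : ℕ, 1 ≤ s → ∀ w ∈ repSet rep s, ∀ w' ∈ repSet rep s,
      (tripleK U s (name s w) (name s w') : ℝ) ≤ α * Real.logb 2 s + β := by
  obtain ⟨c, a, hpoly⟩ := hE.poly
  obtain ⟨α, β, hαβ⟩ := exists_logb_scaleWeight_le c a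
  let use : ℕ × ℕ → Prop := fun t => 1 ≤ t.1 ∧ ∃ w ∈ repSet rep t.1, name t.1 w = t.2
  have huse : REPred use := hE.computable.names_enumerable
  -- Each triple is requested with lengths of about the logarithm of its weight. Key and condition
  -- play no role; the key `0` is used in the end, at constant cost.
  let A : (ℕ × List Bool) × ℕ × List Bool → Prop := fun t =>
    ∃ m : ℕ × ℕ × ℕ, use (m.1, m.2.1) ∧ use (m.1, m.2.2) ∧
      t.2.2 = Nat.bits (Nat.pair m.1 (Nat.pair m.2.1 m.2.2)) ∧ 2 * scaleWeight c a m.1 ≤ 2 ^ t.2.1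
  have hA : REPred A := by
    refine .exists_of_primcodable (.and ?_ (.and ?_ (.and (.eq_bits (by fun_prop) (by fun_prop))
      (.le ?_ (by fun_prop)))))
    · have := huse.comp (f := fun s : ((ℕ × List Bool) × ℕ × List Bool) × ℕ × ℕ × ℕ =>
        (s.2.1, s.2.2.1)) (by fun_prop)
      exact this
    · have := huse.comp (f := fun s : ((ℕ × List Bool) × ℕ × List Bool) × ℕ × ℕ × ℕ =>
        (s.2.1, s.2.2.2)) (by fun_prop)
      exact this
    · unfold scaleWeight
      fun_prop
  obtain ⟨C, hC⟩ := hU.coding hA (by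
    intro k
    have hex : ∀ t : {t : ℕ × List Bool // A (k, t)}, ∃ s : {s : ℕ // 1 ≤ s},
        ∃ p : repSet rep s × repSet rep s,
          t.1.2 = Nat.bits (Nat.pair s (Nat.pair (name s p.1) (name s p.2))) ∧
          (2⁻¹ : ℝ) ^ t.1.1 ≤ 1 / scaleWeight c a s / 2 := by
      rintro ⟨⟨l, x⟩, ⟨s, n, n'⟩, ⟨hs, w, hw, hn⟩, ⟨-, w', hw', hn'⟩, hx, hl⟩
      simp only at hs hw hn hw' hn' hx
      subst hn hn'
      refine ⟨⟨s, hs⟩, (⟨w, hw⟩, ⟨w', hw'⟩), hx, ?_⟩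
      have h1 : (0 : ℝ) < scaleWeight c a s := by exact_mod_cast scaleWeight_pos c a hs
      simp only at hl ⊢
      rw [inv_pow, div_div, one_div]
      refine inv_anti₀ (by positivity) ?_
      rw [mul_comm]
      exact_mod_cast hl
    choose s p hx hl using hex
    let J := Σ s : {s : ℕ // 1 ≤ s}, Σ _ : repSet rep s × repSet rep s,
      {l : ℕ // (2⁻¹ : ℝ) ^ l ≤ 1 / scaleWeight c a s / 2}
    calc _ ≤ ∑' j : J, (2⁻¹ : ENNReal) ^ j.2.2.1 :=
          ENNReal.tsum_comp_le_tsum_of_injective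
            (f := fun t : {t : ℕ × List Bool // A (k, t)} =>
              (⟨s t, p t, t.1.1, hl t⟩ : J))
            (fun t t' h => Subtype.ext (Prod.ext
              (congrArg (fun j : J => j.2.2.1) h)
              ((hx t).trans ((congrArg (fun j : J => Nat.bits (Nat.pair j.1
                (Nat.pair (name j.1 j.2.1.1) (name j.1 j.2.1.2)))) h).trans (hx t').symm))))
            fun j : J => (2⁻¹ : ENNReal) ^ j.2.2.1
      _ = ∑' s : {s : ℕ // 1 ≤ s}, ∑' _ : repSet rep s × repSet rep s,
            ∑' l : {l : ℕ // (2⁻¹ : ℝ) ^ l ≤ 1 / scaleWeight c a s / 2}, (2⁻¹ : ENNReal) ^ l.1 := by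
          rw [ENNReal.tsum_sigma' (fun j : J => (2⁻¹ : ENNReal) ^ j.2.2.1)]
          refine tsum_congr fun s => ?_
          rw [ENNReal.tsum_sigma' (fun j : Σ _ : repSet rep s × repSet rep s,
            {l : ℕ // (2⁻¹ : ℝ) ^ l ≤ 1 / scaleWeight c a s / 2} => (2⁻¹ : ENNReal) ^ j.2.1)]
      _ ≤ ∑' s : {s : ℕ // 1 ≤ s}, ∑' _ : repSet rep s × repSet rep s,
            ENNReal.ofReal (1 / scaleWeight c a s) := by
          refine ENNReal.tsum_le_tsum fun s => ENNReal.tsum_le_tsum fun _ =>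
            (tsum_pow_le_two_mul _).trans_eq ?_
          rw [← ENNReal.ofReal_ofNat, ← ENNReal.ofReal_mul (by norm_num)]
          congr 1
          ring
      _ ≤ 1 := tsum_scaleWeight_le hpoly)
  refine ⟨α, β + 2 + plainK U (Nat.bits 0) + C, fun s hs w hw w' hw' => ?_⟩
  have hB : (1 : ℝ) ≤ scaleWeight c a s := by exact_mod_cast scaleWeight_pos c a hs
  obtain ⟨l, hl, hl'⟩ := exists_nat_two_lt (p := 1 / scaleWeight c a s) (by positivity)
    (div_le_one_of_le₀ hB (by positivity))
  have h1 : tripleK U s (name s w) (name s w') ≤ l + plainK U (Nat.bits 0) + C :=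
    hC 0 [] l _ ⟨(s, name s w, name s w'), ⟨hs, w, hw, rfl⟩, ⟨hs, w', hw', rfl⟩, rfl, by
      rw [mul_one_div, lt_div_iff₀ (by linarith)] at hl
      exact_mod_cast hl.le⟩
  have h2 : (tripleK U s (name s w) (name s w') : ℝ) ≤ l + plainK U (Nat.bits 0) + C := by
    exact_mod_cast h1
  rw [one_div, Real.logb_inv, neg_neg] at hl'
  linarith [hαβ s hs]

theorem neg_logb_le_of_le {p δ : ℝ} {C : ℕ} (hp : 0 < p) (hδ : 0 < δ) (h : δ ≤ p * 2 ^ C) :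
    -Real.logb 2 p ≤ C + -Real.logb 2 δ := by
  have h1 := Real.logb_le_logb_of_le (b := 2) (by norm_num) hδ h
  rw [Real.logb_mul hp.ne' (by positivity), Real.logb_pow, Real.logb_self_eq_one (by norm_num),
    mul_one] at h1
  linarith

theorem exists_mem_not_mem_of_measure_lt_one (hE : IsRandomScaleEmbedding Ω P rep name Φ)
    {B : Set (ℕ → Bool)} (hB : P B < 1) : ∃ ω ∈ Ω, ω ∉ B := by
  have := hE.prob.isProb
  by_contra! h
  have h1 : P Set.univ ≤ P B + P Ωᶜ :=
    (measure_mono fun ω _ => or_iff_not_imp_right.2 fun hω => h ω (by simpa using hω)).trans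
      (measure_union_le B Ωᶜ)
  rw [measure_univ, hE.full, add_zero] at h1
  exact absurd hB (not_lt.2 h1)

/-- The union bound: some outcome obeys countably many lower complexity bounds
simultaneously. -/
theorem exists_neg_logb_le (hE : IsRandomScaleEmbedding Ω P rep name Φ)
    {C : List Bool → List Bool → ℕ}
    (hC : ∀ s : ℕ, 1 ≤ s → ∀ w ∈ repSet rep s, ∀ y,
      ∑' x : {x // ∃ ω ∈ Ω, Φ s w ω = x}, (2⁻¹ : ENNReal) ^ C x.1 y ≤ 1)
    {ι : Type*} [Countable ι] (s : ι → ℕ) (hs : ∀ i, 1 ≤ s i) (w w' : ι → V)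
    (hw : ∀ i, w i ∈ repSet rep (s i)) (hw' : ∀ i, w' i ∈ repSet rep (s i)) (δ : ι → ℝ)
    (hδ : ∀ i, 0 < δ i) (hsum : ∑' i, ENNReal.ofReal (δ i) < 1) :
    ∃ ω ∈ Ω, ∀ i, -Real.logb 2 (condProb Ω P (Φ (s i) (w i)) (Φ (s i) (w' i)) ω) ≤
      C (Φ (s i) (w i) ω) (Φ (s i) (w' i) ω) + -Real.logb 2 (δ i) := by
  have := hE.prob.isProb
  obtain ⟨ω, hω, h⟩ := hE.exists_mem_not_mem_of_measure_lt_one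
    (B := ⋃ i, {ω | ω ∈ Ω ∧ condProb Ω P (Φ (s i) (w i)) (Φ (s i) (w' i)) ω *
      2 ^ C (Φ (s i) (w i) ω) (Φ (s i) (w' i) ω) < δ i})
    (((measure_iUnion_le _).trans (ENNReal.tsum_le_tsum fun i => measure_condProb_lt_le
      (hE.nullMeasurableSet_fiber (hs i) (hw' i)) (hC _ (hs i) _ (hw i)) (hδ i))).trans_lt hsum)
  refine ⟨ω, hω, fun i => neg_logb_le_of_le (hE.pos _ (hs i) _ _ ω hω) (hδ i) ?_⟩
  by_contra hlt
  exact h (Set.mem_iUnion.2 ⟨i, hω, not_le.1 hlt⟩)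

/-- A Martin-Löf test whose non-members obey lower complexity bounds with a logarithmic error
at all scales. -/
theorem exists_test (hE : IsRandomScaleEmbedding Ω P rep name Φ)
    {C : List Bool → List Bool → ℕ}
    (hCre : REPred fun t : List Bool × List Bool × ℕ => C t.1 t.2.1 ≤ t.2.2)
    (hC : ∀ s : ℕ, 1 ≤ s → ∀ w ∈ repSet rep s, ∀ y,
      ∑' x : {x // ∃ ω ∈ Ω, Φ s w ω = x}, (2⁻¹ : ENNReal) ^ C x.1 y ≤ 1) :
    ∃ W : ℕ × List Bool → Prop, REPred W ∧ (∀ k, P (testSet W k) ≤ (2⁻¹ : ENNReal) ^ k) ∧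
      ∀ ω ∈ Ω, ∀ k, ω ∉ testSet W k → ∃ α β : ℝ, ∀ s : ℕ, 1 ≤ s →
        ∀ w ∈ repSet rep s, ∀ w' ∈ repSet rep s,
          -Real.logb 2 (condProb Ω P (Φ s w) (Φ s w') ω) ≤
            C (Φ s w ω) (Φ s w' ω) + (α * Real.logb 2 s + β) := by
  have := hE.prob.isProb
  obtain ⟨c, a, hpoly⟩ := hE.poly
  obtain ⟨α, β, hαβ⟩ := exists_logb_scaleWeight_le c a
  obtain ⟨R, hR, hRΦ⟩ := hE.computable.computable
  let use : ℕ × ℕ → Prop := fun t => 1 ≤ t.1 ∧ ∃ w ∈ repSet rep t.1, name t.1 w = t.2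
  have huse : REPred use := hE.computable.names_enumerable
  -- parameters: test level, scale, two names, complexity bound, two strings
  let G : (ℕ × ℕ × ℕ × ℕ × ℕ × List Bool × List Bool) × List Bool → Prop := fun z =>
    R (z.1.2.1, z.1.2.2.2.1, z.2, z.1.2.2.2.2.2.2)
  have hG : REPred G := hR.comp (by fun_prop)
  -- The complement on `Ω` of the joint event. A small conditional probability means a small
  -- numerator, so here it is the joint probability that has to be bounded from above.
  let H : (ℕ × ℕ × ℕ × ℕ × ℕ × List Bool × List Bool) × List Bool → Prop := fun z =>
    ∃ x', (x' ≠ z.1.2.2.2.2.2.1 ∧ R (z.1.2.1, z.1.2.2.1, z.2, x')) ∨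
      (x' ≠ z.1.2.2.2.2.2.2 ∧ R (z.1.2.1, z.1.2.2.2.1, z.2, x'))
  have hH : REPred H := by
    refine .exists_of_primcodable (.or (.and (.ne (by fun_prop) (by fun_prop)) ?_)
      (.and (.ne (by fun_prop) (by fun_prop)) ?_))
    · have := hR.comp (f := fun z : ((ℕ × ℕ × ℕ × ℕ × ℕ × List Bool × List Bool) × List Bool) × List Bool =>
        (z.1.1.2.1, z.1.1.2.2.1, z.1.2, z.2)) (by fun_prop)
      exact this
    · have := hR.comp (f := fun z : ((ℕ × ℕ × ℕ × ℕ × ℕ × List Bool × List Bool) × List Bool) × List Bool =>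
        (z.1.1.2.1, z.1.1.2.2.2.1, z.1.2, z.2)) (by fun_prop)
      exact this
  let Q : ℕ × ℕ × ℕ × ℕ × ℕ × List Bool × List Bool → Prop := fun z => use (z.2.1, z.2.2.1) ∧ use (z.2.1, z.2.2.2.1) ∧
    C z.2.2.2.2.2.1 z.2.2.2.2.2.2 ≤ z.2.2.2.2.1 ∧
    ((scaleWeight c a z.2.1 * 2 ^ (z.1 + z.2.2.2.2.1) : ℕ) : ℝ) <
      (1 : ℕ) * P.real (openSet fun σ => G (z, σ)) +
        (scaleWeight c a z.2.1 * 2 ^ (z.1 + z.2.2.2.2.1) : ℕ) * P.real (openSet fun σ => H (z, σ))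
  have hQ : REPred Q := by
    refine .and (huse.comp (by fun_prop)) (.and (huse.comp (by fun_prop)) (.and ?_
      (hE.prob.re_lt hG hH ?_ (by fun_prop) ?_)))
    · have := hCre.comp (f := fun z : ℕ × ℕ × ℕ × ℕ × ℕ × List Bool × List Bool => (z.2.2.2.2.2.1, z.2.2.2.2.2.2, z.2.2.2.2.1))
        (by fun_prop)
      exact this
    all_goals
      unfold scaleWeight
      fun_prop
  have hXY : REPred fun z : (ℕ × ℕ × ℕ × ℕ × ℕ × List Bool × List Bool) × List Bool => commonExt
      (fun σ => R (z.1.2.1, z.1.2.2.1, σ, z.1.2.2.2.2.2.1))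
      (fun σ => R (z.1.2.1, z.1.2.2.2.1, σ, z.1.2.2.2.2.2.2)) z.2 := REPred.commonExt
    (G := fun z : (ℕ × ℕ × ℕ × ℕ × ℕ × List Bool × List Bool) × List Bool => R (z.1.2.1, z.1.2.2.1, z.2, z.1.2.2.2.2.2.1))
    (G' := fun z : (ℕ × ℕ × ℕ × ℕ × ℕ × List Bool × List Bool) × List Bool => R (z.1.2.1, z.1.2.2.2.1, z.2, z.1.2.2.2.2.2.2))
    (hR.comp (by fun_prop)) (hR.comp (by fun_prop))
  -- A string enters level `k` when it fixes both values and some `l ≥ C x y` already witnesses that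
  -- the conditional probability is too small. Using an upper bound `l` only strengthens the
  -- requirement.
  let W : ℕ × List Bool → Prop := fun r => ∃ z : ℕ × ℕ × ℕ × ℕ × List Bool × List Bool,
    Q (r.1, z) ∧ commonExt (fun σ => R (z.1, z.2.1, σ, z.2.2.2.2.1))
      (fun σ => R (z.1, z.2.2.1, σ, z.2.2.2.2.2)) r.2
  have hW : REPred W := by
    refine .exists_of_primcodable (.and (hQ.comp (by fun_prop)) ?_)
    have := hXY.comp (f := fun r : (ℕ × List Bool) × ℕ × ℕ × ℕ × ℕ × List Bool × List Bool =>
      ((r.1.1, r.2), r.1.2)) (by fun_prop)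
    exact this
  -- evaluation of the enumerable inequality at an outcome
  have hval : ∀ s, 1 ≤ s → ∀ w ∈ repSet rep s, ∀ w' ∈ repSet rep s, ∀ k l, ∀ ω ∈ Ω,
      ((scaleWeight c a s * 2 ^ (k + l) : ℕ) : ℝ) < (1 : ℕ) * P.real (openSet fun σ =>
          G ((k, s, name s w, name s w', l, Φ s w ω, Φ s w' ω), σ)) +
        (scaleWeight c a s * 2 ^ (k + l) : ℕ) * P.real (openSet fun σ =>
          H ((k, s, name s w, name s w', l, Φ s w ω, Φ s w' ω), σ)) ↔
      condProb Ω P (Φ s w) (Φ s w') ω * 2 ^ l < (2⁻¹) ^ k * (1 / scaleWeight c a s) := by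
    intro s hs w hw w' hw' k l ω hω
    have e1 : P.real (openSet fun σ => G ((k, s, name s w, name s w', l, Φ s w ω, Φ s w' ω), σ)) =
        P.real {ω' | ω' ∈ Ω ∧ Φ s w' ω' = Φ s w' ω} := by
      refine measureReal_congr_of_full hE.full fun ω' hω' => ?_
      exact (hRΦ s hs w' hw' ω' hω' _).symm.trans (and_iff_right hω').symm
    have hnull : NullMeasurableSet {ω' | ω' ∈ Ω ∧ Φ s w ω' = Φ s w ω ∧ Φ s w' ω' = Φ s w' ω} P := by
      refine ((hE.nullMeasurableSet_fiber hs hw (Φ s w ω)).inter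
        (hE.nullMeasurableSet_fiber hs hw' (Φ s w' ω))).congr (Filter.Eventually.of_forall ?_)
      intro ω'
      exact propext ⟨fun h => ⟨h.1.1, h.1.2, h.2.2⟩, fun h => ⟨⟨h.1, h.2.1⟩, h.1, h.2.2⟩⟩
    have e2 : P.real (openSet fun σ => H ((k, s, name s w, name s w', l, Φ s w ω, Φ s w' ω), σ)) =
        1 - P.real {ω' | ω' ∈ Ω ∧ Φ s w ω' = Φ s w ω ∧ Φ s w' ω' = Φ s w' ω} := by
      rw [← probReal_compl_eq_one_sub₀ hnull]
      refine measureReal_congr_of_full hE.full fun ω' hω' => ?_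
      simp only [Set.mem_compl_iff, Set.mem_ofPred_eq, hω', true_and, not_and_or]
      constructor
      · rintro ⟨t, x', ⟨hne, hx⟩ | ⟨hne, hx⟩⟩
        · left
          rw [(hRΦ s hs w hw ω' hω' x').2 ⟨t, hx⟩]
          exact hne
        · right
          rw [(hRΦ s hs w' hw' ω' hω' x').2 ⟨t, hx⟩]
          exact hne
      · rintro (h | h)
        · obtain ⟨t, ht⟩ := (hRΦ s hs w hw ω' hω' _).1 rfl
          exact ⟨t, _, Or.inl ⟨h, ht⟩⟩
        · obtain ⟨t, ht⟩ := (hRΦ s hs w' hw' ω' hω' _).1 rfl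
          exact ⟨t, _, Or.inr ⟨h, ht⟩⟩
    have hp := hE.pos s hs w w' ω hω
    have hd : 0 < P.real {ω' | ω' ∈ Ω ∧ Φ s w' ω' = Φ s w' ω} := by
      rcases (measureReal_nonneg (μ := P)
        (s := {ω' | ω' ∈ Ω ∧ Φ s w' ω' = Φ s w' ω})).eq_or_lt with h | h
      · rw [condProb, ← h, div_zero] at hp
        exact absurd hp (lt_irrefl _)
      · exact h
    have hB : (0 : ℝ) < scaleWeight c a s := by exact_mod_cast scaleWeight_pos c a hs
    have hk : (0 : ℝ) < 2 ^ k := by positivity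
    rw [e1, e2, condProb, inv_pow, mul_one_div, div_mul_eq_mul_div, lt_div_iff₀ hB,
      div_mul_eq_mul_div, div_lt_iff₀ hd, inv_mul_eq_div, lt_div_iff₀ hk]
    push_cast
    rw [pow_add]
    constructor <;> intro h <;> linarith
  refine ⟨W, hW, fun k => ?_, fun ω hω k hk => ?_⟩
  · let B : (s : {s : ℕ // 1 ≤ s}) → repSet rep s × repSet rep s → Set (ℕ → Bool) := fun s p =>
      {ω | ω ∈ Ω ∧ condProb Ω P (Φ s p.1) (Φ s p.2) ω * 2 ^ C (Φ s p.1 ω) (Φ s p.2 ω) <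
        (2⁻¹) ^ k * (1 / scaleWeight c a s)}
    have hsub : P (testSet W k) ≤ P (⋃ s, ⋃ p, B s p) := by
      have h0 : P (testSet W k) = P (testSet W k ∩ Ω) :=
        measure_congr_of_full hE.full fun ω hω => (and_iff_left hω).symm
      rw [h0]
      refine measure_mono ?_
      rintro ω ⟨hωW, hω⟩
      rw [testSet_eq_openSet] at hωW
      obtain ⟨t, ⟨s, n, n', l, x, y⟩, ⟨⟨hs, w, hw, hn⟩, ⟨-, w', hw', hn'⟩, hl, hlt⟩, hc⟩ := hωW
      simp only at hs hw hn hw' hn' hl hlt hc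
      subst hn hn'
      have hmem : ω ∈ openSet (commonExt (fun σ => R (s, name s w, σ, x))
        (fun σ => R (s, name s w', σ, y))) := ⟨t, hc⟩
      rw [openSet_commonExt] at hmem
      have hx := (hRΦ s hs w hw ω hω x).2 hmem.1
      have hy := (hRΦ s hs w' hw' ω hω y).2 hmem.2
      subst hx hy
      have h1 := (hval s hs w hw w' hw' k l ω hω).1 hlt
      refine Set.mem_iUnion.2 ⟨⟨s, hs⟩, Set.mem_iUnion.2 ⟨(⟨w, hw⟩, ⟨w', hw'⟩), hω, ?_⟩⟩
      refine lt_of_le_of_lt ?_ h1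
      have := hE.pos s hs w w' ω hω
      gcongr
      norm_num
    have : ∀ s : {s : ℕ // 1 ≤ s}, Countable (repSet rep s × repSet rep s) := fun s => by
      have := (hE.finite_repSet s.2).to_subtype
      infer_instance
    calc P (testSet W k) ≤ ∑' s, ∑' p, P (B s p) := hsub.trans ((measure_iUnion_le _).trans
          (ENNReal.tsum_le_tsum fun s => measure_iUnion_le _))
      _ ≤ ∑' s : {s : ℕ // 1 ≤ s}, ∑' _ : repSet rep s × repSet rep s,
            (2⁻¹ : ENNReal) ^ k * ENNReal.ofReal (1 / scaleWeight c a s) := by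
          refine ENNReal.tsum_le_tsum fun s => ENNReal.tsum_le_tsum fun p => ?_
          have hB : (0 : ℝ) < scaleWeight c a s := by exact_mod_cast scaleWeight_pos c a s.2
          refine (measure_condProb_lt_le (hE.nullMeasurableSet_fiber s.2 p.2.2)
            (hC _ s.2 _ p.1.2) (by positivity)).trans_eq ?_
          rw [ENNReal.ofReal_mul (by positivity), ENNReal.ofReal_pow (by norm_num),
            ENNReal.ofReal_inv_of_pos (by norm_num), ENNReal.ofReal_ofNat]
      _ ≤ (2⁻¹ : ENNReal) ^ k := by
          simp_rw [ENNReal.tsum_mul_left]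
          exact (mul_le_mul_right (tsum_scaleWeight_le hpoly) _).trans_eq (mul_one _)
  · refine ⟨α, β + k, fun s hs w hw w' hw' => ?_⟩
    have hB : (0 : ℝ) < scaleWeight c a s := by exact_mod_cast scaleWeight_pos c a hs
    have h1 : (2⁻¹ : ℝ) ^ k * (1 / scaleWeight c a s) ≤
        condProb Ω P (Φ s w) (Φ s w') ω * 2 ^ C (Φ s w ω) (Φ s w' ω) := by
      by_contra hlt
      rw [not_le, ← hval s hs w hw w' hw' k _ ω hω] at hlt
      refine hk ?_
      rw [testSet_eq_openSet]
      have hmem : ω ∈ openSet (commonExt (fun σ => R (s, name s w, σ, Φ s w ω))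
          (fun σ => R (s, name s w', σ, Φ s w' ω))) := by
        rw [openSet_commonExt]
        exact ⟨(hRΦ s hs w hw ω hω _).1 rfl, (hRΦ s hs w' hw' ω hω _).1 rfl⟩
      obtain ⟨t, ht⟩ := hmem
      exact ⟨t, (s, name s w, name s w', C (Φ s w ω) (Φ s w' ω), Φ s w ω, Φ s w' ω),
        ⟨⟨hs, w, hw, rfl⟩, ⟨hs, w', hw', rfl⟩, le_rfl, hlt⟩, ht⟩
    have h2 := neg_logb_le_of_le (hE.pos s hs w w' ω hω) (by positivity) h1
    rw [Real.logb_mul (by positivity) (by positivity), Real.logb_pow, Real.logb_inv,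
      Real.logb_self_eq_one (by norm_num), one_div, Real.logb_inv] at h2
    linarith [hαβ s hs]

end IsRandomScaleEmbedding

/-! ### Random sequence-embeddings -/

namespace IsRandomSequenceEmbedding

variable {V : Type*} [MetricSpace V] {Ω : Set (ℕ → Bool)} {P : Measure (ℕ → Bool)}
  {rep : ℕ → V → V} {name : ℕ → V → ℕ} {Φ : ℕ → V → (ℕ → Bool) → List Bool}
  {Φinf : V → (ℕ → Bool) → ℕ → Bool} {f : ℕ → V → ℕ}
  {U : List Bool → List Bool →. List Bool} {M : List Bool → List Bool → List Bool → Prop}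

theorem length_eq (hE : IsRandomSequenceEmbedding Ω P rep name Φ Φinf f) {s : ℕ} (hs : 1 ≤ s)
    (v : V) {ω : ℕ → Bool} (hω : ω ∈ Ω) : (Φ s v ω).length = f s v := by
  rw [hE.eq_initSeg s hs v ω hω, length_initSeg]

theorem strHi_le_iff (x z : List Bool) :
    strHi z ≤ strHi x ↔ (binVal z + 1) * 2 ^ x.length ≤ (binVal x + 1) * 2 ^ z.length := by
  rw [strHi, strHi, div_le_div_iff₀ (by positivity) (by positivity)]
  norm_cast

theorem strLo_le_iff (x z : List Bool) :
    strLo x ≤ strLo z ↔ binVal x * 2 ^ z.length ≤ binVal z * 2 ^ x.length := by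
  rw [strLo, strLo, div_le_div_iff₀ (by positivity) (by positivity)]
  norm_cast

theorem strHi_le_or_strLo_le {x z : List Bool} (h : z.length = x.length) :
    strHi z ≤ strHi x ∨ strLo x ≤ strLo z := by
  rw [strHi_le_iff, strLo_le_iff, h]
  rcases le_total (binVal z) (binVal x) with hle | hle
  · left; gcongr
  · right; gcongr

/-- Conditional monotone complexity is bounded by the conditional probability, up to a
description of the names of the two infinite random sequences. -/
theorem exists_condKm_le (hE : IsRandomSequenceEmbedding Ω P rep name Φ Φinf f)
    (hU : IsOptimalPrefixMachine U) (hM : IsOptimalMonotoneMachine M) :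
    ∃ C : ℕ, ∀ s : ℕ, 1 ≤ s → ∀ w ∈ repSet rep s, ∀ w' ∈ repSet rep s, ∀ ω ∈ Ω,
      (condKm M (Φ s w ω) (Φ s w' ω) : ℝ) ≤ -Real.logb 2 (condProb Ω P (Φ s w) (Φ s w') ω) +
        pairK U (name s w) (name s w') + C := by
  have hS := hE.toRandom
  have := hS.prob.isProb
  obtain ⟨R, hR, hRΦ⟩ := hS.computable.computable
  -- `S (n, σ, x)`: some variable with the name `n` has the value `x` on extensions of `σ`
  let S : ℕ × List Bool × List Bool → Prop := fun r =>
    ∃ s, (1 ≤ s ∧ ∃ w ∈ repSet rep s, name s w = r.1) ∧ R (s, r.1, r.2.1, r.2.2)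
  have hSre : REPred S := by
    refine .exists_of_primcodable (.and ?_ ?_)
    · have := hS.computable.names_enumerable.comp
        (f := fun r : (ℕ × List Bool × List Bool) × ℕ => (r.2, r.1.1)) (by fun_prop)
      exact this
    · have := hR.comp (f := fun r : (ℕ × List Bool × List Bool) × ℕ =>
        (r.2, r.1.1, r.1.2.1, r.1.2.2)) (by fun_prop)
      exact this
  have hScomp : ∀ ω ∈ Ω, ∀ n t t' x x', S (n, initSeg ω t, x) → S (n, initSeg ω t', x') →
      StrComparable x x' := by
    rintro ω hω n t t' x x' ⟨s, ⟨hs, w, hw, hn⟩, h⟩ ⟨s', ⟨hs', w', hw', hn'⟩, h'⟩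
    simp only at hn hn' h h'
    rw [← hn] at h
    rw [← hn'] at h'
    rw [← (hRΦ s hs w hw ω hω x).2 ⟨_, h⟩, ← (hRΦ s' hs' w' hw' ω hω x').2 ⟨_, h'⟩]
    exact hE.coherent s s' hs hs' w hw w' hw' (hn.trans hn'.symm) ω hω
  have hSval : ∀ s, 1 ≤ s → ∀ w ∈ repSet rep s, ∀ ω ∈ Ω,
      ∃ t, S (name s w, initSeg ω t, Φ s w ω) := by
    intro s hs w hw ω hω
    obtain ⟨t, ht⟩ := (hRΦ s hs w hw ω hω _).1 rfl
    exact ⟨t, s, ⟨hs, w, hw, rfl⟩, ht⟩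
  -- In the order of dyadic intervals, `Lft` says that the first sequence is seen not to pass the
  -- right end of `x`, `Rgt` that it is seen not to fall short of the left end. For the second
  -- sequence, `Ext` confirms the condition `y` and `Inc` refutes it. The key contains two names and
  -- no scale.
  let Lft : ((ℕ × List Bool) × List Bool × List Bool) × List Bool → Prop := fun z =>
    ∃ x, (binVal x + 1) * 2 ^ z.1.2.2.length ≤ (binVal z.1.2.2 + 1) * 2 ^ x.length ∧
      S (z.1.1.1.unpair.1, z.2, x)
  let Rgt : ((ℕ × List Bool) × List Bool × List Bool) × List Bool → Prop := fun z =>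
    ∃ x, binVal z.1.2.2 * 2 ^ x.length ≤ binVal x * 2 ^ z.1.2.2.length ∧
      S (z.1.1.1.unpair.1, z.2, x)
  let Ext : ((ℕ × List Bool) × List Bool × List Bool) × List Bool → Prop := fun z =>
    ∃ y, z.1.1.2 <+: y ∧ S (z.1.1.1.unpair.2, z.2, y)
  let Inc : ((ℕ × List Bool) × List Bool × List Bool) × List Bool → Prop := fun z =>
    ∃ y, (z.1.1.2 ≠ y.take z.1.1.2.length ∧ y ≠ z.1.1.2.take y.length) ∧
      S (z.1.1.1.unpair.2, z.2, y)
  have hS1 : REPred fun z : (((ℕ × List Bool) × List Bool × List Bool) × List Bool) × List Bool =>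
      S (z.1.1.1.1.unpair.1, z.1.2, z.2) := hSre.comp (by fun_prop)
  have hS2 : REPred fun z : (((ℕ × List Bool) × List Bool × List Bool) × List Bool) × List Bool =>
      S (z.1.1.1.1.unpair.2, z.1.2, z.2) := hSre.comp (by fun_prop)
  have hLft : REPred Lft :=
    .exists_of_primcodable (.and (.le (by fun_prop) (by fun_prop)) hS1)
  have hRgt : REPred Rgt :=
    .exists_of_primcodable (.and (.le (by fun_prop) (by fun_prop)) hS1)
  have hExt : REPred Ext :=
    .exists_of_primcodable (.and (.prefix (by fun_prop) (by fun_prop)) hS2)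
  have hInc : REPred Inc :=
    .exists_of_primcodable (.and (.and (.ne (by fun_prop) (by fun_prop))
      (.ne (by fun_prop) (by fun_prop))) hS2)
  let FL : (ℕ × List Bool) × List Bool × List Bool → ℝ := fun z => P.real (openSet fun σ =>
    commonExt (fun σ => Lft (z, σ)) (fun σ => Ext (z, σ)) σ)
  let FR : (ℕ × List Bool) × List Bool × List Bool → ℝ := fun z => P.real (openSet fun σ =>
    commonExt (fun σ => Rgt (z, σ)) (fun σ => Ext (z, σ)) σ)
  let FI : (ℕ × List Bool) × List Bool × List Bool → ℝ := fun z => P.real (openSet fun σ =>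
    Inc (z, σ))
  -- Arithmetic coding by enumerable conditions. With `1 - FI` as an upper bound for the mass of the
  -- condition, the interval of `p` scaled by `1 - FI` lies strictly to the left of `FL` and to the
  -- right of `1 - FI - FR`.
  let D : (ℕ × List Bool) × List Bool × List Bool → Prop := fun z =>
    ((binVal z.2.1 + 1 : ℕ) : ℝ) < (2 ^ z.2.1.length : ℕ) * FL z + (binVal z.2.1 + 1 : ℕ) * FI z ∧
    ((2 ^ z.2.1.length - binVal z.2.1 : ℕ) : ℝ) < (2 ^ z.2.1.length : ℕ) * FR z +
      (2 ^ z.2.1.length - binVal z.2.1 : ℕ) * FI z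
  have hD : REPred D :=
    .and (hS.prob.re_lt (hLft.commonExt hExt) hInc (by fun_prop) (by fun_prop) (by fun_prop))
      (hS.prob.re_lt (hRgt.commonExt hExt) hInc (by fun_prop) (by fun_prop) (by fun_prop))
  have hincomp : ∀ y y' : List Bool, (y ≠ y'.take y.length ∧ y' ≠ y.take y'.length) ↔
      ¬ StrComparable y y' := by
    intro y y'
    rw [StrComparable, not_or, List.prefix_iff_eq_take, List.prefix_iff_eq_take]
  have hDiv : ∀ z, D z → strHi z.2.1 * (1 - FI z) < FL z ∧
      (1 - strLo z.2.1) * (1 - FI z) < FR z := by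
    rintro ⟨⟨k, y⟩, p, x⟩ ⟨h1, h2⟩
    simp only at h1 h2 ⊢
    have hpos : (0 : ℝ) < 2 ^ p.length := by positivity
    have hcast : ((2 ^ p.length - binVal p : ℕ) : ℝ) = 2 ^ p.length - binVal p := by
      rw [Nat.cast_sub (binVal_lt p).le]
      push_cast
      rfl
    rw [hcast] at h2
    push_cast at h1 h2
    constructor
    · rw [strHi, div_mul_eq_mul_div, div_lt_iff₀ hpos]
      linarith
    · rw [strLo, one_sub_div hpos.ne', div_mul_eq_mul_div, div_lt_iff₀ hpos]
      linarith
  have hExtInc : ∀ ω ∈ Ω, ∀ z, ω ∈ openSet (fun σ => Ext (z, σ)) →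
      ω ∉ openSet fun σ => Inc (z, σ) := by
    rintro ω hω z ⟨t, y, hy, hSy⟩ ⟨t', y', hy', hSy'⟩
    rw [hincomp] at hy'
    exact hy' ((hScomp ω hω _ _ _ _ _ hSy hSy').mono hy List.prefix_rfl)
  -- Outputs with one name are comparable on each outcome, so their intervals overlap and the
  -- sequence cannot lie both left within `x` and right within `x'`; the condition is not both
  -- confirmed and refuted. The three events are therefore disjoint on `Ω`.
  have hthree : ∀ k y p q x x', strHi x ≤ strLo x' →
      FL ((k, y), p, x) + FR ((k, y), q, x') + FI ((k, y), p, x) ≤ 1 := by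
    intro k y p q x x' hxx
    simp only [FL, FR, FI]
    rw [← measureReal_union₀ (measurableSet_openSet _).nullMeasurableSet,
      ← measureReal_union₀ (measurableSet_openSet _).nullMeasurableSet]
    · exact measureReal_le_one
    · refine measure_mono_null ?_ hS.full
      rintro ω ⟨h | h, h'⟩ hω <;> rw [openSet_commonExt] at h
      · exact hExtInc ω hω _ h.2 h'
      · exact hExtInc ω hω ((k, y), q, x') h.2 h'
    · refine measure_mono_null ?_ hS.full
      rintro ω ⟨h, h'⟩ hω
      rw [openSet_commonExt] at h h'
      obtain ⟨⟨t, z, hz, hSz⟩, -⟩ := h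
      obtain ⟨⟨t', z', hz', hSz'⟩, -⟩ := h'
      rw [← strHi_le_iff] at hz
      rw [← strLo_le_iff] at hz'
      have := (hScomp ω hω _ _ _ _ _ hSz hSz').strLo_lt_strHi
      simp only at hz hz'
      linarith
  obtain ⟨C, hC⟩ := hM.coding hU hD (by
    rintro ⟨k, y⟩ p q x x' hp hq hpq
    by_contra hne
    have hI : FI ((k, y), p, x) ≤ 1 := measureReal_le_one
    have hcomp : StrComparable p q := Or.inl hpq
    have hp' := hDiv _ hp
    have hq' := hDiv _ hq
    have hIq : FI ((k, y), q, x') = FI ((k, y), p, x) := rfl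
    simp only [hIq] at hp' hq'
    -- Overlapping programs give `FL + FR > (1 - FI) * (1 + strHi p - strLo q) ≥ 1 - FI`, against
    -- `hthree`; the second case exchanges the roles.
    rcases strHi_le_strLo_or hne with hxx | hxx
    · have h1 := hthree k y p q x x' hxx
      have h2 := hcomp.strLo_lt_strHi
      nlinarith
    · have h1 := hthree k y q p x' x hxx
      have h2 := hcomp.symm.strLo_lt_strHi
      rw [hIq] at h1
      nlinarith)
  refine ⟨C + 2, fun s hs w hw w' hw' ω hω => ?_⟩
  set x := Φ s w ω with hx
  set y := Φ s w' ω with hy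
  set k := Nat.pair (name s w) (name s w') with hk
  have hk1 : k.unpair.1 = name s w := by rw [hk, Nat.unpair_pair]
  have hk2 : k.unpair.2 = name s w' := by rw [hk, Nat.unpair_pair]
  have hlx : ∀ ω' ∈ Ω, (Φ s w ω').length = x.length := fun ω' hω' => by
    rw [hE.length_eq hs w hω', hx, hE.length_eq hs w hω]
  have hly : ∀ ω' ∈ Ω, (Φ s w' ω').length = y.length := fun ω' hω' => by
    rw [hE.length_eq hs w' hω', hy, hE.length_eq hs w' hω]
  set d := P.real {ω' | ω' ∈ Ω ∧ Φ s w' ω' = y} with hd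
  -- The length at scale `s` does not depend on the outcome, so extending `y` at any scale amounts
  -- to having the value `y` at this scale.
  have hExt_iff : ∀ p, ∀ ω' ∈ Ω, ω' ∈ openSet (fun σ => Ext (((k, y), p, x), σ)) ↔
      Φ s w' ω' = y := by
    intro p ω' hω'
    obtain ⟨t, ht⟩ := hSval s hs w' hw' ω' hω'
    constructor
    · rintro ⟨t', y', hy', hSy'⟩
      simp only [hk2] at hSy'
      exact ((hScomp ω' hω' _ _ _ _ _ ht hSy').mono List.prefix_rfl hy').eq_of_length (hly ω' hω')
    · intro h
      refine ⟨t, Φ s w' ω', ?_, ?_⟩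
      · simp only [h]; exact List.prefix_rfl
      · simpa only [hk2] using ht
  have hFI : ∀ p, FI ((k, y), p, x) = 1 - d := by
    intro p
    rw [hd, ← probReal_compl_eq_one_sub₀ (hS.nullMeasurableSet_fiber hs hw' y)]
    refine measureReal_congr_of_full hS.full fun ω' hω' => ?_
    obtain ⟨t, ht⟩ := hSval s hs w' hw' ω' hω'
    simp only [Set.mem_compl_iff, Set.mem_ofPred_eq, hω', true_and]
    constructor
    · intro h h'
      exact hExtInc ω' hω' _ ((hExt_iff p ω' hω').2 h') h
    · intro h
      refine ⟨t, Φ s w' ω', (hincomp _ _).2 fun hc => h ?_, by simpa only [hk2] using ht⟩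
      exact (hc.eq_of_length (hly ω' hω').symm).symm
  have hFd : ∀ p, FL ((k, y), p, x) ≤ d ∧ FR ((k, y), p, x) ≤ d := by
    intro p
    have hdE : d = P.real (openSet fun σ => Ext (((k, y), p, x), σ)) :=
      measureReal_congr_of_full hS.full fun ω' hω' =>
        (and_iff_right hω').trans (hExt_iff p ω' hω').symm
    rw [hdE]
    simp only [FL, FR]
    rw [openSet_commonExt, openSet_commonExt]
    exact ⟨measureReal_mono Set.inter_subset_right, measureReal_mono Set.inter_subset_right⟩
  -- Strings as long as `x` lie to its left or to its right, or equal it: given `Y = y`, the two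
  -- events cover everything, and both occur when `X = x`.
  have hsum : ∀ p, d + P.real {ω' | ω' ∈ Ω ∧ Φ s w ω' = x ∧ Φ s w' ω' = y} ≤
      FL ((k, y), p, x) + FR ((k, y), p, x) := by
    intro p
    simp only [FL, FR]
    rw [← measureReal_union_add_inter (measurableSet_openSet _)]
    have hmem : ∀ ω' ∈ Ω, (strHi (Φ s w ω') ≤ strHi x →
        ω' ∈ openSet fun σ => Lft (((k, y), p, x), σ)) ∧ (strLo x ≤ strLo (Φ s w ω') →
        ω' ∈ openSet fun σ => Rgt (((k, y), p, x), σ)) := by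
      intro ω' hω'
      obtain ⟨t, ht⟩ := hSval s hs w hw ω' hω'
      exact ⟨fun h => ⟨t, _, (strHi_le_iff _ _).1 h, by simpa only [hk1] using ht⟩,
        fun h => ⟨t, _, (strLo_le_iff _ _).1 h, by simpa only [hk1] using ht⟩⟩
    rw [openSet_commonExt, openSet_commonExt]
    refine add_le_add (measureReal_mono ?_) (measureReal_mono ?_)
    · rintro ω' ⟨hω', hy'⟩
      have hExt' := (hExt_iff p ω' hω').2 hy'
      rcases strHi_le_or_strLo_le (hlx ω' hω') with h | h
      · exact Or.inl ⟨(hmem ω' hω').1 h, hExt'⟩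
      · exact Or.inr ⟨(hmem ω' hω').2 h, hExt'⟩
    · rintro ω' ⟨hω', hx', hy'⟩
      have hExt' := (hExt_iff p ω' hω').2 hy'
      exact ⟨⟨(hmem ω' hω').1 (by rw [hx']), hExt'⟩, ⟨(hmem ω' hω').2 (by rw [hx']), hExt'⟩⟩
  have hp := hS.pos s hs w w' ω hω
  have hd0 : 0 < d := by
    rcases (measureReal_nonneg (μ := P) (s := {ω' | ω' ∈ Ω ∧ Φ s w' ω' = y})).eq_or_lt with h | h
    · rw [condProb, ← hy, ← h, div_zero] at hp
      exact absurd hp (lt_irrefl _)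
    · exact h
  obtain ⟨l, hl, hl'⟩ := exists_nat_two_lt hp (condProb_le_one ω)
  have hT : (0 : ℝ) < 2 ^ l := by positivity
  -- the measures do not depend on the program
  have hFLp : ∀ p, FL ((k, y), p, x) = FL ((k, y), [], x) := fun p => rfl
  have hFRp : ∀ p, FR ((k, y), p, x) = FR ((k, y), [], x) := fun p => rfl
  set a := FL ((k, y), [], x) with ha
  set b := FR ((k, y), [], x) with hb
  have hab := hsum []
  have had := hFd []
  rw [← ha, ← hb] at hab had
  have hmu : 2 * d < 2 ^ l * P.real {ω' | ω' ∈ Ω ∧ Φ s w ω' = x ∧ Φ s w' ω' = y} := by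
    rw [condProb, ← hx, ← hy, ← hd, mul_div_assoc', lt_div_iff₀ hd0] at hl
    exact hl
  -- The lower end of the coding interval, in units of `2 ^ (-l)`. By `hab` and `hmu` the interval
  -- is longer than two units, so the unit interval from `⌊β⌋₊ + 1` fits strictly inside.
  set β := (d - b) / d * 2 ^ l with hβ
  have hβ0 : 0 ≤ β := mul_nonneg (div_nonneg (by linarith) hd0.le) hT.le
  have hβd : β * d = (d - b) * 2 ^ l := by
    rw [hβ, mul_right_comm, div_mul_cancel₀ _ hd0.ne']
  have hj1 := Nat.floor_le hβ0
  have hj2 := Nat.lt_floor_add_one β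
  have hjlt : (⌊β⌋₊ + 1 + 1 : ℝ) * d < 2 ^ l * a := by nlinarith
  have hjT : (⌊β⌋₊ + 1 + 1 : ℝ) < 2 ^ l := by
    have : (⌊β⌋₊ + 1 + 1 : ℝ) * d < 2 ^ l * d :=
      hjlt.trans_le (mul_le_mul_of_nonneg_left had.1 hT.le)
    exact lt_of_mul_lt_mul_right this hd0.le
  have hjT' : ⌊β⌋₊ + 1 < 2 ^ l := by
    have : ⌊β⌋₊ + 1 + 1 < 2 ^ l := by exact_mod_cast hjT
    omega
  obtain ⟨p, hpl, hpv⟩ := exists_binVal l (⌊β⌋₊ + 1) hjT'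
  have h1 : condKm M x y ≤ p.length + pairK U (name s w) (name s w') + C := by
    refine hC k y p x ⟨?_, ?_⟩
    · simp only [hpl, hpv, hFLp, hFI]
      push_cast
      linarith
    · simp only [hpl, hpv, hFRp, hFI]
      rw [Nat.cast_sub hjT'.le]
      push_cast
      nlinarith
  rw [hpl] at h1
  have h2 : (condKm M x y : ℝ) ≤ l + pairK U (name s w) (name s w') + C := by exact_mod_cast h1
  push_cast
  linarith

end IsRandomSequenceEmbedding

/-! ### Derandomization -/

section Derandomization

variable {U : List Bool → List Bool →. List Bool}

theorem IsOptimalPrefixMachine.exists_tripleK_swap_le (hU : IsOptimalPrefixMachine U) :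
    ∃ C : ℕ, ∀ l m n, tripleK U l n m ≤ tripleK U l m n + C := by
  obtain ⟨C, hC⟩ := hU.exists_plainK_comp_le
    (f := fun k => Nat.pair k.unpair.1 (Nat.pair k.unpair.2.unpair.2 k.unpair.2.unpair.1))
    (by fun_prop)
  exact ⟨C, fun l m n => by simpa [tripleK] using hC (Nat.pair l (Nat.pair m n))⟩

theorem IsOptimalPrefixMachine.exists_pairK_swap_le (hU : IsOptimalPrefixMachine U) :
    ∃ C : ℕ, ∀ m n, pairK U n m ≤ pairK U m n + C := by
  obtain ⟨C, hC⟩ := hU.exists_plainK_comp_le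
    (f := fun k => Nat.pair k.unpair.2 k.unpair.1) (by fun_prop)
  exact ⟨C, fun m n => by simpa [pairK] using hC (Nat.pair m n)⟩

/-- For distinct strings the bounds pass to maxima. For equal strings the distance is `0` by
definition, and the lower bound forces `max q q' ≤ C₀ + L`. -/
theorem abs_complexityDist_sub_le {C : List Bool → List Bool → ℕ} {c q q' L : ℝ} {C₀ : ℕ}
    {x y : List Bool} (hself : C x x ≤ C₀) (hq : 0 ≤ q) (hlow : q ≤ C x y + L)
    (hlow' : q' ≤ C y x + L) (hup : C x y ≤ q + L) (hup' : C y x ≤ q' + L) :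
    |complexityDist C c x y - max q q'| ≤ L + |c| + C₀ := by
  have hC₀ : (0 : ℝ) ≤ C₀ := by positivity
  have hc := neg_abs_le c
  have hc' := le_abs_self c
  have h1 : max q q' ≤ max (C x y : ℝ) (C y x) + L := by
    rw [← max_add_add_right]
    exact max_le_max hlow hlow'
  have h2 : max (C x y : ℝ) (C y x) ≤ max q q' + L := by
    rw [← max_add_add_right]
    exact max_le_max hup hup'
  unfold complexityDist
  split_ifs with h
  · subst h
    have h3 : (C x x : ℝ) ≤ C₀ := by exact_mod_cast hself
    have h4 : 0 ≤ max q q' := le_max_of_le_left hq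
    rw [max_self] at h1
    rw [zero_sub, abs_neg, abs_of_nonneg h4]
    have := abs_nonneg c
    linarith
  · rw [abs_le]
    constructor <;> linarith

end Derandomization

namespace IsRandomScaleEmbedding

variable {V : Type*} [MetricSpace V] {Ω : Set (ℕ → Bool)} {P : Measure (ℕ → Bool)}
  {rep : ℕ → V → V} {name : ℕ → V → ℕ} {Φ : ℕ → V → (ℕ → Bool) → List Bool}
  {C : List Bool → List Bool → ℕ}

theorem condProb_rep (hE : IsRandomScaleEmbedding Ω P rep name Φ) {s : ℕ} (hs : 1 ≤ s) (v v' : V)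
    {ω : ℕ → Bool} (hω : ω ∈ Ω) :
    condProb Ω P (Φ s (rep s v)) (Φ s (rep s v')) ω = condProb Ω P (Φ s v) (Φ s v') ω := by
  unfold condProb
  congr 2 <;> ext ω' <;> simp only [Set.mem_ofPred_eq] <;> refine and_congr_right fun hω' => ?_
  · rw [hE.rep_eq s hs v ω hω, hE.rep_eq s hs v ω' hω', hE.rep_eq s hs v' ω hω,
      hE.rep_eq s hs v' ω' hω']
  · rw [hE.rep_eq s hs v' ω hω, hE.rep_eq s hs v' ω' hω']

/-- Two-sided bounds on the complexities of the values at representatives yield a bound on the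
distance of the values at arbitrary points. -/
theorem abs_complexityDist_sub_randDist_le (hE : IsRandomScaleEmbedding Ω P rep name Φ) {c L : ℝ}
    {C₀ : ℕ} (hself : ∀ x, C x x ≤ C₀) {s : ℕ} (hs : 1 ≤ s) (v v' : V) {ω : ℕ → Bool} (hω : ω ∈ Ω)
    (hlow : -Real.logb 2 (condProb Ω P (Φ s (rep s v)) (Φ s (rep s v')) ω) ≤
      C (Φ s (rep s v) ω) (Φ s (rep s v') ω) + L)
    (hlow' : -Real.logb 2 (condProb Ω P (Φ s (rep s v')) (Φ s (rep s v)) ω) ≤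
      C (Φ s (rep s v') ω) (Φ s (rep s v) ω) + L)
    (hup : C (Φ s (rep s v) ω) (Φ s (rep s v') ω) ≤
      -Real.logb 2 (condProb Ω P (Φ s (rep s v)) (Φ s (rep s v')) ω) + L)
    (hup' : C (Φ s (rep s v') ω) (Φ s (rep s v) ω) ≤
      -Real.logb 2 (condProb Ω P (Φ s (rep s v')) (Φ s (rep s v)) ω) + L) :
    |complexityDist C c (Φ s v ω) (Φ s v' ω) - randDist Ω P (Φ s v) (Φ s v') ω| ≤
      L + |c| + C₀ := by
  have := hE.prob.isProb
  rw [hE.condProb_rep hs v v' hω, hE.rep_eq s hs v ω hω, hE.rep_eq s hs v' ω hω] at hlow hup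
  rw [hE.condProb_rep hs v' v hω, hE.rep_eq s hs v ω hω, hE.rep_eq s hs v' ω hω] at hlow' hup'
  exact abs_complexityDist_sub_le (hself _) (neg_nonneg.2 (Real.logb_nonpos (by norm_num)
    (hE.pos s hs v v' ω hω).le (condProb_le_one ω))) hlow hlow' hup hup'

theorem isStringEmbedding (hE : IsRandomScaleEmbedding Ω P rep name Φ) (c : ℝ) {C₀ : ℕ}
    (hself : ∀ x, C x x ≤ C₀) {ω : ℕ → Bool} (hω : ω ∈ Ω)
    (hlow : ∃ α β : ℝ, ∀ s : ℕ, 1 ≤ s → ∀ w ∈ repSet rep s, ∀ w' ∈ repSet rep s,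
      -Real.logb 2 (condProb Ω P (Φ s w) (Φ s w') ω) ≤
        C (Φ s w ω) (Φ s w' ω) + (α * Real.logb 2 s + β))
    (hup : ∃ α β : ℝ, ∀ s : ℕ, 1 ≤ s → ∀ w ∈ repSet rep s, ∀ w' ∈ repSet rep s,
      C (Φ s w ω) (Φ s w' ω) ≤
        -Real.logb 2 (condProb Ω P (Φ s w) (Φ s w') ω) + (α * Real.logb 2 s + β)) :
    IsStringEmbedding (complexityDist C c) fun s v => Φ s v ω := by
  obtain ⟨α, β, hlow⟩ := hlow
  obtain ⟨α', β', hup⟩ := hup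
  obtain ⟨a, b, hab⟩ := hE.scale ω hω
  refine ⟨max α α' + a, max β β' + |c| + C₀ + b, fun s hs v v' => ?_⟩
  -- Nonnegativity permits replacing both slopes by their maximum.
  have hlog : 0 ≤ Real.logb 2 s := Real.logb_nonneg (by norm_num) (by exact_mod_cast hs)
  have h1 : α * Real.logb 2 s + β ≤ max α α' * Real.logb 2 s + max β β' :=
    add_le_add (mul_le_mul_of_nonneg_right (le_max_left _ _) hlog) (le_max_left _ _)
  have h2 : α' * Real.logb 2 s + β' ≤ max α α' * Real.logb 2 s + max β β' :=
    add_le_add (mul_le_mul_of_nonneg_right (le_max_right _ _) hlog) (le_max_right _ _)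
  have h3 := hE.abs_complexityDist_sub_randDist_le (c := c)
    (L := max α α' * Real.logb 2 s + max β β') hself hs v v' hω
    ((hlow s hs _ ⟨v, rfl⟩ _ ⟨v', rfl⟩).trans (by linarith))
    ((hlow s hs _ ⟨v', rfl⟩ _ ⟨v, rfl⟩).trans (by linarith))
    ((hup s hs _ ⟨v, rfl⟩ _ ⟨v', rfl⟩).trans (by linarith))
    ((hup s hs _ ⟨v', rfl⟩ _ ⟨v, rfl⟩).trans (by linarith))
  have h4 := abs_sub_le (complexityDist C c (Φ s v ω) (Φ s v' ω))
    (randDist Ω P (Φ s v) (Φ s v') ω) (s * dist v v')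
  have h5 := hab s hs v v'
  refine h4.trans ((add_le_add h3 h5).trans (le_of_eq ?_))
  ring

variable {U : List Bool → List Bool →. List Bool}

theorem exists_condK_le_log (hE : IsRandomScaleEmbedding Ω P rep name Φ)
    (hU : IsOptimalPrefixMachine U) :
    ∃ α β : ℝ, ∀ ω ∈ Ω, ∀ s : ℕ, 1 ≤ s → ∀ w ∈ repSet rep s, ∀ w' ∈ repSet rep s,
      (condK U (Φ s w ω) (Φ s w' ω) : ℝ) ≤
        -Real.logb 2 (condProb Ω P (Φ s w) (Φ s w') ω) + (α * Real.logb 2 s + β) := by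
  obtain ⟨C, hC⟩ := hE.exists_condK_le hU
  obtain ⟨α, β, h⟩ := hE.exists_tripleK_le hU
  refine ⟨α, β + C, fun ω hω s hs w hw w' hw' => ?_⟩
  linarith [hC s hs w hw w' hw' ω hω, h s hs w hw w' hw']

/-- A Martin-Löf test whose non-members in the sample space yield string-embeddings. -/
theorem exists_test_isStringEmbedding_distK (hE : IsRandomScaleEmbedding Ω P rep name Φ)
    (hU : IsOptimalPrefixMachine U) (c : ℝ) :
    ∃ W : ℕ × List Bool → Prop, REPred W ∧ (∀ k, P (testSet W k) ≤ (2⁻¹ : ENNReal) ^ k) ∧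
      ∀ ω ∈ Ω, ∀ k, ω ∉ testSet W k → IsStringEmbedding (distK U c) fun s v => Φ s v ω := by
  obtain ⟨C₀, hself⟩ := hU.exists_condK_self_le
  obtain ⟨α, β, hup⟩ := hE.exists_condK_le_log hU
  obtain ⟨W, hW, hWP, hlow⟩ := hE.exists_test hU.condK_le_re
    (fun s _ w _ y => hU.kraft _ Subtype.val_injective y)
  exact ⟨W, hW, hWP, fun ω hω k hk =>
    hE.isStringEmbedding c hself hω (hlow ω hω k hk) ⟨α, β, hup ω hω⟩⟩

end IsRandomScaleEmbedding

namespace IsRandomSequenceEmbedding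

variable {V : Type*} [MetricSpace V] {Ω : Set (ℕ → Bool)} {P : Measure (ℕ → Bool)}
  {rep : ℕ → V → V} {name : ℕ → V → ℕ} {Φ : ℕ → V → (ℕ → Bool) → List Bool}
  {Φinf : V → (ℕ → Bool) → ℕ → Bool} {f : ℕ → V → ℕ}
  {U : List Bool → List Bool →. List Bool} {M : List Bool → List Bool → List Bool → Prop}

/-- At a fixed scale all values have the length `f s w`, as Kraft's inequality for monotone
complexity requires. -/
theorem kraft (hE : IsRandomSequenceEmbedding Ω P rep name Φ Φinf f)
    (hM : IsOptimalMonotoneMachine M) {s : ℕ} (hs : 1 ≤ s) (w : V) (y : List Bool) :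
    ∑' x : {x // ∃ ω ∈ Ω, Φ s w ω = x}, (2⁻¹ : ENNReal) ^ condKm M x.1 y ≤ 1 := by
  refine hM.kraft _ Subtype.val_injective ?_ y
  rintro ⟨_, ω, hω, rfl⟩ ⟨_, ω', hω', rfl⟩
  exact (hE.length_eq hs w hω).trans (hE.length_eq hs w hω').symm

theorem isSequenceEmbedding (hE : IsRandomSequenceEmbedding Ω P rep name Φ Φinf f)
    {D : List Bool → List Bool → ℝ} {ω : ℕ → Bool} (hω : ω ∈ Ω)
    (h : IsStringEmbedding D fun s v => Φ s v ω) :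
    IsSequenceEmbedding D (fun v => Φinf v ω) f := by
  obtain ⟨a, b, h⟩ := h
  refine ⟨hE.mono, a, b, fun s hs v v' => ?_⟩
  have := h s hs v v'
  simp only [hE.eq_initSeg s hs v ω hω, hE.eq_initSeg s hs v' ω hω] at this
  exact this

/-- A Martin-Löf test whose non-members in the sample space yield string-embeddings with respect
to the distance from monotone complexity. -/
theorem exists_test_isStringEmbedding_distKm (hE : IsRandomSequenceEmbedding Ω P rep name Φ Φinf f)
    (hU : IsOptimalPrefixMachine U) (hM : IsOptimalMonotoneMachine M) (c : ℝ) :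
    ∃ W : ℕ × List Bool → Prop, REPred W ∧ (∀ k, P (testSet W k) ≤ (2⁻¹ : ENNReal) ^ k) ∧
      ∀ ω ∈ Ω, ∀ k, ω ∉ testSet W k → IsStringEmbedding (distKm M c) fun s v => Φ s v ω := by
  obtain ⟨C₀, hself⟩ := hU.exists_condK_self_le
  obtain ⟨C₁, hKm⟩ := hM.exists_condKm_le_condK hU
  -- With logarithmic error the upper bound for `K` suffices, since `Km ≤ K + O(1)`; the scale-free
  -- bound `exists_condKm_le` serves the quantitative derandomization only.
  obtain ⟨α, β, hup⟩ := hE.toRandom.exists_condK_le_log hU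
  obtain ⟨W, hW, hWP, hlow⟩ := hE.toRandom.exists_test hM.condKm_le_re
    (fun s hs w _ y => hE.kraft hM hs w y)
  refine ⟨W, hW, hWP, fun ω hω k hk => hE.toRandom.isStringEmbedding (C₀ := C₀ + C₁) c
    (fun x => (hKm x x).trans (Nat.add_le_add_right (hself x) _)) hω (hlow ω hω k hk)
    ⟨α, β + C₁, fun s hs w hw w' hw' => ?_⟩⟩
  have h1 : (condKm M (Φ s w ω) (Φ s w' ω) : ℝ) ≤ condK U (Φ s w ω) (Φ s w' ω) + C₁ := by
    exact_mod_cast hKm _ _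
  linarith [hup ω hω s hs w hw w' hw']

end IsRandomSequenceEmbedding

/-! ### Assembly of the theorem -/

theorem mainTheorem9 {V : Type*} [MetricSpace V]
    (U : List Bool → List Bool →. List Bool) (hU : IsOptimalPrefixMachine U)
    (M : List Bool → List Bool → List Bool → Prop) (hM : IsOptimalMonotoneMachine M)
    (c : ℝ)
    (Ω : Set (ℕ → Bool)) (P : Measure (ℕ → Bool)) (rep : ℕ → V → V) (name : ℕ → V → ℕ)
    (Φ : ℕ → V → (ℕ → Bool) → List Bool) :
    -- String case
    (IsRandomScaleEmbedding Ω P rep name Φ →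
      -- quantitative derandomization at each scale
      (∃ C : ℝ, ∀ s : ℕ, 1 ≤ s → ∀ δ : V → V → ℝ,
        (∀ w ∈ repSet rep s, ∀ w' ∈ repSet rep s, 0 < δ w w') →
        (∑' p : repSet rep s × repSet rep s, ENNReal.ofReal (δ p.1 p.2) < 1) →
        ∃ ω₀ ∈ Ω, ∀ v v' : V,
          |distK U c (Φ s v ω₀) (Φ s v' ω₀) - randDist Ω P (Φ s v) (Φ s v') ω₀| ≤
            max (max (-Real.logb 2 (δ (rep s v) (rep s v')))
                  (-Real.logb 2 (δ (rep s v') (rep s v))))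
                (tripleK U s (name s (rep s v)) (name s (rep s v')) : ℝ) + C) ∧
      -- a suitable outcome gives a string-embedding
      (∃ ω₀ ∈ Ω, IsStringEmbedding (distK U c) fun s v => Φ s v ω₀) ∧
      -- every random outcome does
      (∀ ω₀ ∈ Ω, IsMartinLofRandom P ω₀ ∨ (IsUniformMeasure P ∧ IsKRandom U ω₀) →
        IsStringEmbedding (distK U c) fun s v => Φ s v ω₀)) ∧
    -- Sequence case
    (∀ (Φinf : V → (ℕ → Bool) → ℕ → Bool) (f : ℕ → V → ℕ),
      IsRandomSequenceEmbedding Ω P rep name Φ Φinf f →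
      -- quantitative derandomization, at all scales simultaneously
      (∃ C : ℝ, ∀ δ : ℕ → V → V → ℝ,
        (∀ s : ℕ, 1 ≤ s → ∀ w ∈ repSet rep s, ∀ w' ∈ repSet rep s, 0 < δ s w w') →
        (∑' s : {s : ℕ // 1 ≤ s}, ∑' p : repSet rep s × repSet rep s,
          ENNReal.ofReal (δ s p.1 p.2) < 1) →
        ∃ ω₀ ∈ Ω, ∀ s : ℕ, 1 ≤ s → ∀ v v' : V,
          |distKm M c (Φ s v ω₀) (Φ s v' ω₀) - randDist Ω P (Φ s v) (Φ s v') ω₀| ≤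
            max (max (-Real.logb 2 (δ s (rep s v) (rep s v')))
                  (-Real.logb 2 (δ s (rep s v') (rep s v))))
                (pairK U (name s (rep s v)) (name s (rep s v')) : ℝ) + C) ∧
      -- a suitable outcome gives a sequence-embedding
      (∃ ω₀ ∈ Ω, IsSequenceEmbedding (distK U c) (fun v => Φinf v ω₀) f ∧
        IsSequenceEmbedding (distKm M c) (fun v => Φinf v ω₀) f) ∧
      -- every random outcome does
      (∀ ω₀ ∈ Ω, IsMartinLofRandom P ω₀ ∨ (IsUniformMeasure P ∧ IsKRandom U ω₀) →
        IsSequenceEmbedding (distK U c) (fun v => Φinf v ω₀) f ∧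
        IsSequenceEmbedding (distKm M c) (fun v => Φinf v ω₀) f)) := by
  constructor
  · intro hE
    have := hE.prob.isProb
    obtain ⟨W, hW, hWP, hemb⟩ := hE.exists_test_isStringEmbedding_distK hU c
    refine ⟨?_, ?_, ?_⟩
    · obtain ⟨C₀, hself⟩ := hU.exists_condK_self_le
      obtain ⟨C₁, hup⟩ := hE.exists_condK_le hU
      obtain ⟨C₂, hswap⟩ := hU.exists_tripleK_swap_le
      refine ⟨C₁ + C₂ + |c| + C₀, fun s hs δ hδ hsum => ?_⟩
      have := (hE.finite_repSet hs).to_subtype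
      obtain ⟨ω, hω, hlow⟩ := hE.exists_neg_logb_le (C := condK U)
        (fun s _ w _ y => hU.kraft _ Subtype.val_injective y)
        (ι := repSet rep s × repSet rep s) (fun _ => s) (fun _ => hs) (fun p => p.1)
        (fun p => p.2) (fun p => p.1.2) (fun p => p.2.2) (fun p => δ p.1 p.2)
        (fun p => hδ _ p.1.2 _ p.2.2) hsum
      refine ⟨ω, hω, fun v v' => ?_⟩
      have hv : rep s v ∈ repSet rep s := ⟨v, rfl⟩
      have hv' : rep s v' ∈ repSet rep s := ⟨v', rfl⟩
      have h1 := hlow (⟨_, hv⟩, ⟨_, hv'⟩)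
      have h2 := hlow (⟨_, hv'⟩, ⟨_, hv⟩)
      have h3 := hup s hs _ hv _ hv' ω hω
      have h4 := hup s hs _ hv' _ hv ω hω
      have h5 : (tripleK U s (name s (rep s v')) (name s (rep s v)) : ℝ) ≤
          tripleK U s (name s (rep s v)) (name s (rep s v')) + C₂ := by exact_mod_cast hswap _ _ _
      have hC₁ : (0 : ℝ) ≤ C₁ := by positivity
      have hC₂ : (0 : ℝ) ≤ C₂ := by positivity
      set m := max (max (-Real.logb 2 (δ (rep s v) (rep s v')))
        (-Real.logb 2 (δ (rep s v') (rep s v))))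
        (tripleK U s (name s (rep s v)) (name s (rep s v')) : ℝ) with hm
      have m1 : -Real.logb 2 (δ (rep s v) (rep s v')) ≤ m :=
        (le_max_left _ _).trans (le_max_left _ _)
      have m2 : -Real.logb 2 (δ (rep s v') (rep s v)) ≤ m :=
        (le_max_right _ _).trans (le_max_left _ _)
      have m3 : (tripleK U s (name s (rep s v)) (name s (rep s v')) : ℝ) ≤ m := le_max_right _ _
      refine (hE.abs_complexityDist_sub_randDist_le (L := m + C₁ + C₂) hself hs v v' hω
        ?_ ?_ ?_ ?_).trans (by linarith) <;> linarith
    -- Level `1` has measure at most one half, so some outcome of `Ω` escapes it.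
    · obtain ⟨ω, hω, hωW⟩ := hE.exists_mem_not_mem_of_measure_lt_one (B := testSet W 1)
        ((hWP 1).trans_lt (by rw [pow_one]; exact ENNReal.one_half_lt_one))
      exact ⟨ω, hω, hemb ω hω 1 hωW⟩
    · rintro ω hω hrand
      have hML : IsMartinLofRandom P ω := hrand.elim id fun h => h.2.isMartinLofRandom hU h.1
      obtain ⟨k, hk⟩ := hML W hW hWP
      exact hemb ω hω k hk
  · intro Φinf f hE
    have hS := hE.toRandom
    have := hS.prob.isProb
    obtain ⟨W, hW, hWP, hemb⟩ := hS.exists_test_isStringEmbedding_distK hU c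
    obtain ⟨W', hW', hWP', hemb'⟩ := hE.exists_test_isStringEmbedding_distKm hU hM c
    refine ⟨?_, ?_, ?_⟩
    · obtain ⟨C₀, hself⟩ := hU.exists_condK_self_le
      obtain ⟨C₃, hKm⟩ := hM.exists_condKm_le_condK hU
      obtain ⟨C₁, hup⟩ := hE.exists_condKm_le hU hM
      obtain ⟨C₂, hswap⟩ := hU.exists_pairK_swap_le
      refine ⟨C₁ + C₂ + |c| + (C₀ + C₃ : ℕ), fun δ hδ hsum => ?_⟩
      have : ∀ s : {s : ℕ // 1 ≤ s}, Finite (repSet rep s) := fun s =>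
        (hS.finite_repSet s.2).to_subtype
      obtain ⟨ω, hω, hlow⟩ := hS.exists_neg_logb_le (C := condKm M)
        (fun s hs w _ y => hE.kraft hM hs w y)
        (ι := Σ s : {s : ℕ // 1 ≤ s}, repSet rep s × repSet rep s) (fun i => i.1) (fun i => i.1.2)
        (fun i => i.2.1) (fun i => i.2.2) (fun i => i.2.1.2) (fun i => i.2.2.2)
        -- The union bound runs over the pairs of all scales at once, which gives a single outcome.
        (fun i => δ i.1 i.2.1 i.2.2) (fun i => hδ _ i.1.2 _ i.2.1.2 _ i.2.2.2)
        (by rwa [ENNReal.tsum_sigma' (fun i : Σ s : {s : ℕ // 1 ≤ s}, repSet rep s × repSet rep s =>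
          ENNReal.ofReal (δ i.1 i.2.1 i.2.2))])
      refine ⟨ω, hω, fun s hs v v' => ?_⟩
      have hv : rep s v ∈ repSet rep s := ⟨v, rfl⟩
      have hv' : rep s v' ∈ repSet rep s := ⟨v', rfl⟩
      have h1 := hlow ⟨⟨s, hs⟩, ⟨_, hv⟩, ⟨_, hv'⟩⟩
      have h2 := hlow ⟨⟨s, hs⟩, ⟨_, hv'⟩, ⟨_, hv⟩⟩
      have h3 := hup s hs _ hv _ hv' ω hω
      have h4 := hup s hs _ hv' _ hv ω hω
      have h5 : (pairK U (name s (rep s v')) (name s (rep s v)) : ℝ) ≤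
          pairK U (name s (rep s v)) (name s (rep s v')) + C₂ := by exact_mod_cast hswap _ _
      have hC₁ : (0 : ℝ) ≤ C₁ := by positivity
      have hC₂ : (0 : ℝ) ≤ C₂ := by positivity
      set m := max (max (-Real.logb 2 (δ s (rep s v) (rep s v')))
        (-Real.logb 2 (δ s (rep s v') (rep s v))))
        (pairK U (name s (rep s v)) (name s (rep s v')) : ℝ) with hm
      have m1 : -Real.logb 2 (δ s (rep s v) (rep s v')) ≤ m :=
        (le_max_left _ _).trans (le_max_left _ _)
      have m2 : -Real.logb 2 (δ s (rep s v') (rep s v)) ≤ m :=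
        (le_max_right _ _).trans (le_max_left _ _)
      have m3 : (pairK U (name s (rep s v)) (name s (rep s v')) : ℝ) ≤ m := le_max_right _ _
      refine (hS.abs_complexityDist_sub_randDist_le (C₀ := C₀ + C₃) (L := m + C₁ + C₂)
        (fun x => (hKm x x).trans (Nat.add_le_add_right (hself x) _)) hs v v' hω
        ?_ ?_ ?_ ?_).trans (by linarith) <;> linarith
    -- Level `2` of each of the two tests leaves a total measure of at most one half, so one outcome
    -- serves both distances.
    · obtain ⟨ω, hω, hωW⟩ := hS.exists_mem_not_mem_of_measure_lt_one
        (B := testSet W 2 ∪ testSet W' 2) (by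
          refine (measure_union_le _ _).trans_lt ((add_le_add (hWP 2) (hWP' 2)).trans_lt ?_)
          rw [← two_mul, pow_two, ← mul_assoc, ENNReal.mul_inv_cancel (by simp) (by simp), one_mul]
          exact ENNReal.one_half_lt_one)
      rw [Set.mem_union, not_or] at hωW
      exact ⟨ω, hω, hE.isSequenceEmbedding hω (hemb ω hω 2 hωW.1),
        hE.isSequenceEmbedding hω (hemb' ω hω 2 hωW.2)⟩
    · rintro ω hω hrand
      have hML : IsMartinLofRandom P ω := hrand.elim id fun h => h.2.isMartinLofRandom hU h.1
      obtain ⟨k, hk⟩ := hML W hW hWP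
      obtain ⟨k', hk'⟩ := hML W' hW' hWP'
      exact ⟨hE.isSequenceEmbedding hω (hemb ω hω k hk),
        hE.isSequenceEmbedding hω (hemb' ω hω k' hk')⟩
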